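/- Consider finite simplicial complexes $\Delta$ of dimension two with underlying topological space $|\Delta|$. Such a $\Delta$ is a triangulation of the orientable surface $M_4$ of genus $4$ if $|\Delta|$ is a closed connected surface (a compact connected $2$-manifold without boundary) that is orientable and has Euler characteristic $f_0-f_1+f_2=-6$, where $f_k$ is the number of $k$-dimensional faces of $\Delta$. It is vertex-minimal if no triangulation of $M_4$ has fewer vertices. A polyhedral embedding of $\Delta$ in $\mathbb R^3$ is an injective map $\phi:|\Delta|\to\mathbb R^3$ that is linear on each simplex, and thus determined by the positions of the vertices. It has $2$-fold rotational symmetry if there are a rotation $R$ of $\mathbb R^3$ by the angle $\pi$ about some line and a simplicial automorphism $\sigma$ of $\Delta$ with $R(\phi(|\Delta|))=\phi(|\Delta|)$ and $R\circ\phi=\phi\circ|\sigma|$, where $|\sigma|:|\Delta|\to|\Delta|$ is the map induced by $\sigma$. Theorem. There are at least $28$ pairwise non-isomorphic vertex-minimal triangulations of $M_4$ with $11$ vertices, each of which has a polyhedral embedding in $\mathbb R^3$ with $2$-fold rotational symmetry. -/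

import Mathlib

open scoped BigOperators

noncomputable section

namespace TriangulatedSurface

/-- Euclidean three-space. -/
abbrev E3 : Type := EuclideanSpace ℝ (Fin 3)

/-- A closed surface in the sense of a compact connected `2`-manifold: a compact connected Hausdorff
space that is locally homeomorphic to the Euclidean plane. -/
structure IsClosedConnectedSurface (X : Type*) [TopologicalSpace X] : Prop where
  compact : CompactSpace X
  hausdorff : T2Space X
  connected : ConnectedSpace X
  locally_plane : ∀ x : X,
    ∃ e : OpenPartialHomeomorph X (EuclideanSpace ℝ (Fin 2)), x ∈ e.source

section Complex

variable {V : Type*}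

/-- The underlying topological space `|K|` of a finite simplicial complex, in barycentric
coordinates: all convex weights on the vertex set that are supported on some face of `K`. It carries
the topology induced from `V → ℝ`. -/
def polyhedron [Fintype V] (K : AbstractSimplicialComplex V) : Set (V → ℝ) :=
  {x | x ∈ stdSimplex ℝ V ∧ ∃ s ∈ K.faces, ∀ v, v ∉ s → x v = 0}

/-- `K` is two-dimensional: every face has at most three vertices and some face has three. -/
def IsTwoDimensional (K : AbstractSimplicialComplex V) : Prop :=
  (∀ s ∈ K.faces, s.card ≤ 3) ∧ ∃ s ∈ K.faces, s.card = 3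

/-- The number of `k`-dimensional faces (faces with `k + 1` vertices). -/
def faceCount (K : AbstractSimplicialComplex V) (k : ℕ) : ℕ :=
  Set.ncard {s : Finset V | s ∈ K.faces ∧ s.card = k + 1}

/-- The Euler characteristic `f₀ - f₁ + f₂` of a two-dimensional complex. -/
def eulerChar (K : AbstractSimplicialComplex V) : ℤ :=
  (faceCount K 0 : ℤ) - (faceCount K 1 : ℤ) + (faceCount K 2 : ℤ)

/-- A coherent orientation of the triangles of `K`: for every triangle one of its two cyclic
orderings is chosen (`O` is the set of all triples that list the vertices of a triangle in its
chosen cyclic order), such that no two triangles induce the same direction on a common edge. -/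
structure IsCoherentOrientation [DecidableEq V] (K : AbstractSimplicialComplex V)
    (O : Set (V × V × V)) : Prop where
  triangle : ∀ a b c, (a, b, c) ∈ O →
    a ≠ b ∧ b ≠ c ∧ a ≠ c ∧ ({a, b, c} : Finset V) ∈ K.faces
  cyclic : ∀ a b c, (a, b, c) ∈ O → (b, c, a) ∈ O
  choice : ∀ a b c, a ≠ b → b ≠ c → a ≠ c → ({a, b, c} : Finset V) ∈ K.faces →
    ((a, b, c) ∈ O ↔ (b, a, c) ∉ O)
  coherent : ∀ a b c d, (a, b, c) ∈ O → (a, b, d) ∈ O → c = d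

/-- `K` is a triangulation of the orientable surface of genus `g`: it is a two-dimensional simplicial
complex whose underlying space is a closed connected surface, and this surface is orientable and has
Euler characteristic `2 - 2 g`. -/
structure IsOrientableTriangulation [Fintype V] [DecidableEq V]
    (K : AbstractSimplicialComplex V) (g : ℕ) : Prop where
  two_dimensional : IsTwoDimensional K
  surface : IsClosedConnectedSurface (polyhedron K)
  orientable : ∃ O : Set (V × V × V), IsCoherentOrientation K O
  genus : eulerChar K = 2 - 2 * (g : ℤ)

/-- `K` is a triangulation of the orientable surface of genus `g`, and no triangulation of that
surface has fewer vertices. (All elements of the vertex type are vertices of the complex.) -/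
def IsVertexMinimalTriangulation [Fintype V] [DecidableEq V]
    (K : AbstractSimplicialComplex V) (g : ℕ) : Prop :=
  IsOrientableTriangulation K g ∧
    ∀ (m : ℕ) (L : AbstractSimplicialComplex (Fin m)),
      IsOrientableTriangulation L g → Fintype.card V ≤ m

/-- The bijection `e` of the vertex sets is an isomorphism of simplicial complexes. -/
def IsIsomorphism {W : Type*} (K : AbstractSimplicialComplex V) (L : AbstractSimplicialComplex W)
    (e : V ≃ W) : Prop :=
  ∀ s : Finset V, s ∈ K.faces ↔ s.map e.toEmbedding ∈ L.faces

/-- Combinatorial isomorphism of simplicial complexes. -/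
def Isomorphic {W : Type*} (K : AbstractSimplicialComplex V) (L : AbstractSimplicialComplex W) :
    Prop :=
  ∃ e : V ≃ W, IsIsomorphism K L e

/-- The simplexwise linear map induced by the vertex positions `ψ`. -/
def simplexwiseLinear [Fintype V] (ψ : V → E3) (x : V → ℝ) : E3 :=
  ∑ v, x v • ψ v

/-- The vertex positions `ψ` give a polyhedral embedding of `K` in three-space: the induced
simplexwise linear map on `|K|` is injective. -/
def IsPolyhedralEmbedding [Fintype V] (K : AbstractSimplicialComplex V) (ψ : V → E3) : Prop :=
  Set.InjOn (simplexwiseLinear ψ) (polyhedron K)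

/-- A rotation by the angle `π` about a line of three-space. This is the map that fixes the line
pointwise and is `-1` on the directions orthogonal to it, which Mathlib calls the reflection in
that line. -/
def IsHalfTurn (R : E3 ≃ᵃⁱ[ℝ] E3) : Prop :=
  ∃ (ℓ : AffineSubspace ℝ E3) (_ : Nonempty ℓ),
    Module.finrank ℝ ℓ.direction = 1 ∧ R = EuclideanGeometry.reflection ℓ

/-- The isometry `R` is a geometric symmetry of the realization of `K` given by `ψ`: it maps the
image of `|K|` onto itself, and there it is induced by a simplicial automorphism `σ` of `K`, acting
on `|K|` by `x ↦ x ∘ σ⁻¹`. -/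
def IsGeometricSymmetry [Fintype V] (K : AbstractSimplicialComplex V) (ψ : V → E3)
    (R : E3 ≃ᵃⁱ[ℝ] E3) : Prop :=
  R '' (simplexwiseLinear ψ '' polyhedron K) = simplexwiseLinear ψ '' polyhedron K ∧
    ∃ σ : Equiv.Perm V, IsIsomorphism K K σ ∧
      ∀ x ∈ polyhedron K, R (simplexwiseLinear ψ x) = simplexwiseLinear ψ (fun v => x (σ.symm v))

end Complex

end TriangulatedSurface

end

/-! The bound of eleven vertices is Heawood's. In a closed surface every edge lies in at least two
triangles, so `2 f₁ ≤ 3 f₂`. Together with `f₀ - f₁ + f₂ = -6` this gives `f₁ ≥ 3 f₀ + 18`, which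
exceeds `f₀.choose 2` whenever `f₀ ≤ 10` (`eleven_le_card`). Since a surface is here a topological
manifold, the statement on edges needs a topological reason (`exists_two_triangles`). If an edge lay
in at most one triangle, a small punctured neighbourhood of its midpoint would contract along
segments, inside itself, to one or two points. A punctured neighbourhood in the plane contains a
circle of winding number one and does not contract like that (`not_deformation_of_chart`).

The existence part is a finite certificate, checked by kernel evaluation. A surface is given by the
cyclic links of its eleven vertices. If the oriented triangles read off from the links are closed
under cyclic permutation, they form an oriented complex in which every vertex star is a cone over a
cycle. Such a star is mapped onto a regular polygon in the plane, which gives the manifold charts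
(`exists_chart_of_cyclic_link`). A vertex joined to all others gives connectedness, and the sum of
the degrees gives the genus.

Each surface comes with integer coordinates. Two points of the polyhedron with the same image lie in
two listed triangles, and it suffices to treat each pair of triangles. Either a linear functional
separates them strictly except at common vertices (`eq_of_separating_function`), or both lie in one
nondegenerate tetrahedron, on which the map is injective by Cramer's rule (`eq_of_volume_ne_zero`).

The symmetry is the half-turn about the third axis: vertex `0` lies on the axis, the other vertices
form pairs exchanged by it, and the swap of the pairs preserves the triangles. Non-isomorphism
follows from an integer invariant (`triangleInvariant`), an iterated sum over the triangles at a
vertex, which takes 28 different values. -/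

noncomputable section

namespace TriangulatedSurface

/-! ### Punctured neighbourhoods in a surface and the winding number -/

open Topology

/-- A punctured neighbourhood of a point of a surface does not contract to a locally constant map:
otherwise the identity of a small circle of the plane would have a continuous logarithm. -/
theorem not_deformation_of_chart {X : Type*} [TopologicalSpace X] {x₀ : X}
    (φ : OpenPartialHomeomorph X ℂ) {N : Set X} (hN : IsOpen N) (hx₀ : x₀ ∈ N)
    (hNφ : N ⊆ φ.source) (c : ↥(N \ {x₀}) → ↥(N \ {x₀})) (hc : IsLocallyConstant c)
    (H : C(unitInterval × ↥(N \ {x₀}), ↥(N \ {x₀})))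
    (H0 : ∀ x, H (0, x) = c x) (H1 : ∀ x, H (1, x) = x) : False := by
  let S := ↥(N \ {x₀})
  have hne : ∀ x : S, φ x - φ x₀ ≠ 0 := fun x h =>
    x.2.2 (φ.injOn (hNφ x.2.1) (hNφ hx₀) (sub_eq_zero.1 h))
  have hgc : Continuous fun x : S => φ x - φ x₀ := by
    refine Continuous.sub ?_ continuous_const
    exact φ.continuousOn.comp_continuous continuous_subtype_val fun x => hNφ x.2.1
  let g : C(S, {z : ℂ // z ≠ 0}) := ⟨fun x => ⟨φ x - φ x₀, hne x⟩, hgc.subtype_mk _⟩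
  -- The principal logarithm is discontinuous, but composed with the locally constant `c` it is a
  -- continuous logarithm at time `0`. Lifting the homotopy through `exp` carries it to time `1`,
  -- where it is a logarithm of `φ x - φ x₀` itself.
  have hf : IsLocallyConstant fun x : S => Complex.log (φ (c x) - φ x₀) :=
    hc.comp fun y : S => Complex.log (φ y - φ x₀)
  let f : C(S, ℂ) := ⟨_, hf.continuous⟩
  let G : C(unitInterval × S, {z : ℂ // z ≠ 0}) := g.comp H
  have hG0 : ∀ a, G (0, a) = (⟨_, Complex.exp_ne_zero (f a)⟩ : {z : ℂ // z ≠ 0}) := by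
    intro a
    apply Subtype.ext
    change φ (H (0, a)) - φ x₀ = Complex.exp (Complex.log (φ (c a) - φ x₀))
    rw [H0, Complex.exp_log (hne _)]
  let h := Complex.isCoveringMap_exp.liftHomotopy G f hG0
  have hlift : ∀ x : S, Complex.exp (h (1, x)) = φ x - φ x₀ := by
    intro x
    have := congrFun (Complex.isCoveringMap_exp.liftHomotopy_lifts G f hG0) (1, x)
    have h2 := congrArg Subtype.val this
    change Complex.exp (h (1, x)) = φ (H (1, x)) - φ x₀ at h2
    rw [h2, H1]
  -- a small circle around the image of the point
  have hopen : IsOpen (φ '' N) := φ.isOpen_image_of_subset_source hN hNφ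
  obtain ⟨ε, hε, hball⟩ := Metric.isOpen_iff.1 hopen (φ x₀) ⟨x₀, hx₀, rfl⟩
  let q : ℝ → ℂ := fun t => φ x₀ + (ε / 2 : ℝ) * Complex.exp (t * Complex.I)
  have hqb : ∀ t, q t ∈ φ '' N := by
    intro t
    apply hball
    have : ‖q t - φ x₀‖ = ε / 2 := by
      simp only [q, add_sub_cancel_left, norm_mul, Complex.norm_exp_ofReal_mul_I, mul_one,
        Complex.norm_real, Real.norm_eq_abs]
      exact abs_of_pos (by positivity)
    rw [Metric.mem_ball, dist_eq_norm, this]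
    linarith
  have hq0 : ∀ t, q t ≠ φ x₀ := by
    intro t h
    have : ((ε / 2 : ℝ) : ℂ) * Complex.exp (t * Complex.I) = 0 := by simpa [q] using h
    rcases mul_eq_zero.1 this with h | h
    · have := Complex.ofReal_eq_zero.1 h
      linarith
    · exact Complex.exp_ne_zero _ h
  have hqt : ∀ t, q t ∈ φ.target := fun t => by
    obtain ⟨y, hy, h⟩ := hqb t
    exact h ▸ φ.map_source (hNφ hy)
  have hmem : ∀ t, φ.symm (q t) ∈ N \ {x₀} := by
    intro t
    obtain ⟨y, hy, h⟩ := hqb t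
    rw [← h, φ.left_inv (hNφ hy)]
    refine ⟨hy, fun h' => hq0 t ?_⟩
    rw [← h, Set.mem_singleton_iff.1 h']
  have hqc : Continuous q := by fun_prop
  have hγc : Continuous fun t => φ.symm (q t) :=
    φ.continuousOn_symm.comp_continuous hqc hqt
  let γ : ℝ → S := fun t => ⟨φ.symm (q t), hmem t⟩
  have hγ : Continuous γ := hγc.subtype_mk _
  have hexp : ∀ t : ℝ, Complex.exp (h (1, γ t) - t * Complex.I) = (ε / 2 : ℝ) := by
    intro t
    rw [Complex.exp_sub, hlift]
    have : φ (γ t) = q t := φ.right_inv (hqt t)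
    rw [this, div_eq_iff (Complex.exp_ne_zero _)]
    simp [q]
  have hcont : Continuous fun t : ℝ => h (1, γ t) - t * Complex.I := by fun_prop
  -- The function `h (1, γ t) - t i` takes values in a single fibre of `exp`, so it is constant on
  -- the line. Since `γ` closes up after `2π`, this forces `2π i = 0`.
  have hconst := Complex.isCoveringMap_exp.const_of_comp hcont
    (fun a a' => by
      apply Subtype.ext
      change Complex.exp _ = Complex.exp _
      rw [hexp, hexp]) 0 (2 * Real.pi)
  have hperiod : γ (2 * Real.pi) = γ 0 := by
    have : q (2 * Real.pi) = q 0 := by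
      simp [q, Complex.exp_two_pi_mul_I]
    exact Subtype.ext (congrArg φ.symm this)
  simp only [hperiod, Complex.ofReal_zero, zero_mul, sub_zero] at hconst
  have : ((2 * Real.pi : ℝ) : ℂ) * Complex.I = 0 := by linear_combination hconst
  simp [Real.pi_ne_zero] at this

open Topology

/-! ### Every edge of a triangulated surface lies in two triangles -/

section Edge

variable {V : Type*} [Fintype V]

/-- Let `u` and `v` span an edge whose star is the simplex `A`. If the complement of an interior
point `m` of the edge in a small neighbourhood is contracted along segments to a locally constant
map, then the underlying space is not a surface at `m`. -/
theorem not_deformation_of_edge (K : AbstractSimplicialComplex V)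
    {u v : V} {A : Finset V} (hA : A ∈ K.faces)
    (hstar : ∀ s ∈ K.faces, u ∈ s → v ∈ s → s ⊆ A)
    (m : polyhedron K) (hmu : 0 < m.1 u) (hmv : 0 < m.1 v)
    (e : OpenPartialHomeomorph (polyhedron K) (EuclideanSpace ℝ (Fin 2))) (hme : m ∈ e.source)
    (hc : ∀ r > 0, ∃ c : polyhedron K → polyhedron K,
      (∀ x, 0 < (c x).1 u ∧ 0 < (c x).1 v ∧ dist (c x).1 m.1 < r) ∧
      (∀ x, 0 < x.1 u → 0 < x.1 v → x ≠ m → ∃ U, IsOpen U ∧ x ∈ U ∧ ∀ y ∈ U, c y = c x) ∧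
      ∀ x, 0 < x.1 u → 0 < x.1 v → x ≠ m → ∀ t ∈ Set.Icc (0 : ℝ) 1,
        (1 - t) • (c x).1 + t • x.1 ≠ m.1) : False := by
  obtain ⟨r, hr, hball⟩ := Metric.isOpen_iff.1 e.open_source m hme
  obtain ⟨c, hcN, hcl, hcm⟩ := hc r hr
  let N : Set (polyhedron K) := {x | 0 < x.1 u ∧ 0 < x.1 v ∧ dist x.1 m.1 < r}
  have hN : IsOpen N := by
    have h1 : Continuous fun x : polyhedron K => x.1 u :=
      (continuous_apply u).comp continuous_subtype_val
    have h2 : Continuous fun x : polyhedron K => x.1 v :=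
      (continuous_apply v).comp continuous_subtype_val
    have h3 : Continuous fun x : polyhedron K => dist x.1 m.1 := by fun_prop
    exact (isOpen_lt continuous_const h1).inter
      ((isOpen_lt continuous_const h2).inter (isOpen_lt h3 continuous_const))
  have hmN : m ∈ N := ⟨hmu, hmv, by simpa using hr⟩
  have hsupp : ∀ x ∈ N, ∀ w, w ∉ A → x.1 w = 0 := by
    intro x hx w hw
    obtain ⟨s, hs, h⟩ := x.2.2
    have hu : u ∈ s := by by_contra h'; exact hx.1.ne' (h u h')
    have hv : v ∈ s := by by_contra h'; exact hx.2.1.ne' (h v h')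
    exact h w fun h' => hw (hstar s hs hu hv h')
  -- All points of `N` are supported on the one face `A`, so `N` is convex although the polyhedron
  -- is not. This allows a straight-line homotopy.
  have hcomb : ∀ x ∈ N, ∀ y ∈ N, ∀ t ∈ Set.Icc (0 : ℝ) 1,
      ∃ h : (1 - t) • x.1 + t • y.1 ∈ polyhedron K, (⟨_, h⟩ : polyhedron K) ∈ N := by
    intro x hx y hy t ht
    have ht' : 0 ≤ 1 - t := by linarith [ht.2]
    have hpos : ∀ a b : ℝ, 0 < a → 0 < b → 0 < (1 - t) * a + t * b := by
      intro a b ha hb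
      rcases ht.1.eq_or_lt with h | h
      · rw [← h]; simpa using ha
      · have := mul_pos h hb
        have := mul_nonneg ht' ha.le
        linarith
    refine ⟨⟨convex_stdSimplex ℝ V x.2.1 y.2.1 ht' ht.1 (by ring), A, hA, fun w hw => ?_⟩,
      hpos _ _ hx.1 hy.1, hpos _ _ hx.2.1 hy.2.1, ?_⟩
    · simp [hsupp x hx w hw, hsupp y hy w hw]
    · have := convex_ball m.1 r (Metric.mem_ball.2 hx.2.2) (Metric.mem_ball.2 hy.2.2) ht' ht.1
        (by ring)
      exact Metric.mem_ball.1 this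
  let S := ↥(N \ {m})
  have hS : ∀ x : S, x.1 ≠ m := fun x h => x.2.2 h
  have hcS : ∀ x : S, c x.1 ∈ N \ {m} := by
    intro x
    refine ⟨hcN x.1, fun h => ?_⟩
    -- That `c x` differs from `m` is the case `t = 0` of the hypothesis that the segment avoids
    -- `m`.
    apply hcm x.1 x.2.1.1 x.2.1.2.1 (hS x) 0 ⟨le_rfl, zero_le_one⟩
    rw [Set.mem_singleton_iff.1 h]
    simp
  have hHmem : ∀ p : unitInterval × S,
      ∃ h : (1 - (p.1 : ℝ)) • (c p.2.1).1 + (p.1 : ℝ) • p.2.1.1 ∈ polyhedron K,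
        (⟨_, h⟩ : polyhedron K) ∈ N \ {m} := by
    intro p
    obtain ⟨h, h'⟩ := hcomb _ (hcS p.2).1 _ p.2.2.1 p.1 p.1.2
    exact ⟨h, h', fun h'' =>
      hcm p.2.1 p.2.2.1.1 p.2.2.1.2.1 (hS p.2) p.1 p.1.2 (congrArg Subtype.val h'')⟩
  have hloc : IsLocallyConstant fun x : S => (⟨c x.1, hcS x⟩ : S) := by
    refine (IsLocallyConstant.iff_exists_open _).2 fun x => ?_
    obtain ⟨U, hU, hxU, h⟩ := hcl x.1 x.2.1.1 x.2.1.2.1 (hS x)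
    exact ⟨_, hU.preimage continuous_subtype_val, hxU, fun y hy => Subtype.ext (h y.1 hy)⟩
  have hHc : Continuous fun p : unitInterval × S =>
      (1 - (p.1 : ℝ)) • (c p.2.1).1 + (p.1 : ℝ) • p.2.1.1 := by
    have hc' : Continuous fun p : unitInterval × S => (c p.2.1).1 :=
      continuous_subtype_val.comp (continuous_subtype_val.comp (hloc.continuous.comp continuous_snd))
    have ht : Continuous fun p : unitInterval × S => (p.1 : ℝ) :=
      continuous_subtype_val.comp continuous_fst
    have hx : Continuous fun p : unitInterval × S => p.2.1.1 :=
      continuous_subtype_val.comp (continuous_subtype_val.comp continuous_snd)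
    exact ((continuous_const.sub ht).smul hc').add (ht.smul hx)
  let H : C(unitInterval × S, S) :=
    ⟨fun p => ⟨⟨_, (hHmem p).1⟩, (hHmem p).2⟩, (hHc.subtype_mk _).subtype_mk _⟩
  let φ := e.transHomeomorph Complex.orthonormalBasisOneI.repr.symm.toHomeomorph
  refine not_deformation_of_chart (x₀ := m) φ hN hmN (fun x hx => hball hx.2.2) _ hloc H ?_ ?_
  · intro x
    apply Subtype.ext; apply Subtype.ext
    change (1 - ((0 : unitInterval) : ℝ)) • (c x.1).1 + ((0 : unitInterval) : ℝ) • x.1.1 = (c x.1).1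
    simp
  · intro x
    apply Subtype.ext; apply Subtype.ext
    change (1 - ((1 : unitInterval) : ℝ)) • (c x.1).1 + ((1 : unitInterval) : ℝ) • x.1.1 = x.1.1
    simp

variable [DecidableEq V]

/-- The combination of two points of a face with weights `1/2 + t` and `1/2 - t`. -/
theorem smul_single_add_mem_polyhedron (K : AbstractSimplicialComplex V) {u v w : V}
    (h : ({u, v, w} : Finset V) ∈ K.faces) {a b c : ℝ} (ha : 0 ≤ a) (hb : 0 ≤ b) (hc : 0 ≤ c)
    (habc : a + b + c = 1) :
    (Pi.single u a + Pi.single v b + Pi.single w c : V → ℝ) ∈ polyhedron K := by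
  refine ⟨⟨fun x => ?_, ?_⟩, _, h, fun x hx => ?_⟩
  · have h1 : 0 ≤ (Pi.single u a : V → ℝ) x := by
      by_cases h : x = u
      · subst h; simpa
      · simp [h]
    have h2 : 0 ≤ (Pi.single v b : V → ℝ) x := by
      by_cases h : x = v
      · subst h; simpa
      · simp [h]
    have h3 : 0 ≤ (Pi.single w c : V → ℝ) x := by
      by_cases h : x = w
      · subst h; simpa
      · simp [h]
    simp only [Pi.add_apply]
    linarith
  · simp [Finset.sum_add_distrib, habc]
  · simp only [Finset.mem_insert, Finset.mem_singleton, not_or] at hx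
    simp [hx.1, hx.2.1, hx.2.2]

/-- In a triangulated surface every edge lies in two triangles. -/
theorem exists_two_triangles (K : AbstractSimplicialComplex V)
    (hK : ∀ s ∈ K.faces, s.card ≤ 3) (hS : IsClosedConnectedSurface (polyhedron K))
    {u v : V} (huv : u ≠ v) (he : ({u, v} : Finset V) ∈ K.faces) :
    ∃ a b, a ≠ b ∧ a ≠ u ∧ a ≠ v ∧ b ≠ u ∧ b ≠ v ∧
      ({u, v, a} : Finset V) ∈ K.faces ∧ ({u, v, b} : Finset V) ∈ K.faces := by
  by_contra hcon
  push Not at hcon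
  -- The edge is written as a degenerate triangle, so that the lemma on points of triangles also
  -- produces points of the edge.
  have he' : ({u, v, u} : Finset V) ∈ K.faces := by
    have : ({u, v, u} : Finset V) = {u, v} := by ext; simp; tauto
    rwa [this]
  let m : polyhedron K := ⟨_, smul_single_add_mem_polyhedron K he' (a := 1 / 2) (b := 1 / 2)
    (c := 0) (by norm_num) (by norm_num) le_rfl (by norm_num)⟩
  have hmu : m.1 u = 1 / 2 := by simp [m, huv]
  have hmv : m.1 v = 1 / 2 := by simp [m, huv.symm]
  have hmw : ∀ w, w ≠ u → w ≠ v → m.1 w = 0 := fun w h1 h2 => by simp [m, h1, h2]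
  obtain ⟨e, hme⟩ := hS.locally_plane m
  have hthird : ∀ s ∈ K.faces, u ∈ s → v ∈ s → s = {u, v} ∨
      ∃ a, a ≠ u ∧ a ≠ v ∧ s = {u, v, a} := by
    intro s hs hu hv
    have hsub : {u, v} ⊆ s := by
      intro x hx
      rcases Finset.mem_insert.1 hx with h | h
      · exact h ▸ hu
      · exact Finset.mem_singleton.1 h ▸ hv
    by_cases h2 : s = {u, v}
    · exact Or.inl h2
    right
    obtain ⟨a, has, ha⟩ : ∃ a ∈ s, a ∉ ({u, v} : Finset V) := by
      by_contra h
      push Not at h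
      exact h2 (Finset.Subset.antisymm h hsub)
    have hau : a ≠ u := fun h => ha (by simp [h])
    have hav : a ≠ v := fun h => ha (by simp [h])
    refine ⟨a, hau, hav, (Finset.eq_of_subset_of_card_le (fun x hx => ?_) ?_).symm⟩
    · simp only [Finset.mem_insert, Finset.mem_singleton] at hx
      rcases hx with rfl | rfl | rfl <;> assumption
    · rw [Finset.card_eq_three.2 ⟨u, v, a, huv, hau.symm, hav.symm, rfl⟩]
      exact hK s hs
  by_cases hw : ∃ w, w ≠ u ∧ w ≠ v ∧ ({u, v, w} : Finset V) ∈ K.faces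
  · obtain ⟨w, hwu, hwv, hwf⟩ := hw
    have hstar : ∀ s ∈ K.faces, u ∈ s → v ∈ s → s ⊆ {u, v, w} := by
      intro s hs hu hv
      rcases hthird s hs hu hv with rfl | ⟨a, hau, hav, rfl⟩
      · intro x; simp; tauto
      · by_cases haw : a = w
        · rw [haw]
        · exact absurd hwf (hcon a w haw hau hav hwu hwv hs)
    refine not_deformation_of_edge K hwf hstar m (by simp [hmu]) (by simp [hmv]) e hme ?_
    intro r hr
    -- One triangle `{u, v, w}`: everything contracts to one point `p` inside the triangle. The
    -- bound `1 / 4` keeps the weights of `p` positive, and `r / 2` keeps `p` within distance `r` of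
    -- `m`.
    let δ := min (r / 2) (1 / 4)
    have hδ : 0 < δ := lt_min (by positivity) (by norm_num)
    have hδ' : δ ≤ 1 / 4 := min_le_right _ _
    have hδr : δ < r := (min_le_left _ _).trans_lt (by linarith)
    let p : polyhedron K := ⟨_, smul_single_add_mem_polyhedron K hwf (a := 1 / 2 - δ / 2)
      (b := 1 / 2 - δ / 2) (c := δ) (by linarith) (by linarith) hδ.le (by ring)⟩
    have hpu : p.1 u = 1 / 2 - δ / 2 := by simp [p, huv, hwu.symm]
    have hpv : p.1 v = 1 / 2 - δ / 2 := by simp [p, huv.symm, hwv.symm]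
    have hpw : p.1 w = δ := by simp [p, hwu, hwv]
    refine ⟨fun _ => p, fun x => ⟨?_, ?_, ?_⟩, fun x _ _ _ => ⟨Set.univ, isOpen_univ, trivial,
      fun _ _ => rfl⟩, fun x hxu hxv hxm t ht h => ?_⟩
    · rw [hpu]; linarith
    · rw [hpv]; linarith
    · refine (dist_pi_le_iff hδ.le).2 (fun y => ?_) |>.trans_lt hδr
      by_cases hyu : y = u
      · rw [hyu, hpu, hmu, Real.dist_eq, abs_le]; constructor <;> linarith
      by_cases hyv : y = v
      · rw [hyv, hpv, hmv, Real.dist_eq, abs_le]; constructor <;> linarith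
      by_cases hyw : y = w
      · rw [hyw, hpw, hmw w hwu hwv, Real.dist_eq, abs_le]; constructor <;> linarith
      · rw [hmw y hyu hyv]
        simp [p, hyu, hyv, hyw, hδ.le]
    -- The weight at `w` is positive at `p`, nonnegative at `x` and zero at `m`. Hence the segment
    -- from `p` to `x` can meet `m` only at `t = 1`, that is, if `x = m`.
    · have h1 := congrFun h w
      simp only [Pi.add_apply, Pi.smul_apply, smul_eq_mul, hpw, hmw w hwu hwv] at h1
      have hxw := x.2.1.1 w
      have h2 := mul_nonneg ht.1 hxw
      have h3 := mul_nonneg (sub_nonneg.2 ht.2) hδ.le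
      have h4 : (1 - t) * δ = 0 := by linarith
      have ht1 : t = 1 := by
        rcases mul_eq_zero.1 h4 with h | h <;> linarith
      apply hxm
      apply Subtype.ext
      rw [← h, ht1]
      simp
  · push Not at hw
    have hstar : ∀ s ∈ K.faces, u ∈ s → v ∈ s → s ⊆ {u, v, u} := by
      intro s hs hu hv
      rcases hthird s hs hu hv with rfl | ⟨a, hau, hav, rfl⟩
      · intro x; simp; tauto
      · exact absurd hs (hw a hau hav)
    refine not_deformation_of_edge K he' hstar m (by simp [hmu]) (by simp [hmv]) e hme ?_
    intro r hr
    let δ := min (r / 2) (1 / 4)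
    have hδ : 0 < δ := lt_min (by positivity) (by norm_num)
    have hδ' : δ ≤ 1 / 4 := min_le_right _ _
    have hδr : δ < r := (min_le_left _ _).trans_lt (by linarith)
    -- No triangle: near `m` the space is an open interval, and `m` cuts it into two halves, which
    -- contract to `p` and `q`. The map is locally constant away from `m`, which is all that is
    -- required.
    let p : polyhedron K := ⟨_, smul_single_add_mem_polyhedron K he' (a := 1 / 2 + δ)
      (b := 1 / 2 - δ) (c := 0) (by linarith) (by linarith) le_rfl (by ring)⟩
    let q : polyhedron K := ⟨_, smul_single_add_mem_polyhedron K he' (a := 1 / 2 - δ)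
      (b := 1 / 2 + δ) (c := 0) (by linarith) (by linarith) le_rfl (by ring)⟩
    have hpu : p.1 u = 1 / 2 + δ := by simp [p, huv]
    have hpv : p.1 v = 1 / 2 - δ := by simp [p, huv.symm]
    have hqu : q.1 u = 1 / 2 - δ := by simp [q, huv]
    have hqv : q.1 v = 1 / 2 + δ := by simp [q, huv.symm]
    have hxsum : ∀ x : polyhedron K, 0 < x.1 u → 0 < x.1 v →
        (∀ w, w ≠ u → w ≠ v → x.1 w = 0) ∧ x.1 u + x.1 v = 1 := by
      intro x hxu hxv
      obtain ⟨s, hs, h⟩ := x.2.2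
      have hu : u ∈ s := by by_contra h'; exact hxu.ne' (h u h')
      have hv : v ∈ s := by by_contra h'; exact hxv.ne' (h v h')
      have h0 : ∀ w, w ≠ u → w ≠ v → x.1 w = 0 := fun w h1 h2 => h w fun h' => by
        have := hstar s hs hu hv h'
        simp [h1, h2] at this
      refine ⟨h0, ?_⟩
      rw [← x.2.1.2, ← Finset.sum_pair huv]
      exact Finset.sum_subset (Finset.subset_univ _) fun w _ hw => by
        simp only [Finset.mem_insert, Finset.mem_singleton, not_or] at hw
        exact h0 w hw.1 hw.2
    have hxne : ∀ x : polyhedron K, 0 < x.1 u → 0 < x.1 v → x ≠ m → x.1 u ≠ 1 / 2 := by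
      intro x hxu hxv hxm h
      obtain ⟨h0, h1⟩ := hxsum x hxu hxv
      apply hxm
      apply Subtype.ext
      funext y
      by_cases hyu : y = u
      · rw [hyu, h, hmu]
      by_cases hyv : y = v
      · rw [hyv, hmv]; linarith
      · rw [h0 y hyu hyv, hmw y hyu hyv]
    have hcu : Continuous fun x : polyhedron K => x.1 u :=
      (continuous_apply u).comp continuous_subtype_val
    refine ⟨fun x => if 1 / 2 < x.1 u then p else q, fun x => ?_, fun x hxu hxv hxm => ?_,
      fun x hxu hxv hxm t ht h => ?_⟩
    · have key : ∀ z : polyhedron K, |z.1 u - 1 / 2| ≤ δ → |z.1 v - 1 / 2| ≤ δ →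
          (∀ w, w ≠ u → w ≠ v → z.1 w = 0) → 0 < z.1 u ∧ 0 < z.1 v ∧ dist z.1 m.1 < r := by
        intro z hu hv hw'
        rw [abs_le] at hu hv
        refine ⟨by linarith, by linarith, (dist_pi_le_iff hδ.le).2 (fun y => ?_) |>.trans_lt hδr⟩
        by_cases hyu : y = u
        · rw [hyu, hmu, Real.dist_eq, abs_le]; exact hu
        by_cases hyv : y = v
        · rw [hyv, hmv, Real.dist_eq, abs_le]; exact hv
        · rw [hmw y hyu hyv, hw' y hyu hyv]; simpa using hδ.le
      by_cases h : 1 / 2 < x.1 u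
      · simp only [if_pos h]
        exact key p (by simp [hpu, abs_of_pos hδ]) (by rw [hpv]; simp [abs_of_pos hδ])
          fun w h1 h2 => by simp [p, h1, h2]
      · simp only [if_neg h]
        exact key q (by rw [hqu]; simp [abs_of_pos hδ]) (by simp [hqv, abs_of_pos hδ])
          fun w h1 h2 => by simp [q, h1, h2]
    · rcases lt_or_gt_of_ne (hxne x hxu hxv hxm) with h | h
      · refine ⟨_, isOpen_lt hcu continuous_const, h, fun y hy => ?_⟩
        have hy' : y.1 u < 1 / 2 := hy
        simp only [if_neg hy'.le.not_gt, if_neg h.le.not_gt]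
      · refine ⟨_, isOpen_lt continuous_const hcu, h, fun y hy => ?_⟩
        have hy' : 1 / 2 < y.1 u := hy
        simp only [if_pos hy', if_pos h]
    -- The target of the contraction and `x` lie strictly on the same side of weight `1 / 2` at `u`,
    -- hence so does the segment between them.
    · have h1 := congrFun h u
      simp only [Pi.add_apply, Pi.smul_apply, smul_eq_mul, hmu] at h1
      obtain ⟨ht0, ht1⟩ := ht
      rcases lt_or_gt_of_ne (hxne x hxu hxv hxm) with h | h
      · rw [if_neg h.le.not_gt, hqu] at h1
        rcases ht0.eq_or_lt with h0 | h0
        · subst h0; linarith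
        · nlinarith [mul_pos h0 (sub_pos.2 h)]
      · rw [if_pos h, hpu] at h1
        rcases ht0.eq_or_lt with h0 | h0
        · subst h0; linarith
        · nlinarith [mul_pos h0 (sub_pos.2 h)]

end Edge

/-! ### Double counting and Heawood's bound -/

section Counting

variable {V : Type*} [Fintype V]

open Classical in
/-- The faces of `K` with `n` vertices, as a finite set. -/
def facesOfCard (K : AbstractSimplicialComplex V) (n : ℕ) : Finset (Finset V) :=
  Finset.univ.filter fun s => s ∈ K.faces ∧ s.card = n

theorem mem_facesOfCard {K : AbstractSimplicialComplex V} {n : ℕ} {s : Finset V} :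
    s ∈ facesOfCard K n ↔ s ∈ K.faces ∧ s.card = n := by
  classical
  simp [facesOfCard]

theorem faceCount_eq_card (K : AbstractSimplicialComplex V) (k : ℕ) :
    faceCount K k = (facesOfCard K (k + 1)).card := by
  rw [faceCount, ← Set.ncard_coe_finset]
  congr 1
  ext s
  simp [mem_facesOfCard]

theorem faceCount_zero (K : AbstractSimplicialComplex V) : faceCount K 0 = Fintype.card V := by
  rw [faceCount_eq_card]
  have : facesOfCard K 1 = Finset.powersetCard 1 Finset.univ := by
    ext s
    simp only [mem_facesOfCard, Finset.mem_powersetCard, Finset.subset_univ, true_and,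
      and_iff_right_iff_imp]
    intro h
    obtain ⟨v, rfl⟩ := Finset.card_eq_one.1 h
    exact K.singleton_mem v
  rw [zero_add, this, Finset.card_powersetCard, Nat.choose_one_right, Finset.card_univ]

theorem faceCount_one_le (K : AbstractSimplicialComplex V) :
    faceCount K 1 ≤ (Fintype.card V).choose 2 := by
  rw [faceCount_eq_card, ← Finset.card_univ, ← Finset.card_powersetCard]
  exact Finset.card_le_card fun s hs => Finset.mem_powersetCard.2
    ⟨Finset.subset_univ _, (mem_facesOfCard.1 hs).2⟩

variable [DecidableEq V]

/-- Double counting of the pairs of an edge and a triangle that contains it. -/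
theorem sum_card_triangles_of_edge (K : AbstractSimplicialComplex V) :
    ∑ e ∈ facesOfCard K 2, ((facesOfCard K 3).filter (e ⊆ ·)).card = 3 * faceCount K 2 := by
  have h := Finset.sum_card_bipartiteAbove_eq_sum_card_bipartiteBelow
    (s := facesOfCard K 2) (t := facesOfCard K 3) (fun e t => e ⊆ t)
  simp only [Finset.bipartiteAbove, Finset.bipartiteBelow] at h
  rw [h, faceCount_eq_card, mul_comm, ← smul_eq_mul, ← Finset.sum_const]
  refine Finset.sum_congr rfl fun t ht => ?_
  obtain ⟨htK, ht3⟩ := mem_facesOfCard.1 ht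
  have : (facesOfCard K 2).filter (· ⊆ t) = Finset.powersetCard 2 t := by
    ext s
    simp only [Finset.mem_filter, mem_facesOfCard, Finset.mem_powersetCard]
    constructor
    · rintro ⟨⟨_, h⟩, h'⟩
      exact ⟨h', h⟩
    · rintro ⟨h, h'⟩
      exact ⟨⟨(K.isRelLowerSet_faces htK).2 h (Finset.card_pos.1 (by omega)), h'⟩, h⟩
  rw [this, Finset.card_powersetCard, ht3]
  rfl

/-- Each edge contributes at least two to the number of incident pairs of an edge and a triangle, by
`exists_two_triangles`. This is the only place where the topology enters the lower bound. -/
theorem two_mul_edges_le (K : AbstractSimplicialComplex V)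
    (hK : ∀ s ∈ K.faces, s.card ≤ 3) (hS : IsClosedConnectedSurface (polyhedron K)) :
    2 * faceCount K 1 ≤ 3 * faceCount K 2 := by
  rw [← sum_card_triangles_of_edge, faceCount_eq_card, mul_comm, ← smul_eq_mul]
  refine Finset.card_nsmul_le_sum _ _ _ fun e he => ?_
  obtain ⟨heK, he2⟩ := mem_facesOfCard.1 he
  obtain ⟨u, v, huv, rfl⟩ := Finset.card_eq_two.1 he2
  obtain ⟨a, b, hab, hau, hav, hbu, hbv, ha, hb⟩ := exists_two_triangles K hK hS huv heK
  have hsub : ∀ c, ({u, v} : Finset V) ⊆ {u, v, c} := fun c x => by simp; tauto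
  have hcard : ∀ c, c ≠ u → c ≠ v → ({u, v, c} : Finset V).card = 3 := fun c h1 h2 =>
    Finset.card_eq_three.2 ⟨u, v, c, huv, h1.symm, h2.symm, rfl⟩
  have hne : ({u, v, a} : Finset V) ≠ {u, v, b} := fun h => by
    have : a ∈ ({u, v, b} : Finset V) := by rw [← h]; simp
    simp [hab, hau, hav] at this
  rw [← Finset.card_pair hne]
  refine Finset.card_le_card fun t ht => ?_
  simp only [Finset.mem_insert, Finset.mem_singleton] at ht
  rw [Finset.mem_filter, mem_facesOfCard]
  rcases ht with rfl | rfl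
  · exact ⟨⟨ha, hcard a hau hav⟩, hsub a⟩
  · exact ⟨⟨hb, hcard b hbu hbv⟩, hsub b⟩

/-- A triangle on the edge `{u, v}` induces one of the two directions of the edge, and by coherence
each direction is induced at most once. So at most two triangles contain the edge. -/
theorem three_mul_triangles_le (K : AbstractSimplicialComplex V) {O : Set (V × V × V)}
    (hO : IsCoherentOrientation K O) : 3 * faceCount K 2 ≤ 2 * faceCount K 1 := by
  classical
  rw [← sum_card_triangles_of_edge, faceCount_eq_card, mul_comm, ← smul_eq_mul]
  refine Finset.sum_le_card_nsmul _ _ _ fun e he => ?_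
  obtain ⟨heK, he2⟩ := mem_facesOfCard.1 he
  obtain ⟨u, v, huv, rfl⟩ := Finset.card_eq_two.1 he2
  let side : V → V → Finset (Finset V) := fun a b =>
    (Finset.univ.filter fun c => (a, b, c) ∈ O).image fun c => {a, b, c}
  have hside : ∀ a b, (side a b).card ≤ 1 := by
    intro a b
    refine Finset.card_image_le.trans (Finset.card_le_one.2 fun c hc d hd => ?_)
    exact hO.coherent a b c d (Finset.mem_filter.1 hc).2 (Finset.mem_filter.1 hd).2
  have hsub : (facesOfCard K 3).filter ({u, v} ⊆ ·) ⊆ side u v ∪ side v u := by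
    intro t ht
    rw [Finset.mem_filter, mem_facesOfCard] at ht
    obtain ⟨⟨htK, ht3⟩, huvt⟩ := ht
    obtain ⟨w, hw, hwt⟩ : ∃ w, w ∉ ({u, v} : Finset V) ∧ insert w {u, v} = t := by
      have : (t \ {u, v}).card = 1 := by rw [Finset.card_sdiff_of_subset huvt]; omega
      obtain ⟨w, hw⟩ := Finset.card_eq_one.1 this
      have hw' : w ∈ t \ {u, v} := by rw [hw]; simp
      refine ⟨w, (Finset.mem_sdiff.1 hw').2, ?_⟩
      rw [Finset.insert_eq, ← hw, Finset.sdiff_union_of_subset huvt]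
    simp only [Finset.mem_insert, Finset.mem_singleton, not_or] at hw
    have h1 : ({u, v, w} : Finset V) = t := by rw [← hwt]; ext; simp; tauto
    have h2 : ({v, u, w} : Finset V) = t := by rw [← hwt]; ext; simp; tauto
    rw [Finset.mem_union]
    by_cases h : (v, u, w) ∈ O
    · exact Or.inr (Finset.mem_image.2 ⟨w, by simpa using h, h2⟩)
    · refine Or.inl (Finset.mem_image.2 ⟨w, ?_, h1⟩)
      simpa using (hO.choice u v w huv (Ne.symm hw.2) (Ne.symm hw.1) (h1 ▸ htK)).2 h
  have := Finset.card_le_card hsub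
  have := Finset.card_union_le (side u v) (side v u)
  have := hside u v
  have := hside v u
  omega

/-- Heawood's bound for genus four: a triangulation has at least eleven vertices. -/
theorem eleven_le_card (K : AbstractSimplicialComplex V) (hK : IsOrientableTriangulation K 4) :
    11 ≤ Fintype.card V := by
  have h1 := two_mul_edges_le K hK.two_dimensional.1 hK.surface
  have h2 := faceCount_one_le K
  have h3 := hK.genus
  rw [eulerChar, faceCount_zero] at h3
  by_contra h
  have h4 : Fintype.card V ≤ 10 := by omega
  generalize Fintype.card V = n at *
  -- The hypotheses give `f₁ ≥ 3 n + 18`. Already for `n = 10` this is 48, against at most 45 edges.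
  interval_cases n <;> simp [Nat.choose] at h2 <;> omega

end Counting

open ComplexConjugate

/-! ### Piecewise linear coordinates on the fan of a regular polygon -/

section Fan

variable (k : ℕ)

/-- The angle of a regular `k`-gon at its centre. -/
def fanAngle : ℝ := 2 * Real.pi / k

/-- The piecewise linear function of the plane that is `1` at `1`, vanishes at the other `k`-th
roots of unity, and is linear on the cone over every edge of the regular `k`-gon. -/
def hat (y : ℂ) : ℝ :=
  max 0 (min (y * Complex.exp (fanAngle k * Complex.I)).im
    (Complex.exp (fanAngle k * Complex.I) * conj y).im) / Real.sin (fanAngle k)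

theorem continuous_hat : Continuous (hat k) := by
  unfold hat
  have : Continuous fun y : ℂ => (y * Complex.exp (fanAngle k * Complex.I)).im := by fun_prop
  have : Continuous fun y : ℂ => (Complex.exp (fanAngle k * Complex.I) * conj y).im :=
    Complex.continuous_im.comp (continuous_const.mul Complex.continuous_conj)
  fun_prop

variable {k} (hk : 4 ≤ k)

include hk

theorem fanAngle_pos : 0 < fanAngle k := by
  have : (0 : ℝ) < k := by positivity
  unfold fanAngle
  positivity

theorem fanAngle_le : fanAngle k ≤ Real.pi / 2 := by
  have h : (4 : ℝ) ≤ k := by exact_mod_cast hk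
  unfold fanAngle
  rw [div_le_iff₀ (by linarith)]
  nlinarith [Real.pi_pos]

theorem mul_fanAngle : (k : ℝ) * fanAngle k = 2 * Real.pi := by
  have : (0 : ℝ) < k := by positivity
  unfold fanAngle
  field_simp

theorem sin_fanAngle_pos : 0 < Real.sin (fanAngle k) :=
  Real.sin_pos_of_pos_of_lt_pi (fanAngle_pos hk) (by linarith [fanAngle_le hk, Real.pi_pos])

/-- The two imaginary parts in `hat` vanish on the rays at angles `-α` and `α`. On each sector next
to the ray at angle `0` their minimum is the one that is linear with the right boundary values, and
on every other sector one of them is nonpositive. -/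
theorem hat_add {a b : ℝ} (ha : 0 ≤ a) (hb : 0 ≤ b) {n : ℕ} (hn : n < k) :
    hat k (a * Complex.exp ((n * fanAngle k : ℝ) * Complex.I) +
      b * Complex.exp (((n + 1) * fanAngle k : ℝ) * Complex.I)) =
      (if n = 0 then a else 0) + (if n + 1 = k then b else 0) := by
  set α := fanAngle k with hα
  have h1 : ((a * Complex.exp ((n * α : ℝ) * Complex.I) +
      b * Complex.exp (((n + 1) * α : ℝ) * Complex.I)) * Complex.exp (α * Complex.I)).im =
      a * Real.sin ((n + 1) * α) + b * Real.sin ((n + 2) * α) := by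
    rw [add_mul, mul_assoc, mul_assoc, ← Complex.exp_add, ← Complex.exp_add, ← add_mul, ← add_mul,
      ← Complex.ofReal_add, ← Complex.ofReal_add, Complex.add_im, Complex.im_ofReal_mul,
      Complex.im_ofReal_mul, Complex.exp_ofReal_mul_I_im, Complex.exp_ofReal_mul_I_im]
    congr 3 <;> ring
  have hconj : ∀ t : ℝ, conj (Complex.exp (t * Complex.I)) = Complex.exp ((-t : ℝ) * Complex.I) := by
    intro t
    rw [← Complex.exp_conj]
    simp
  have h2 : (Complex.exp (α * Complex.I) * conj (a * Complex.exp ((n * α : ℝ) * Complex.I) +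
      b * Complex.exp (((n + 1) * α : ℝ) * Complex.I))).im =
      a * Real.sin ((1 - n) * α) + b * Real.sin (-(n * α)) := by
    rw [map_add, map_mul, map_mul, hconj, hconj, Complex.conj_ofReal, Complex.conj_ofReal, mul_add,
      mul_left_comm, mul_left_comm _ (b : ℂ), ← Complex.exp_add, ← Complex.exp_add, ← add_mul,
      ← add_mul, ← Complex.ofReal_add, ← Complex.ofReal_add, Complex.add_im, Complex.im_ofReal_mul,
      Complex.im_ofReal_mul, Complex.exp_ofReal_mul_I_im, Complex.exp_ofReal_mul_I_im]
    congr 3 <;> ring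
  have hsin := sin_fanAngle_pos hk
  have hα0 := fanAngle_pos hk
  have hα1 := fanAngle_le hk
  have hkα := mul_fanAngle hk
  rw [← hα] at hsin hα0 hα1 hkα
  have hsin2 : 0 ≤ Real.sin (2 * α) :=
    Real.sin_nonneg_of_nonneg_of_le_pi (by linarith) (by linarith)
  rw [hat, h1, h2, ← hα, div_eq_iff hsin.ne']
  rcases Nat.eq_zero_or_pos n with rfl | hn0
  · have : (0 : ℕ) + 1 ≠ k := by omega
    have e1 : min (a * Real.sin ((((0 : ℕ) : ℝ) + 1) * α) + b * Real.sin ((((0 : ℕ) : ℝ) + 2) * α))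
        (a * Real.sin ((1 - ((0 : ℕ) : ℝ)) * α) + b * Real.sin (-(((0 : ℕ) : ℝ) * α))) =
        a * Real.sin α := by
      simp only [Nat.cast_zero, zero_add, one_mul, sub_zero, zero_mul, neg_zero, Real.sin_zero,
        mul_zero, add_zero]
      -- The choice of the minimum uses `sin (2 α) ≥ 0`, that is `α ≤ π / 2`. This is where at least
      -- four sectors are needed.
      exact min_eq_right (by nlinarith [mul_nonneg hb hsin2])
    rw [e1, max_eq_right (by positivity)]
    simp [this]
  have hn0' : n ≠ 0 := hn0.ne'
  rcases eq_or_ne (n + 1) k with hnk | hnk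
  · have hn' : (n : ℝ) = k - 1 := by rw [← hnk]; push_cast; ring
    have e1 : Real.sin ((n + 1) * α) = 0 := by
      rw [show ((n : ℝ) + 1) * α = 2 * Real.pi by rw [hn', ← hkα]; ring]
      exact Real.sin_two_pi
    have e2 : Real.sin ((n + 2) * α) = Real.sin α := by
      rw [show ((n : ℝ) + 2) * α = α + 2 * Real.pi by rw [hn', ← hkα]; ring]
      exact Real.sin_add_two_pi _
    have e3 : Real.sin ((1 - n) * α) = Real.sin (2 * α) := by
      rw [show (1 - (n : ℝ)) * α = 2 * α - 2 * Real.pi by rw [hn', ← hkα]; ring]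
      exact Real.sin_sub_two_pi _
    have e4 : Real.sin (-(n * α)) = Real.sin α := by
      rw [show -((n : ℝ) * α) = α - 2 * Real.pi by rw [hn', ← hkα]; ring]
      exact Real.sin_sub_two_pi _
    rw [e1, e2, e3, e4, mul_zero, zero_add, min_eq_left (by nlinarith [mul_nonneg ha hsin2]),
      max_eq_right (by positivity)]
    simp [hn0', hnk]
  · have hn1 : (1 : ℝ) ≤ n := by exact_mod_cast hn0
    have hn2 : (n : ℝ) + 2 ≤ k := by
      have : n + 2 ≤ k := by omega
      exact_mod_cast this
    have hmin : min (a * Real.sin ((n + 1) * α) + b * Real.sin ((n + 2) * α))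
        (a * Real.sin ((1 - n) * α) + b * Real.sin (-(n * α))) ≤ 0 := by
      -- In the upper half-turn the second imaginary part is nonpositive, in the lower one the
      -- first.
      rcases le_or_gt (n * α) Real.pi with h | h
      · have s1 : Real.sin ((1 - n) * α) ≤ 0 :=
          Real.sin_nonpos_of_nonpos_of_neg_pi_le (by nlinarith) (by nlinarith)
        have s2 : Real.sin (-(n * α)) ≤ 0 :=
          Real.sin_nonpos_of_nonpos_of_neg_pi_le (by nlinarith) (by linarith)
        refine (min_le_right _ _).trans ?_
        nlinarith [mul_nonneg ha (neg_nonneg.2 s1), mul_nonneg hb (neg_nonneg.2 s2)]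
      · have s1 : Real.sin ((n + 1) * α) ≤ 0 := by
          rw [← Real.sin_sub_two_pi]
          exact Real.sin_nonpos_of_nonpos_of_neg_pi_le (by nlinarith) (by nlinarith)
        have s2 : Real.sin ((n + 2) * α) ≤ 0 := by
          rw [← Real.sin_sub_two_pi]
          exact Real.sin_nonpos_of_nonpos_of_neg_pi_le (by nlinarith) (by nlinarith)
        refine (min_le_left _ _).trans ?_
        nlinarith [mul_nonneg ha (neg_nonneg.2 s1), mul_nonneg hb (neg_nonneg.2 s2)]
    rw [max_eq_left hmin]
    simp [hn0', hnk]

variable [NeZero k]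

omit hk in
theorem stdAddChar_natCast (n : ℕ) :
    ZMod.stdAddChar (n : ZMod k) = Complex.exp ((n * fanAngle k : ℝ) * Complex.I) := by
  have h := ZMod.stdAddChar_coe (N := k) (n : ℤ)
  have hk0 : (k : ℂ) ≠ 0 := by exact_mod_cast NeZero.ne k
  rw [Int.cast_natCast] at h
  rw [h]
  congr 1
  unfold fanAngle
  push_cast
  field_simp

/-- Multiplication by the conjugate of the `j`-th root of unity rotates that root to `1`, which
reduces the claim to `hat_add` with `n` the representative of `i - j` below `k`. -/
theorem hat_fan {a b : ℝ} (ha : 0 ≤ a) (hb : 0 ≤ b) (i j : ZMod k) :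
    hat k ((a * ZMod.stdAddChar i + b * ZMod.stdAddChar (i + 1)) * conj (ZMod.stdAddChar j)) =
      (if j = i then a else 0) + (if j = i + 1 then b else 0) := by
  have h : (a * ZMod.stdAddChar i + b * ZMod.stdAddChar (i + 1)) * conj (ZMod.stdAddChar j) =
      a * ZMod.stdAddChar (i - j) + b * ZMod.stdAddChar (i - j + 1) := by
    rw [← AddChar.map_neg_eq_conj, add_mul, mul_assoc, mul_assoc, ← AddChar.map_add_eq_mul,
      ← AddChar.map_add_eq_mul]
    congr 3 <;> ring
  rw [h]
  obtain ⟨n, hn, hnm⟩ : ∃ n < k, (n : ZMod k) = i - j :=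
    ⟨(i - j).val, ZMod.val_lt _, ZMod.natCast_zmod_val _⟩
  have h1 : ((n + 1 : ℕ) : ZMod k) = i - j + 1 := by rw [← hnm]; push_cast; ring
  rw [← h1, ← hnm, stdAddChar_natCast, stdAddChar_natCast]
  have := hat_add hk ha hb hn
  push_cast at this ⊢
  rw [this]
  congr 1
  · have : n = 0 ↔ j = i := by
      rw [← sub_eq_zero (a := j), ← neg_eq_zero, neg_sub, ← hnm, ZMod.natCast_eq_zero_iff]
      exact ⟨fun h => h ▸ dvd_zero _, fun h => Nat.eq_zero_of_dvd_of_lt h hn⟩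
    simp only [this]
  · have : n + 1 = k ↔ j = i + 1 := by
      have h2 : j = i + 1 ↔ ((n + 1 : ℕ) : ZMod k) = 0 := by
        rw [h1, ← sub_eq_zero (a := j), ← neg_eq_zero]
        ring_nf
      rw [h2, ZMod.natCast_eq_zero_iff]
      exact ⟨fun h => h ▸ dvd_rfl, fun h =>
        le_antisymm (by omega) (Nat.le_of_dvd (Nat.succ_pos _) h)⟩
    simp only [this]

/-- The cones over the edges of the regular polygon cover the plane. -/
theorem exists_sector (z : ℂ) : ∃ (i : ZMod k) (a b : ℝ), 0 ≤ a ∧ 0 ≤ b ∧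
    z = a * ZMod.stdAddChar i + b * ZMod.stdAddChar (i + 1) := by
  have hα0 := fanAngle_pos hk
  have hsin := sin_fanAngle_pos hk
  have hα1 := fanAngle_le hk
  set α := fanAngle k with hα
  -- The shift by `2π` makes the angle nonnegative, so that the natural floor applies. The sector
  -- number may then be `k` or more, but only its residue modulo `k` matters.
  set θ := z.arg + 2 * Real.pi with hθ
  have hθ0 : 0 ≤ θ := by linarith [Complex.neg_pi_lt_arg z, Real.pi_pos]
  set n := ⌊θ / α⌋₊ with hn
  have h1 : n * α ≤ θ := by
    rw [← le_div_iff₀ hα0]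
    exact Nat.floor_le (by positivity)
  have h2 : θ < (n + 1) * α := by
    rw [← div_lt_iff₀ hα0]
    exact Nat.lt_floor_add_one _
  set t := θ - n * α with ht
  have ht0 : 0 ≤ t := by linarith
  have ht1 : t < α := by linarith
  -- The coefficients come from `sin α · exp (i t) = sin (α - t) + sin t · exp (i α)`, where `t` is
  -- the angle within the sector.
  refine ⟨n, ‖z‖ * Real.sin (α - t) / Real.sin α, ‖z‖ * Real.sin t / Real.sin α, ?_, ?_, ?_⟩
  · have := Real.sin_nonneg_of_nonneg_of_le_pi (x := α - t) (by linarith)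
      (by linarith [Real.pi_pos])
    positivity
  · have := Real.sin_nonneg_of_nonneg_of_le_pi (x := t) (by linarith)
      (by linarith [Real.pi_pos])
    positivity
  · have e1 : ((n : ZMod k) + 1) = ((n + 1 : ℕ) : ZMod k) := by push_cast; rfl
    have e2 : z = ‖z‖ * (Complex.exp ((n * α : ℝ) * Complex.I) * Complex.exp (t * Complex.I)) := by
      rw [← Complex.exp_add, ← add_mul, ← Complex.ofReal_add,
        show (n : ℝ) * α + t = z.arg + 2 * Real.pi by rw [ht, hθ]; ring, Complex.ofReal_add,
        add_mul, Complex.exp_add]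
      push_cast
      rw [Complex.exp_two_pi_mul_I, mul_one, Complex.norm_mul_exp_arg_mul_I]
    have e3 : (Real.sin α : ℂ) * Complex.exp (t * Complex.I) =
        Real.sin (α - t) + Real.sin t * Complex.exp (α * Complex.I) := by
      apply Complex.ext
      · simp only [Complex.re_ofReal_mul, Complex.add_re, Complex.exp_ofReal_mul_I_re,
          Complex.ofReal_re, Real.sin_sub]
        ring
      · simp only [Complex.im_ofReal_mul, Complex.add_im, Complex.exp_ofReal_mul_I_im,
          Complex.ofReal_im]
        ring
    have hs : (Real.sin α : ℂ) ≠ 0 := by exact_mod_cast hsin.ne'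
    have e5 : Complex.exp (t * Complex.I) =
        (Real.sin (α - t) + Real.sin t * Complex.exp (α * Complex.I)) / Real.sin α := by
      rw [eq_div_iff hs, mul_comm, e3]
    rw [e1, stdAddChar_natCast, stdAddChar_natCast, ← hα]
    conv_lhs => rw [e2, e5]
    have e4 : Complex.exp ((((n + 1 : ℕ) : ℝ) * α : ℝ) * Complex.I) =
        Complex.exp ((n * α : ℝ) * Complex.I) * Complex.exp (α * Complex.I) := by
      rw [← Complex.exp_add]
      congr 1
      push_cast
      ring
    rw [e4]
    simp only [Complex.ofReal_div, Complex.ofReal_mul]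
    ring

end Fan

/-! ### Planar charts on open vertex stars -/

section Chart

variable {V : Type*} [Fintype V] [DecidableEq V]

/-- If the faces at the vertex `v` are those of the cone over a cycle of `k ≥ 4` vertices, then the
open star of `v` is homeomorphic to an open set of the plane. -/
theorem exists_chart_of_cyclic_link (K : AbstractSimplicialComplex V) (v : V) {k : ℕ} [NeZero k]
    (hk : 4 ≤ k) (w : ZMod k → V) (hw : Function.Injective w) (hwv : ∀ i, w i ≠ v)
    (hmem : ∀ i, ({v, w i, w (i + 1)} : Finset V) ∈ K.faces)
    (hstar : ∀ s ∈ K.faces, v ∈ s → ∃ i, s ⊆ {v, w i, w (i + 1)}) :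
    ∃ e : OpenPartialHomeomorph (polyhedron K) (EuclideanSpace ℝ (Fin 2)),
      e.source = {x | 0 < x.1 v} := by
  classical
  have hone : ∀ i : ZMod k, i + 1 ≠ i := by
    intro i h
    have : (1 : ZMod k) = 0 := by simpa using h
    have h' : ((1 : ℕ) : ZMod k) = 0 := by simpa using this
    rw [ZMod.natCast_eq_zero_iff] at h'
    have := Nat.le_of_dvd one_pos h'
    omega
  let E : ZMod k → ℂ := fun j => ZMod.stdAddChar j
  -- The chart `P` sends `v` to the origin and the link to the vertices of a regular polygon,
  -- linearly on each triangle. Its inverse `Ψ` takes the functions `η j` as weights of the link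
  -- vertices and gives the remaining weight to `v`.
  let P : (V → ℝ) → ℂ := fun x => ∑ j, (x (w j) : ℂ) * E j
  let η : ZMod k → ℂ → ℝ := fun j z => hat k (z * conj (E j))
  let Ψ : ℂ → V → ℝ := fun z =>
    (1 - ∑ j, η j z) • Pi.single v (1 : ℝ) + ∑ j, η j z • Pi.single (w j) (1 : ℝ)
  have hP : Continuous P := by fun_prop
  have hη : ∀ j, Continuous (η j) := fun j =>
    (continuous_hat k).comp (continuous_id.mul continuous_const)
  have hsum : Continuous fun z => ∑ j, η j z := continuous_finsetSum _ fun j _ => hη j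
  have hΨ : Continuous Ψ :=
    ((continuous_const.sub hsum).smul continuous_const).add
      (continuous_finsetSum _ fun j _ => (hη j).smul continuous_const)
  have hηE : ∀ a b : ℝ, 0 ≤ a → 0 ≤ b → ∀ i j, η j (a * E i + b * E (i + 1)) =
      (if j = i then a else 0) + (if j = i + 1 then b else 0) :=
    fun a b ha hb i j => hat_fan hk ha hb i j
  have hηsum : ∀ a b : ℝ, 0 ≤ a → 0 ≤ b → ∀ i, ∑ j, η j (a * E i + b * E (i + 1)) = a + b := by
    intro a b ha hb i
    simp [hηE a b ha hb, Finset.sum_add_distrib]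
  have hΨE : ∀ a b : ℝ, 0 ≤ a → 0 ≤ b → ∀ i, Ψ (a * E i + b * E (i + 1)) =
      Pi.single v (1 - a - b) + Pi.single (w i) a + Pi.single (w (i + 1)) b := by
    intro a b ha hb i
    simp only [Ψ, hηE a b ha hb, add_smul, ite_smul, zero_smul,
      Finset.sum_add_distrib, Finset.sum_ite_eq', Finset.mem_univ, if_true]
    simp only [← Pi.single_smul, smul_eq_mul, mul_one]
    rw [sub_sub, add_assoc]
  have hPsingle : ∀ (a b c : ℝ) (i : ZMod k),
      P (Pi.single v c + Pi.single (w i) a + Pi.single (w (i + 1)) b) =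
      a * E i + b * E (i + 1) := by
    intro a b c i
    simp only [P, Pi.add_apply, Complex.ofReal_add, add_mul, Finset.sum_add_distrib]
    rw [Finset.sum_eq_zero (fun j _ => by simp [hwv]),
      Finset.sum_eq_single i (fun j _ h => by simp [hw.ne h]) (by simp),
      Finset.sum_eq_single (i + 1) (fun j _ h => by simp [hw.ne h]) (by simp)]
    simp
  have hsource : ∀ x : polyhedron K, 0 < x.1 v → ∃ (i : ZMod k) (a b : ℝ), 0 ≤ a ∧ 0 ≤ b ∧
      0 < 1 - a - b ∧
      x.1 = Pi.single v (1 - a - b) + Pi.single (w i) a + Pi.single (w (i + 1)) b := by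
    intro x hx
    obtain ⟨s, hs, h0⟩ := x.2.2
    have hv : v ∈ s := by by_contra h; exact hx.ne' (h0 v h)
    obtain ⟨i, hi⟩ := hstar s hs hv
    have h0' : ∀ u, u ∉ ({v, w i, w (i + 1)} : Finset V) → x.1 u = 0 :=
      fun u hu => h0 u fun h => hu (hi h)
    have h12 : w i ≠ w (i + 1) := hw.ne (hone i).symm
    have hxs : x.1 v + (x.1 (w i) + x.1 (w (i + 1))) = 1 := by
      have h3 : ∑ u ∈ ({v, w i, w (i + 1)} : Finset V), x.1 u = 1 := by
        rw [← x.2.1.2]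
        exact Finset.sum_subset (Finset.subset_univ _) fun u _ hu => h0' u hu
      rwa [Finset.sum_insert (by simp [(hwv i).symm, (hwv (i + 1)).symm]), Finset.sum_pair h12]
        at h3
    refine ⟨i, x.1 (w i), x.1 (w (i + 1)), x.2.1.1 _, x.2.1.1 _, by linarith, ?_⟩
    funext u
    by_cases h1 : u = v
    · subst h1
      simp [(hwv i).symm, (hwv (i + 1)).symm]
      linarith
    by_cases h2 : u = w i
    · subst h2
      simp [hwv i, h12]
    by_cases h3 : u = w (i + 1)
    · subst h3
      simp [hwv, h12.symm]
    · rw [h0' u (by simp [h1, h2, h3])]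
      simp [h1, h2, h3]
  have htarget : ∀ z, ∑ j, η j z < 1 → Ψ z ∈ polyhedron K ∧ 0 < Ψ z v ∧ P (Ψ z) = z := by
    intro z hz
    obtain ⟨i, a, b, ha, hb, rfl⟩ := exists_sector hk z
    have hz' : a + b < 1 := by rw [← hηsum a b ha hb i]; exact hz
    change Ψ (a * E i + b * E (i + 1)) ∈ _ ∧ 0 < Ψ (a * E i + b * E (i + 1)) v ∧
      P (Ψ (a * E i + b * E (i + 1))) = _
    rw [hΨE a b ha hb]
    refine ⟨smul_single_add_mem_polyhedron K (hmem i) (by linarith) ha hb (by ring), ?_,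
      hPsingle _ _ _ _⟩
    simp [(hwv i).symm, (hwv (i + 1)).symm]
    linarith
  let e : OpenPartialHomeomorph (polyhedron K) ℂ :=
    { toFun := fun x => P x.1
      -- Outside the open polygon `∑ j, η j z < 1` the value is irrelevant; the vertex `v` serves as
      -- default.
      invFun := fun z => if h : Ψ z ∈ polyhedron K then ⟨Ψ z, h⟩ else
        ⟨_, smul_single_add_mem_polyhedron K (hmem 0) (a := 1) (b := 0) (c := 0) zero_le_one le_rfl
          le_rfl (by ring)⟩
      source := {x | 0 < x.1 v}
      target := {z | ∑ j, η j z < 1}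
      map_source' := by
        intro x hx
        obtain ⟨i, a, b, ha, hb, hab, h⟩ := hsource x hx
        change ∑ j, η j (P x.1) < 1
        rw [h, hPsingle, hηsum a b ha hb]
        linarith
      map_target' := by
        intro z hz
        obtain ⟨h1, h2, -⟩ := htarget z hz
        rw [dif_pos h1]
        exact h2
      left_inv' := by
        intro x hx
        obtain ⟨i, a, b, ha, hb, hab, h⟩ := hsource x hx
        have : Ψ (P x.1) = x.1 := by rw [h, hPsingle, hΨE a b ha hb]
        apply Subtype.ext
        rw [dif_pos (by rw [this]; exact x.2)]
        exact this
      right_inv' := by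
        intro z hz
        obtain ⟨h1, -, h3⟩ := htarget z hz
        rw [dif_pos h1]
        exact h3
      open_source := isOpen_lt continuous_const
        ((continuous_apply v).comp continuous_subtype_val)
      open_target := isOpen_lt hsum continuous_const
      continuousOn_toFun := (hP.comp continuous_subtype_val).continuousOn
      continuousOn_invFun := by
        rw [Topology.IsInducing.subtypeVal.continuousOn_iff]
        refine hΨ.continuousOn.congr fun z hz => ?_
        simp only [Function.comp_apply, dif_pos (htarget z hz).1] }
  exact ⟨e.transHomeomorph Complex.orthonormalBasisOneI.repr.toHomeomorph, rfl⟩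

end Chart

/-! ### Rotation systems and their oriented complexes -/

/-- The pairs of cyclically consecutive entries of a list. -/
def cyclicPairs {V : Type*} (l : List V) : List (V × V) :=
  l.zip (l.rotate 1)

/-- Indices in `ZMod l.length` absorb the wrap-around from the last entry to the first, so that
links later become injective cyclic sequences as the chart lemma wants them. -/
theorem mem_cyclicPairs {V : Type*} {l : List V} [NeZero l.length] (hl : 1 < l.length) {b c : V} :
    (b, c) ∈ cyclicPairs l ↔ ∃ j : ZMod l.length, b = l[j.val]'(ZMod.val_lt j) ∧
      c = l[(j + 1).val]'(ZMod.val_lt (j + 1)) := by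
  have hval : ∀ j : ZMod l.length, (j + 1).val = (j.val + 1) % l.length := by
    intro j
    have : Fact (1 < l.length) := ⟨hl⟩
    rw [ZMod.val_add, ZMod.val_one]
  rw [cyclicPairs, List.mem_iff_getElem]
  constructor
  · rintro ⟨i, hi, h⟩
    have hi' : i < l.length := by simpa using hi
    rw [List.getElem_zip, Prod.mk.injEq, List.getElem_rotate] at h
    have hv : ((i : ℕ) : ZMod l.length).val = i := by
      rw [ZMod.val_natCast, Nat.mod_eq_of_lt hi']
    refine ⟨(i : ZMod l.length), ?_, ?_⟩
    · simp only [hv, h.1]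
    · simp only [hval, hv, h.2]
  · rintro ⟨j, rfl, rfl⟩
    refine ⟨j.val, by simpa using ZMod.val_lt j, ?_⟩
    rw [List.getElem_zip, Prod.mk.injEq, List.getElem_rotate]
    exact ⟨rfl, by simp only [hval]⟩

/-- An oriented rotation system: every vertex `v` has a cyclically ordered link of at least four
other vertices, and the triples `(v, b, c)` with consecutive `b`, `c` in the link of `v` are closed
under cyclic permutations. -/
structure RotationSystem (V : Type*) where
  link : V → List V
  four_le_length : ∀ v, 4 ≤ (link v).length
  nodup : ∀ v, (v :: link v).Nodup
  cyclic : ∀ a, ∀ p ∈ cyclicPairs (link a), (p.2, a) ∈ cyclicPairs (link p.1)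

namespace RotationSystem

variable {V : Type*} (R : RotationSystem V)

/-- The oriented triangles of a rotation system. -/
def triples : Set (V × V × V) :=
  {t | t.2 ∈ cyclicPairs (R.link t.1)}

theorem mem_triples {a b c : V} : (a, b, c) ∈ R.triples ↔ (b, c) ∈ cyclicPairs (R.link a) :=
  Iff.rfl

theorem rotate_mem {a b c : V} (h : (a, b, c) ∈ R.triples) : (b, c, a) ∈ R.triples :=
  R.cyclic a _ h

instance (v : V) : NeZero (R.link v).length :=
  ⟨by have := R.four_le_length v; omega⟩

/-- The link of a vertex as an injective cyclic sequence. -/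
def nbr (v : V) (j : ZMod (R.link v).length) : V :=
  (R.link v)[j.val]'(ZMod.val_lt j)

theorem nbr_injective (v : V) : Function.Injective (R.nbr v) := by
  intro i j h
  have := (List.nodup_cons.1 (R.nodup v)).2
  exact ZMod.val_injective _ ((List.Nodup.getElem_inj_iff this).1 h)

theorem nbr_mem (v : V) (j) : R.nbr v j ∈ R.link v :=
  List.getElem_mem _

theorem mem_link_iff {v u : V} : u ∈ R.link v ↔ ∃ j, R.nbr v j = u := by
  constructor
  · intro h
    obtain ⟨i, hi, rfl⟩ := List.mem_iff_getElem.1 h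
    refine ⟨(i : ZMod _), ?_⟩
    have : ((i : ℕ) : ZMod (R.link v).length).val = i := by
      rw [ZMod.val_natCast, Nat.mod_eq_of_lt hi]
    simp only [nbr, this]
  · rintro ⟨j, rfl⟩
    exact R.nbr_mem v j

theorem nbr_ne (v : V) (j) : R.nbr v j ≠ v := fun h => by
  have := R.nbr_mem v j
  rw [h] at this
  exact (List.nodup_cons.1 (R.nodup v)).1 this

theorem mem_triples_iff {a b c : V} :
    (a, b, c) ∈ R.triples ↔ ∃ j, b = R.nbr a j ∧ c = R.nbr a (j + 1) :=
  mem_cyclicPairs (l := R.link a) (Nat.lt_of_lt_of_le (by norm_num) (R.four_le_length a))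

theorem natCast_ne_zero (v : V) {n : ℕ} (h0 : 0 < n) (h : n < 4) :
    (n : ZMod (R.link v).length) ≠ 0 := by
  intro h'
  rw [ZMod.natCast_eq_zero_iff] at h'
  have := Nat.le_of_dvd h0 h'
  have := R.four_le_length v
  omega

theorem add_one_ne (v : V) (j : ZMod (R.link v).length) : j + 1 ≠ j := by
  intro h
  have : (1 : ZMod (R.link v).length) = 0 := by simpa using h
  exact R.natCast_ne_zero v (n := 1) one_pos (by norm_num) (by simpa using this)

theorem ne_of_mem_triples {a b c : V} (h : (a, b, c) ∈ R.triples) : a ≠ b ∧ b ≠ c ∧ a ≠ c := by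
  obtain ⟨j, rfl, rfl⟩ := R.mem_triples_iff.1 h
  exact ⟨(R.nbr_ne a j).symm, fun h => R.add_one_ne a j (R.nbr_injective a h).symm,
    (R.nbr_ne a _).symm⟩

/-- If `c` followed `b` and `b` followed `c`, then `2 = 0` in `ZMod` of the link length, which is at
least four. -/
theorem not_swap_mem {a b c : V} (h : (a, b, c) ∈ R.triples) : (a, c, b) ∉ R.triples := by
  intro h'
  obtain ⟨j, rfl, rfl⟩ := R.mem_triples_iff.1 h
  obtain ⟨i, h1, h2⟩ := R.mem_triples_iff.1 h'
  have h1 := R.nbr_injective a h1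
  have h2 := R.nbr_injective a h2
  apply R.natCast_ne_zero a (n := 2) two_pos (by norm_num)
  rw [← h1, add_assoc] at h2
  have : (1 + 1 : ZMod (R.link a).length) = 0 := by simpa using h2.symm
  push_cast
  rw [← this]
  norm_num

variable [DecidableEq V]

/-- The simplicial complex of the triangles of a rotation system. -/
def complex : AbstractSimplicialComplex V where
  faces := {s | s.Nonempty ∧ ∃ a b c, (a, b, c) ∈ R.triples ∧ s ⊆ {a, b, c}}
  isRelLowerSet_faces := by
    rintro s ⟨hs, a, b, c, h, hsub⟩
    exact ⟨hs, fun t hts ht => ⟨ht, a, b, c, h, hts.trans hsub⟩⟩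
  singleton_mem v := ⟨Finset.singleton_nonempty v, v, R.nbr v 0, R.nbr v (0 + 1),
    R.mem_triples_iff.2 ⟨0, rfl, rfl⟩, by simp⟩

theorem mem_complex_of_subset {s : Finset V} (hs : s.Nonempty) {a b c : V}
    (h : (a, b, c) ∈ R.triples) (hsub : s ⊆ {a, b, c}) : s ∈ R.complex.faces :=
  ⟨hs, a, b, c, h, hsub⟩

/-- By the cyclic closure any vertex of a triangle can be moved to the first place. Hence the link
of `v` alone determines all faces at `v`. -/
theorem exists_of_mem_complex {s : Finset V} (hs : s ∈ R.complex.faces) {v : V} (hv : v ∈ s) :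
    ∃ b c, (v, b, c) ∈ R.triples ∧ s ⊆ {v, b, c} := by
  obtain ⟨-, a, b, c, h, hsub⟩ := hs
  have hv' := hsub hv
  simp only [Finset.mem_insert, Finset.mem_singleton] at hv'
  rcases hv' with rfl | rfl | rfl
  · exact ⟨b, c, h, hsub⟩
  · exact ⟨c, a, R.rotate_mem h, hsub.trans fun x => by simp; tauto⟩
  · exact ⟨a, b, R.rotate_mem (R.rotate_mem h), hsub.trans fun x => by simp; tauto⟩

theorem card_le_three {s : Finset V} (hs : s ∈ R.complex.faces) : s.card ≤ 3 := by
  obtain ⟨-, a, b, c, -, hsub⟩ := hs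
  exact (Finset.card_le_card hsub).trans Finset.card_le_three

theorem isTwoDimensional [Nonempty V] : IsTwoDimensional R.complex := by
  refine ⟨fun s => R.card_le_three, ?_⟩
  obtain ⟨v⟩ := ‹Nonempty V›
  have h : (v, R.nbr v 0, R.nbr v (0 + 1)) ∈ R.triples := R.mem_triples_iff.2 ⟨0, rfl, rfl⟩
  obtain ⟨h1, h2, h3⟩ := R.ne_of_mem_triples h
  exact ⟨_, R.mem_complex_of_subset (by simp) h le_rfl,
    Finset.card_eq_three.2 ⟨_, _, _, h1, h3, h2, rfl⟩⟩

/-- The triples themselves are the orientation. A triangle cannot occur in both orders by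
`not_swap_mem`, and coherence holds because the entries of a link are distinct, so each has only one
successor. -/
theorem isCoherentOrientation : IsCoherentOrientation R.complex R.triples where
  triangle a b c h := by
    obtain ⟨h1, h2, h3⟩ := R.ne_of_mem_triples h
    exact ⟨h1, h2, h3, R.mem_complex_of_subset (by simp) h le_rfl⟩
  cyclic a b c h := R.rotate_mem h
  choice a b c hab hbc hac hf := by
    constructor
    · intro h h'
      exact R.not_swap_mem h (R.rotate_mem h')
    · intro h
      obtain ⟨p, q, hpq, hsub⟩ := R.exists_of_mem_complex hf (v := a) (by simp)
      have hb : b ∈ ({a, p, q} : Finset V) := hsub (by simp)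
      have hc : c ∈ ({a, p, q} : Finset V) := hsub (by simp)
      simp only [Finset.mem_insert, Finset.mem_singleton, hab.symm, hac.symm, false_or] at hb hc
      rcases hb with rfl | rfl <;> rcases hc with rfl | rfl
      · exact absurd rfl hbc
      · exact hpq
      · exact absurd (R.rotate_mem (R.rotate_mem hpq)) h
      · exact absurd rfl hbc
  coherent a b c d h h' := by
    obtain ⟨j, rfl, rfl⟩ := R.mem_triples_iff.1 h
    obtain ⟨i, h1, rfl⟩ := R.mem_triples_iff.1 h'
    rw [R.nbr_injective a h1]

/-! ### The complex of a rotation system as a closed surface of given genus -/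

section Surface

variable [Fintype V]

omit [DecidableEq V] in
/-- The points of the standard simplex supported on a given set of vertices. -/
theorem convex_cell (s : Finset V) :
    Convex ℝ {x : V → ℝ | x ∈ stdSimplex ℝ V ∧ ∀ v, v ∉ s → x v = 0} := by
  rintro x ⟨hx, hxs⟩ y ⟨hy, hys⟩ a b ha hb hab
  exact ⟨convex_stdSimplex ℝ V hx hy ha hb hab, fun v hv => by simp [hxs v hv, hys v hv]⟩

omit [DecidableEq V] in
theorem isCompact_polyhedron (K : AbstractSimplicialComplex V) : IsCompact (polyhedron K) := by
  have : polyhedron K = stdSimplex ℝ V ∩ ⋃ s ∈ K.faces, {x | ∀ v, v ∉ s → x v = 0} := by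
    ext x
    simp [polyhedron]
  rw [this]
  refine (isCompact_stdSimplex ℝ V).inter_right ?_
  refine (Set.toFinite K.faces).isClosed_biUnion fun s _ => ?_
  have : {x : V → ℝ | ∀ v, v ∉ s → x v = 0} = ⋂ v, ⋂ (_ : v ∉ s), {x | x v = 0} := by
    ext x
    simp
  rw [this]
  exact isClosed_iInter fun v => isClosed_iInter fun _ =>
    isClosed_eq (continuous_apply v) continuous_const

/-- A point is connected to `o` through two convex cells: a face that carries the point, and the
edge from a vertex `u` of that face to `o`, which degenerates to a vertex if `u = o`. -/
theorem isPreconnected_polyhedron (K : AbstractSimplicialComplex V) (o : V)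
    (ho : ∀ u, ({u, o} : Finset V) ∈ K.faces) : IsPreconnected (polyhedron K) := by
  refine isPreconnected_of_forall (Pi.single o 1) fun x hx => ?_
  obtain ⟨hxs, s, hs, h0⟩ := hx
  obtain ⟨u, hu⟩ := (K.isRelLowerSet_faces hs).1
  have hsub : ∀ t ∈ K.faces, {x : V → ℝ | x ∈ stdSimplex ℝ V ∧ ∀ v, v ∉ t → x v = 0} ⊆
      polyhedron K := fun t ht y hy => ⟨hy.1, t, ht, hy.2⟩
  have hsingle : ∀ t : Finset V, ∀ a ∈ t,
      Pi.single a 1 ∈ {x : V → ℝ | x ∈ stdSimplex ℝ V ∧ ∀ v, v ∉ t → x v = 0} := by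
    intro t a ha
    exact ⟨single_mem_stdSimplex ℝ a, fun v hv => by
      rw [Pi.single_eq_of_ne]
      rintro rfl
      exact hv ha⟩
  refine ⟨_, Set.union_subset (hsub s hs) (hsub _ (ho u)), Or.inr (hsingle _ o (by simp)),
    Or.inl ⟨hxs, h0⟩, ?_⟩
  exact IsPreconnected.union (Pi.single u 1) (hsingle s u hu) (hsingle _ u (by simp))
    (convex_cell s).isPreconnected (convex_cell _).isPreconnected

omit [Fintype V] in
theorem pair_mem_complex {u v : V} (h : u ∈ R.link v) : ({u, v} : Finset V) ∈ R.complex.faces := by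
  obtain ⟨j, rfl⟩ := R.mem_link_iff.1 h
  refine R.mem_complex_of_subset (by simp) (R.mem_triples_iff.2 ⟨j, rfl, rfl⟩) fun x => ?_
  simp
  tauto

/-- A rotation system with a vertex that is joined to all others triangulates a closed connected
surface. -/
theorem isClosedConnectedSurface (o : V) (ho : ∀ u, u ≠ o → u ∈ R.link o) :
    IsClosedConnectedSurface (polyhedron R.complex) where
  compact := isCompact_iff_compactSpace.1 (isCompact_polyhedron _)
  hausdorff := inferInstance
  connected := by
    refine isConnected_iff_connectedSpace.1 ⟨⟨Pi.single o 1, single_mem_stdSimplex ℝ o, {o},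
      R.complex.singleton_mem o, fun v hv => ?_⟩, isPreconnected_polyhedron _ o fun u => ?_⟩
    · rw [Pi.single_eq_of_ne]
      simpa using hv
    · by_cases h : u = o
      · subst h
        simpa using R.complex.singleton_mem u
      · exact R.pair_mem_complex (ho u h)
  locally_plane x := by
    -- The weights sum to one, so one of them is positive, and `x` lies in the open star of that
    -- vertex.
    obtain ⟨v, hv⟩ : ∃ v, 0 < x.1 v := by
      by_contra h
      push Not at h
      have := Finset.sum_nonpos fun v (_ : v ∈ Finset.univ) => h v
      rw [x.2.1.2] at this
      linarith
    obtain ⟨e, he⟩ := exists_chart_of_cyclic_link R.complex v (R.four_le_length v) (R.nbr v)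
      (R.nbr_injective v) (R.nbr_ne v)
      (fun i => R.mem_complex_of_subset (by simp) (R.mem_triples_iff.2 ⟨i, rfl, rfl⟩) le_rfl)
      (fun s hs hvs => by
        obtain ⟨b, c, h, hsub⟩ := R.exists_of_mem_complex hs hvs
        obtain ⟨j, rfl, rfl⟩ := R.mem_triples_iff.1 h
        exact ⟨j, hsub⟩)
    exact ⟨e, he ▸ hv⟩

theorem card_edges_at (v : V) :
    ((facesOfCard R.complex 2).filter (v ∈ ·)).card = (R.link v).length := by
  have hnd := (List.nodup_cons.1 (R.nodup v))
  have : (facesOfCard R.complex 2).filter (v ∈ ·) =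
      (R.link v).toFinset.image fun u => ({u, v} : Finset V) := by
    ext s
    simp only [Finset.mem_filter, mem_facesOfCard, Finset.mem_image, List.mem_toFinset]
    constructor
    · rintro ⟨⟨hs, h2⟩, hv⟩
      obtain ⟨u, huv, rfl⟩ : ∃ u, u ≠ v ∧ s = {u, v} := by
        obtain ⟨x, y, hxy, rfl⟩ := Finset.card_eq_two.1 h2
        rcases Finset.mem_insert.1 hv with rfl | h
        · exact ⟨y, hxy.symm, Finset.pair_comm _ _⟩
        · rw [Finset.mem_singleton] at h
          subst h
          exact ⟨x, hxy, rfl⟩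
      refine ⟨u, ?_, rfl⟩
      obtain ⟨b, c, h, hsub⟩ := R.exists_of_mem_complex hs hv
      have hu : u ∈ ({v, b, c} : Finset V) := hsub (by simp)
      simp only [Finset.mem_insert, Finset.mem_singleton, huv, false_or] at hu
      obtain ⟨j, rfl, rfl⟩ := R.mem_triples_iff.1 h
      rcases hu with rfl | rfl <;> exact R.nbr_mem _ _
    · rintro ⟨u, hu, rfl⟩
      have huv : u ≠ v := fun h => hnd.1 (h ▸ hu)
      exact ⟨⟨R.pair_mem_complex hu, Finset.card_pair huv⟩, by simp⟩
  rw [this, Finset.card_image_of_injOn, List.toFinset_card_of_nodup hnd.2]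
  intro x hx y hy hxy
  have hxv : x ≠ v := by
    rintro rfl
    exact hnd.1 (List.mem_toFinset.1 hx)
  have : x ∈ ({y, v} : Finset V) := by
    have h : x ∈ ({x, v} : Finset V) := by simp
    rwa [show ({x, v} : Finset V) = {y, v} from hxy] at h
  simpa [hxv] using this

theorem two_mul_edges : 2 * faceCount R.complex 1 = ∑ v, (R.link v).length := by
  have h := Finset.sum_card_bipartiteAbove_eq_sum_card_bipartiteBelow
    (s := (Finset.univ : Finset V)) (t := facesOfCard R.complex 2) (fun v e => v ∈ e)
  simp only [Finset.bipartiteAbove, Finset.bipartiteBelow, R.card_edges_at] at h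
  rw [h, faceCount_eq_card, mul_comm, ← smul_eq_mul, ← Finset.sum_const]
  refine Finset.sum_congr rfl fun e he => ?_
  rw [← (mem_facesOfCard.1 he).2]
  congr 1
  ext v
  simp

/-- The two incidence inequalities give `3 f₂ = 2 f₁`, and `2 f₁` is the sum of the degrees. Thus
the Euler characteristic is the number of vertices minus a sixth of that sum, and `hg` says that it
equals `2 - 2 g`. -/
theorem isOrientableTriangulation (o : V) (ho : ∀ u, u ≠ o → u ∈ R.link o) {g : ℕ}
    (hg : 6 * Fintype.card V + 12 * g = ∑ v, (R.link v).length + 12) :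
    IsOrientableTriangulation R.complex g where
  two_dimensional := haveI : Nonempty V := ⟨o⟩; R.isTwoDimensional
  surface := R.isClosedConnectedSurface o ho
  orientable := ⟨_, R.isCoherentOrientation⟩
  genus := by
    have h1 := two_mul_edges_le R.complex (fun s => R.card_le_three)
      (R.isClosedConnectedSurface o ho)
    have h2 := three_mul_triangles_le R.complex R.isCoherentOrientation
    have h3 := R.two_mul_edges
    rw [eulerChar, faceCount_zero]
    omega

end Surface

end RotationSystem

/-! ### Criteria for injectivity on a pair of triangles -/

section Embedding

variable {V : Type*} [Fintype V]

/-- The sum of `x v * y w * (h v - h w)` vanishes because `h` has the same mean under `x` and `y`,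
and its terms are nonnegative. So every term is zero, every support vertex of `x` equals every one
of `y`, and both are the same vertex. This allows triangles with one common vertex, but not with a
common edge. -/
theorem eq_of_separating_function {x y : V → ℝ} (hx : x ∈ stdSimplex ℝ V) (hy : y ∈ stdSimplex ℝ V)
    (h : V → ℝ) (heq : ∑ v, x v * h v = ∑ v, y v * h v)
    (hsep : ∀ v w, x v ≠ 0 → y w ≠ 0 → v = w ∨ h w < h v) : x = y := by
  classical
  have hsum : ∑ v, ∑ w, x v * y w * (h v - h w) = 0 := by
    have h1 : ∀ v, ∑ w, x v * y w * (h v - h w) = x v * h v - x v * ∑ w, y w * h w := by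
      intro v
      have : ∀ w, x v * y w * (h v - h w) = x v * h v * y w - x v * (y w * h w) := fun w => by ring
      simp only [this, Finset.sum_sub_distrib, ← Finset.mul_sum, hy.2, mul_one]
    simp only [h1, Finset.sum_sub_distrib, ← Finset.sum_mul, hx.2, one_mul, heq, sub_self]
  have hnonneg : ∀ v w, 0 ≤ x v * y w * (h v - h w) := by
    intro v w
    by_cases hv : x v = 0
    · simp [hv]
    by_cases hw : y w = 0
    · simp [hw]
    rcases hsep v w hv hw with rfl | hlt
    · simp
    · exact mul_nonneg (mul_nonneg (hx.1 v) (hy.1 w)) (sub_nonneg.2 hlt.le)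
  have hzero : ∀ v w, x v * y w * (h v - h w) = 0 := by
    intro v w
    have h1 := (Finset.sum_eq_zero_iff_of_nonneg fun v _ =>
      Finset.sum_nonneg fun w _ => hnonneg v w).1 hsum v (Finset.mem_univ v)
    exact (Finset.sum_eq_zero_iff_of_nonneg fun w _ => hnonneg v w).1 h1 w (Finset.mem_univ w)
  have hvw : ∀ v w, x v ≠ 0 → y w ≠ 0 → v = w := by
    intro v w hv hw
    refine (hsep v w hv hw).resolve_right fun hlt => ?_
    exact mul_ne_zero (mul_ne_zero hv hw) (sub_pos.2 hlt).ne' (hzero v w)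
  have hex : ∀ z ∈ stdSimplex ℝ V, ∃ v, z v ≠ 0 := by
    intro z hz
    by_contra hcon
    push Not at hcon
    have := hz.2
    simp [hcon] at this
  obtain ⟨v, hv⟩ := hex x hx
  obtain ⟨w, hw⟩ := hex y hy
  obtain rfl := hvw v w hv hw
  have hsingle : ∀ z ∈ stdSimplex ℝ V, (∀ u, z u ≠ 0 → u = v) → z = Pi.single v 1 := by
    intro z hz h0
    have h0' : ∀ u, u ≠ v → z u = 0 := fun u hu => by
      by_contra hcon
      exact hu (h0 u hcon)
    funext u
    by_cases hu : u = v
    · subst hu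
      have := hz.2
      rw [Finset.sum_eq_single u (fun w _ hw => h0' w hw) (by simp)] at this
      simp [this]
    · simp [hu, h0' u hu]
  rw [hsingle x hx fun u hu => hvw u v hu hw, hsingle y hy fun u hu => (hvw v u hv hu).symm]

/-- Integer vectors of three-space. -/
abbrev IntPoint : Type := ℤ × ℤ × ℤ

/-- The point of Euclidean space with given integer coordinates. -/
def IntPoint.toE3 (p : IntPoint) : E3 := !₂[(p.1 : ℝ), (p.2.1 : ℝ), (p.2.2 : ℝ)]

/-- The scalar product of integer vectors. -/
def IntPoint.dot (n p : IntPoint) : ℤ := n.1 * p.1 + n.2.1 * p.2.1 + n.2.2 * p.2.2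

/-- Six times the signed volume of a tetrahedron. -/
def IntPoint.volume (a b c d : IntPoint) : ℤ :=
  (b.1 - a.1) * ((c.2.1 - a.2.1) * (d.2.2 - a.2.2) - (c.2.2 - a.2.2) * (d.2.1 - a.2.1)) -
    (b.2.1 - a.2.1) * ((c.1 - a.1) * (d.2.2 - a.2.2) - (c.2.2 - a.2.2) * (d.1 - a.1)) +
    (b.2.2 - a.2.2) * ((c.1 - a.1) * (d.2.1 - a.2.1) - (c.2.1 - a.2.1) * (d.1 - a.1))

theorem coordinates_eq (p : V → IntPoint) {x y : V → ℝ}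
    (h : simplexwiseLinear (fun v => (p v).toE3) x = simplexwiseLinear (fun v => (p v).toE3) y) :
    ∑ v, x v * ((p v).1 : ℝ) = ∑ v, y v * ((p v).1 : ℝ) ∧
    ∑ v, x v * ((p v).2.1 : ℝ) = ∑ v, y v * ((p v).2.1 : ℝ) ∧
    ∑ v, x v * ((p v).2.2 : ℝ) = ∑ v, y v * ((p v).2.2 : ℝ) := by
  have key : ∀ (z : V → ℝ) (i : Fin 3), simplexwiseLinear (fun v => (p v).toE3) z i =
      ∑ v, z v * (p v).toE3 i := by
    intro z i
    simp [simplexwiseLinear]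
  refine ⟨?_, ?_, ?_⟩
  · have := congrArg (fun q : E3 => q 0) h
    simp only [key] at this
    simpa [IntPoint.toE3] using this
  · have := congrArg (fun q : E3 => q 1) h
    simp only [key] at this
    simpa [IntPoint.toE3] using this
  · have := congrArg (fun q : E3 => q 2) h
    simp only [key] at this
    simpa [IntPoint.toE3] using this

/-- Two points of the simplex with the same image are equal if a linear functional, which is `n` up
to an additive constant, separates their supports. -/
theorem eq_of_separated (p : V → IntPoint) {x y : V → ℝ} (hx : x ∈ stdSimplex ℝ V)
    (hy : y ∈ stdSimplex ℝ V)
    (h : simplexwiseLinear (fun v => (p v).toE3) x = simplexwiseLinear (fun v => (p v).toE3) y)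
    (n : IntPoint) (hsep : ∀ v w, x v ≠ 0 → y w ≠ 0 → v = w ∨ n.dot (p w) < n.dot (p v)) :
    x = y := by
  obtain ⟨h1, h2, h3⟩ := coordinates_eq p h
  refine eq_of_separating_function hx hy (fun v => (n.dot (p v) : ℝ)) ?_ fun v w hv hw =>
    (hsep v w hv hw).imp_right fun h => by exact_mod_cast h
  have key : ∀ z : V → ℝ, ∑ v, z v * (n.dot (p v) : ℝ) = n.1 * ∑ v, z v * ((p v).1 : ℝ) +
      n.2.1 * ∑ v, z v * ((p v).2.1 : ℝ) + n.2.2 * ∑ v, z v * ((p v).2.2 : ℝ) := by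
    intro z
    rw [Finset.mul_sum, Finset.mul_sum, Finset.mul_sum, ← Finset.sum_add_distrib,
      ← Finset.sum_add_distrib]
    refine Finset.sum_congr rfl fun v _ => ?_
    simp only [IntPoint.dot]
    push_cast
    ring
  rw [key, key, h1, h2, h3]

/-- Two points of a nondegenerate tetrahedron with the same image are equal. -/
theorem eq_of_volume_ne_zero [DecidableEq V] (p : V → IntPoint) {x y : V → ℝ}
    (hx : x ∈ stdSimplex ℝ V) (hy : y ∈ stdSimplex ℝ V)
    (h : simplexwiseLinear (fun v => (p v).toE3) x = simplexwiseLinear (fun v => (p v).toE3) y)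
    {a b c d : V} (hvol : IntPoint.volume (p a) (p b) (p c) (p d) ≠ 0)
    (hxs : ∀ v, x v ≠ 0 → v ∈ ({a, b, c, d} : Finset V))
    (hys : ∀ v, y v ≠ 0 → v ∈ ({a, b, c, d} : Finset V)) : x = y := by
  have hab : a ≠ b := by rintro rfl; exact hvol (by unfold IntPoint.volume; ring)
  have hac : a ≠ c := by rintro rfl; exact hvol (by unfold IntPoint.volume; ring)
  have had : a ≠ d := by rintro rfl; exact hvol (by unfold IntPoint.volume; ring)
  have hbc : b ≠ c := by rintro rfl; exact hvol (by unfold IntPoint.volume; ring)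
  have hbd : b ≠ d := by rintro rfl; exact hvol (by unfold IntPoint.volume; ring)
  have hcd : c ≠ d := by rintro rfl; exact hvol (by unfold IntPoint.volume; ring)
  have hexp : ∀ z : V → ℝ, (∀ v, z v ≠ 0 → v ∈ ({a, b, c, d} : Finset V)) → ∀ f : V → ℝ,
      ∑ v, z v * f v = z a * f a + (z b * f b + (z c * f c + z d * f d)) := by
    intro z hz f
    have : ∑ v ∈ ({a, b, c, d} : Finset V), z v * f v = ∑ v, z v * f v :=
      Finset.sum_subset (Finset.subset_univ _) fun v _ hv => by
        have : z v = 0 := by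
          by_contra hcon
          exact hv (hz v hcon)
        rw [this, zero_mul]
    rw [← this, Finset.sum_insert (by simp [hab, hac, had]),
      Finset.sum_insert (by simp [hbc, hbd]), Finset.sum_pair hcd]
  obtain ⟨h1, h2, h3⟩ := coordinates_eq p h
  have h0 : ∑ v, x v * (1 : ℝ) = ∑ v, y v * (1 : ℝ) := by simp [hx.2, hy.2]
  rw [hexp x hxs, hexp y hys] at h0 h1 h2 h3
  have hvol' : (IntPoint.volume (p a) (p b) (p c) (p d) : ℝ) ≠ 0 := by exact_mod_cast hvol
  -- Cramer's rule: subtracting multiples of the mass equation `h0` moves `p a` to the origin and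
  -- eliminates the weight at `a`. The multipliers are the 2 × 2 minors of the edge vectors from `p
  -- a`.
  have eb : x b = y b := by
    refine sub_eq_zero.1 ((mul_eq_zero.1 ?_).resolve_left hvol')
    simp only [IntPoint.volume]
    push_cast
    linear_combination (((p c).2.1 - (p a).2.1 : ℝ) * ((p d).2.2 - (p a).2.2) -
        ((p c).2.2 - (p a).2.2) * ((p d).2.1 - (p a).2.1)) * (h1 - (p a).1 * h0) -
      (((p c).1 - (p a).1 : ℝ) * ((p d).2.2 - (p a).2.2) -
        ((p c).2.2 - (p a).2.2) * ((p d).1 - (p a).1)) * (h2 - (p a).2.1 * h0) +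
      (((p c).1 - (p a).1 : ℝ) * ((p d).2.1 - (p a).2.1) -
        ((p c).2.1 - (p a).2.1) * ((p d).1 - (p a).1)) * (h3 - (p a).2.2 * h0)
  have ec : x c = y c := by
    refine sub_eq_zero.1 ((mul_eq_zero.1 ?_).resolve_left hvol')
    simp only [IntPoint.volume]
    push_cast
    linear_combination -(((p b).2.1 - (p a).2.1 : ℝ) * ((p d).2.2 - (p a).2.2) -
        ((p b).2.2 - (p a).2.2) * ((p d).2.1 - (p a).2.1)) * (h1 - (p a).1 * h0) +
      (((p b).1 - (p a).1 : ℝ) * ((p d).2.2 - (p a).2.2) -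
        ((p b).2.2 - (p a).2.2) * ((p d).1 - (p a).1)) * (h2 - (p a).2.1 * h0) -
      (((p b).1 - (p a).1 : ℝ) * ((p d).2.1 - (p a).2.1) -
        ((p b).2.1 - (p a).2.1) * ((p d).1 - (p a).1)) * (h3 - (p a).2.2 * h0)
  have ed : x d = y d := by
    refine sub_eq_zero.1 ((mul_eq_zero.1 ?_).resolve_left hvol')
    simp only [IntPoint.volume]
    push_cast
    linear_combination (((p b).2.1 - (p a).2.1 : ℝ) * ((p c).2.2 - (p a).2.2) -
        ((p b).2.2 - (p a).2.2) * ((p c).2.1 - (p a).2.1)) * (h1 - (p a).1 * h0) -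
      (((p b).1 - (p a).1 : ℝ) * ((p c).2.2 - (p a).2.2) -
        ((p b).2.2 - (p a).2.2) * ((p c).1 - (p a).1)) * (h2 - (p a).2.1 * h0) +
      (((p b).1 - (p a).1 : ℝ) * ((p c).2.1 - (p a).2.1) -
        ((p b).2.1 - (p a).2.1) * ((p c).1 - (p a).1)) * (h3 - (p a).2.2 * h0)
  have ea : x a = y a := by linarith
  funext v
  by_cases hv : v ∈ ({a, b, c, d} : Finset V)
  · simp only [Finset.mem_insert, Finset.mem_singleton] at hv
    rcases hv with rfl | rfl | rfl | rfl <;> assumption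
  · have h1 : x v = 0 := by
      by_contra hcon
      exact hv (hxs v hcon)
    have h2 : y v = 0 := by
      by_contra hcon
      exact hv (hys v hcon)
    rw [h1, h2]

end Embedding

/-! ### The half-turn about the vertical axis -/

section HalfTurn

/-- The third coordinate axis. -/
def verticalAxis : AffineSubspace ℝ E3 :=
  (Submodule.span ℝ {(EuclideanSpace.single 2 1 : E3)}).toAffineSubspace

instance : Nonempty verticalAxis := ⟨⟨0, Submodule.zero_mem _⟩⟩

/-- The half-turn about the third coordinate axis. -/
def halfTurn : E3 ≃ᵃⁱ[ℝ] E3 := EuclideanGeometry.reflection verticalAxis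

theorem isHalfTurn_halfTurn : IsHalfTurn halfTurn := by
  refine ⟨verticalAxis, inferInstance, ?_, rfl⟩
  rw [verticalAxis, Submodule.toAffineSubspace_direction]
  exact finrank_span_singleton (by simp)

theorem halfTurn_apply (q : E3) : halfTurn q = !₂[-q 0, -q 1, q 2] := by
  have hmem : (EuclideanSpace.single 2 (q 2) : E3) ∈ verticalAxis := by
    change _ ∈ Submodule.span ℝ {(EuclideanSpace.single 2 1 : E3)}
    rw [Submodule.mem_span_singleton]
    exact ⟨q 2, by ext i; fin_cases i <;> simp⟩
  have horth : (!₂[q 0, q 1, 0] : E3) ∈ verticalAxis.directionᗮ := by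
    rw [verticalAxis, Submodule.toAffineSubspace_direction,
      Submodule.mem_orthogonal_singleton_iff_inner_right, EuclideanSpace.inner_single_left]
    simp
  have h := EuclideanGeometry.reflection_orthogonal_vadd hmem horth
  have hq : (!₂[q 0, q 1, 0] : E3) +ᵥ (EuclideanSpace.single 2 (q 2) : E3) = q := by
    ext i
    fin_cases i <;> simp
  rw [hq] at h
  rw [halfTurn, h]
  ext i
  fin_cases i <;> simp

theorem halfTurn_toE3 (p : IntPoint) :
    halfTurn p.toE3 = IntPoint.toE3 (-p.1, -p.2.1, p.2.2) := by
  rw [halfTurn_apply]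
  ext i
  fin_cases i <;> simp [IntPoint.toE3]

variable {V : Type*} [Fintype V]

/-- The axis passes through the origin, so the half-turn is linear and commutes with weighted sums.
It remains to reindex the sum by `σ`. -/
theorem halfTurn_simplexwiseLinear (p : V → IntPoint) (σ : Equiv.Perm V)
    (hp : ∀ v, p (σ v) = (-(p v).1, -(p v).2.1, (p v).2.2)) (x : V → ℝ) :
    halfTurn (simplexwiseLinear (fun v => (p v).toE3) x) =
      simplexwiseLinear (fun v => (p v).toE3) fun v => x (σ.symm v) := by
  have h1 : simplexwiseLinear (fun v => (p v).toE3) (fun v => x (σ.symm v)) =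
      ∑ v, x v • halfTurn (p v).toE3 := by
    rw [simplexwiseLinear, ← Equiv.sum_comp σ]
    refine Finset.sum_congr rfl fun v _ => ?_
    rw [Equiv.symm_apply_apply, hp, halfTurn_toE3]
  rw [h1, simplexwiseLinear]
  ext i
  fin_cases i <;> simp [halfTurn_apply]

/-- A simplicial automorphism that is compatible with the half-turn on the vertices makes the
half-turn a symmetry of the realization. -/
theorem isGeometricSymmetry_halfTurn (K : AbstractSimplicialComplex V) (p : V → IntPoint)
    (σ : Equiv.Perm V) (hσ : IsIsomorphism K K σ)
    (hp : ∀ v, p (σ v) = (-(p v).1, -(p v).2.1, (p v).2.2)) :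
    IsGeometricSymmetry K (fun v => (p v).toE3) halfTurn := by
  have hmaps : ∀ x ∈ polyhedron K, (fun v => x (σ.symm v)) ∈ polyhedron K := by
    rintro x ⟨hx, s, hs, h0⟩
    refine ⟨⟨fun v => hx.1 _, ?_⟩, s.map σ.toEmbedding, (hσ s).1 hs, fun v hv => h0 _ fun h => ?_⟩
    · rw [← hx.2]
      exact Equiv.sum_comp σ.symm x
    · exact hv (Finset.mem_map.2 ⟨_, h, by simp⟩)
  have hmaps' : ∀ x ∈ polyhedron K, (fun v => x (σ v)) ∈ polyhedron K := by
    rintro x ⟨hx, s, hs, h0⟩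
    have hs' : (s.map σ.symm.toEmbedding).map σ.toEmbedding = s := by
      ext v
      simp
    refine ⟨⟨fun v => hx.1 _, ?_⟩, s.map σ.symm.toEmbedding, (hσ _).2 (hs'.symm ▸ hs),
      fun v hv => h0 _ fun h => ?_⟩
    · rw [← hx.2]
      exact Equiv.sum_comp σ x
    · exact hv (Finset.mem_map.2 ⟨_, h, by simp⟩)
  refine ⟨?_, σ, hσ, fun x _ => halfTurn_simplexwiseLinear p σ hp x⟩
  apply Set.Subset.antisymm
  · rintro _ ⟨_, ⟨x, hx, rfl⟩, rfl⟩
    exact ⟨_, hmaps x hx, (halfTurn_simplexwiseLinear p σ hp x).symm⟩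
  · rintro _ ⟨x, hx, rfl⟩
    refine ⟨_, ⟨_, hmaps' x hx, rfl⟩, ?_⟩
    rw [halfTurn_simplexwiseLinear p σ hp]
    simp

end HalfTurn

/-! ### A numerical isomorphism invariant -/

section Invariant

variable {V W : Type*} [Fintype V] [DecidableEq V] [Fintype W] [DecidableEq W]

/-- The sum over the triangles at `v` of the product of the values of `f` at the vertices. -/
def triangleSum (K : AbstractSimplicialComplex V) (f : V → ℕ) (v : V) : ℕ :=
  ∑ s ∈ (facesOfCard K 3).filter (v ∈ ·), ∏ u ∈ s, f u

/-- An isomorphism maps the triangles at `v` bijectively onto those at `e v`. As the compatibility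
of `f` and `g` passes to their triangle sums, the operation can be iterated from the constant `1`.
-/
theorem triangleSum_of_isIsomorphism {K : AbstractSimplicialComplex V}
    {L : AbstractSimplicialComplex W} {e : V ≃ W} (he : IsIsomorphism K L e) {f : V → ℕ}
    {g : W → ℕ} (hfg : ∀ v, g (e v) = f v) (v : V) : triangleSum L g (e v) = triangleSum K f v := by
  symm
  refine Finset.sum_bij (fun s _ => s.map e.toEmbedding) ?_ ?_ ?_ ?_
  · intro s hs
    rw [Finset.mem_filter, mem_facesOfCard] at hs ⊢
    exact ⟨⟨(he s).1 hs.1.1, by rw [Finset.card_map]; exact hs.1.2⟩,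
      Finset.mem_map_of_mem e.toEmbedding hs.2⟩
  · intro s _ t _ h
    exact Finset.map_injective _ h
  · intro t ht
    rw [Finset.mem_filter, mem_facesOfCard] at ht
    have hmap : (t.map e.symm.toEmbedding).map e.toEmbedding = t := by
      ext w
      simp
    refine ⟨t.map e.symm.toEmbedding, ?_, hmap⟩
    rw [Finset.mem_filter, mem_facesOfCard]
    refine ⟨⟨(he _).2 (hmap.symm ▸ ht.1.1), by rw [Finset.card_map]; exact ht.1.2⟩, ?_⟩
    exact Finset.mem_map.2 ⟨e v, ht.2, by simp⟩
  · intro s _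
    rw [Finset.prod_map]
    exact Finset.prod_congr rfl fun u _ => (hfg u).symm

/-- A numerical invariant of complexes, obtained by iterating `triangleSum`. -/
def triangleInvariant (K : AbstractSimplicialComplex V) : ℕ :=
  ∑ v, triangleSum K (triangleSum K (triangleSum K fun _ => 1)) v ^ 2

theorem triangleInvariant_eq_of_isomorphic {K : AbstractSimplicialComplex V}
    {L : AbstractSimplicialComplex W} (h : Isomorphic K L) :
    triangleInvariant K = triangleInvariant L := by
  obtain ⟨e, he⟩ := h
  rw [triangleInvariant, triangleInvariant, ← Equiv.sum_comp e]
  refine Finset.sum_congr rfl fun v _ => ?_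
  rw [triangleSum_of_isIsomorphism he (triangleSum_of_isIsomorphism he
    (triangleSum_of_isIsomorphism he fun _ => rfl))]

/-- This makes the invariant computable from the links. Triangles at `v` correspond to consecutive
pairs in its link, bijectively because no pair also occurs reversed. -/
theorem RotationSystem.triangleSum_eq (R : RotationSystem V) (f : V → ℕ) (v : V) :
    triangleSum R.complex f v =
      f v * ((cyclicPairs (R.link v)).map fun p => f p.1 * f p.2).sum := by
  have hnd : (cyclicPairs (R.link v)).Nodup := by
    refine List.Nodup.of_map Prod.fst ?_
    rw [cyclicPairs, List.map_fst_zip (by simp)]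
    exact (List.nodup_cons.1 (R.nodup v)).2
  have hset : (facesOfCard R.complex 3).filter (v ∈ ·) =
      (cyclicPairs (R.link v)).toFinset.image fun p => {v, p.1, p.2} := by
    ext s
    simp only [Finset.mem_filter, mem_facesOfCard, Finset.mem_image, List.mem_toFinset]
    constructor
    · rintro ⟨⟨hs, h3⟩, hv⟩
      obtain ⟨b, c, h, hsub⟩ := R.exists_of_mem_complex hs hv
      refine ⟨(b, c), h, (Finset.eq_of_subset_of_card_le hsub ?_).symm⟩
      rw [h3]
      exact Finset.card_le_three
    · rintro ⟨⟨b, c⟩, h, rfl⟩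
      have h' : (v, b, c) ∈ R.triples := h
      obtain ⟨h1, h2, h3⟩ := R.ne_of_mem_triples h'
      exact ⟨⟨R.mem_complex_of_subset (by simp) h' le_rfl,
        Finset.card_eq_three.2 ⟨_, _, _, h1, h3, h2, rfl⟩⟩, by simp⟩
  have hinj : Set.InjOn (fun p : V × V => ({v, p.1, p.2} : Finset V))
      (cyclicPairs (R.link v)).toFinset := by
    rintro ⟨b, c⟩ hbc ⟨b', c'⟩ hbc' h
    have hbc : (v, b, c) ∈ R.triples := R.mem_triples.2 (by simpa using hbc)
    have hbc' : (v, b', c') ∈ R.triples := R.mem_triples.2 (by simpa using hbc')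
    obtain ⟨h1, h2, h3⟩ := R.ne_of_mem_triples hbc
    have hsets : ({v, b, c} : Finset V) = {v, b', c'} := h
    have hb : b ∈ ({v, b', c'} : Finset V) := hsets ▸ (by simp)
    have hc : c ∈ ({v, b', c'} : Finset V) := hsets ▸ (by simp)
    simp only [Finset.mem_insert, Finset.mem_singleton, h1.symm, h3.symm, false_or] at hb hc
    rcases hb with rfl | rfl <;> rcases hc with rfl | rfl
    · exact absurd rfl h2
    · rfl
    · exact absurd hbc' (R.not_swap_mem hbc)
    · exact absurd rfl h2
  rw [triangleSum, hset, Finset.sum_image hinj, ← List.sum_toFinset _ hnd, Finset.mul_sum]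
  refine Finset.sum_congr rfl fun p hp => ?_
  obtain ⟨h1, h2, h3⟩ := R.ne_of_mem_triples (a := v) (b := p.1) (c := p.2) (List.mem_toFinset.1 hp)
  rw [Finset.prod_insert (by simp [h1, h3]), Finset.prod_pair h2]

end Invariant

/-! ### Certificates and their Boolean check -/

section Force

/-- Apply a function to a natural number by recursion on the number. This makes the kernel evaluate
the number first. -/
def force {α : Type*} (n : ℕ) (g : ℕ → α) : α :=
  Nat.rec (g 0) (fun k _ => g (k + 1)) n

theorem force_eq {α : Type*} (n : ℕ) (g : ℕ → α) : force n g = g n := by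
  cases n <;> rfl

/-- `force` for all entries of a list. -/
def forceList {α : Type*} (l : List ℕ) (g : List ℕ → α) : α :=
  List.rec (motive := fun _ => (List ℕ → α) → α) (fun g => g [])
    (fun a _ ih g => force a fun a' => ih fun l' => g (a' :: l')) l g

theorem forceList_eq {α : Type*} (l : List ℕ) (g : List ℕ → α) : forceList l g = g l := by
  induction l generalizing g with
  | nil => rfl
  | cons a l ih =>
    change (force a fun a' => forceList l fun l' => g (a' :: l')) = _
    rw [force_eq, ih]

end Force

/-- The involution of the vertices that fixes `0` and exchanges `2 i + 1` and `2 i + 2`. -/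
def swapPairs : Equiv.Perm (Fin 11) :=
  Function.Involutive.toPerm
    (fun v => if v.val = 0 then v else if v.val % 2 = 1 then v + 1 else v - 1)
    (by unfold Function.Involutive; decide)

/-- A triangulated surface with eleven vertices that is symmetric under `swapPairs`, with integer
coordinates of a realization: the oriented links of the vertices, the triangles `{a, b, c}` coded as
`a + 16 b + 256 c`, the third coordinate of the vertex `0` on the vertical axis, the positions of
the odd vertices, normal vectors of planes that separate the triangles, and the value of the
invariant of the complex. -/
structure SurfaceData where
  links : List (List ℕ)
  triangles : List ℕ
  apex : ℤ
  positions : List IntPoint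
  normals : List IntPoint
  invariant : ℕ

/-- The natural numbers below eleven. -/
def vertexList : List ℕ := [0, 1, 2, 3, 4, 5, 6, 7, 8, 9, 10]

/-- The values of `swapPairs`. -/
def swapped (v : ℕ) : ℕ := [0, 2, 1, 4, 3, 6, 5, 8, 7, 10, 9].getD v 0

/-- All pairs of consecutive entries of a list, with `z` after the last entry, satisfy `r`. -/
def allNext (r : ℕ → ℕ → Bool) (z : ℕ) (l : List ℕ) : Bool :=
  List.rec true (fun x l ih => r x (l.headD z) && ih) l

/-- Some pair of consecutive entries of a list, with `z` after the last entry, satisfies `r`. -/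
def anyNext (r : ℕ → ℕ → Bool) (z : ℕ) (l : List ℕ) : Bool :=
  List.rec false (fun x l ih => r x (l.headD z) || ih) l

/-- The sum of `f` over the pairs of consecutive entries of a list, with `z` after the last one. -/
def sumNext (f : ℕ → ℕ → ℕ) (z : ℕ) (l : List ℕ) : ℕ :=
  List.rec 0 (fun x l ih => Nat.add (f x (l.headD z)) ih) l

/-- The entries of a list are distinct. -/
def isNodup (l : List ℕ) : Bool :=
  List.rec true (fun x l ih => (l.all fun y => !Nat.beq x y) && ih) l

/-- A relation holds for all pairs of a list, where the entries of a pair keep their order. -/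
def allPairs (r : ℕ → ℕ → Bool) (l : List ℕ) : Bool :=
  List.rec true (fun a l ih => (r a a && l.all (r a)) && ih) l

/-- The number with the single binary digit `1` at the place that belongs to `v` and `w`. -/
def pairMask (v w : ℕ) : ℕ := Nat.shiftLeft 1 (Nat.add (Nat.mul 11 v) w)

/-- The union of the sets `f v` of binary digits. -/
def unionMask (l : List ℕ) (f : ℕ → ℕ) : ℕ :=
  List.rec 0 (fun v _ ih => Nat.lor (f v) ih) l

namespace SurfaceData

variable (D : SurfaceData)

/-- The list of the vertices in the link of a vertex. -/
def natLink (v : ℕ) : List ℕ := D.links.getD v []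

/-- The cyclic successors in the link of `a` satisfy `r`. -/
def allLink (a : ℕ) (r : ℕ → ℕ → Bool) : Bool :=
  allNext r ((D.natLink a).headD 0) (D.natLink a)

/-- The entry `c` follows `b` in the link of `a`. -/
def follows (a b c : ℕ) : Bool :=
  anyNext (fun x y => Nat.beq x b && Nat.beq y c) ((D.natLink a).headD 0) (D.natLink a)

/-- The links form a rotation system. -/
def isRotation : Bool :=
  vertexList.all fun a => Nat.ble 4 (D.natLink a).length && isNodup (a :: D.natLink a) &&
    (D.natLink a).all (Nat.blt · 11) && D.allLink a fun b c => D.follows b c a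

/-- Some vertex is joined to all others, and the number of edges is that of genus four. -/
def hasGenusFour : Bool :=
  (vertexList.any fun o => vertexList.all fun u => Nat.beq u o || (D.natLink o).any (Nat.beq u)) &&
    Nat.beq (vertexList.map fun v => (D.natLink v).length).sum 102

/-- The triangles are permuted by `swapPairs`. -/
def isSymmetric : Bool :=
  vertexList.all fun a => D.allLink a fun b c => D.follows (swapped a) (swapped b) (swapped c)

/-- The vertices of a coded triangle. -/
def vertices (t : ℕ) : List ℕ :=
  [Nat.mod t 16, Nat.mod (Nat.div t 16) 16, Nat.div t 256]

/-- Every triangle of the rotation system occurs in the list of triangles. -/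
def covers : Bool :=
  (D.triangles.all fun t => (vertices t).all (Nat.blt · 11)) && vertexList.all fun a => D.allLink a fun b c => D.triangles.any fun t =>
    ((vertices t).any (Nat.beq a) && (vertices t).any (Nat.beq b)) && (vertices t).any (Nat.beq c)

/-- The passage from values of a function at the vertices to those of its `triangleSum`. -/
def nextLevel (l : List ℕ) : List ℕ :=
  vertexList.map fun a => Nat.mul (l.getD a 0)
    (sumNext (fun b c => Nat.mul (l.getD b 0) (l.getD c 0)) ((D.natLink a).headD 0) (D.natLink a))

/-- Computation of the invariant of the complex. -/
def hasInvariant : Bool :=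
  forceList (D.nextLevel [1, 1, 1, 1, 1, 1, 1, 1, 1, 1, 1]) fun l₁ =>
    forceList (D.nextLevel l₁) fun l₂ =>
      forceList (D.nextLevel l₂) fun l₃ => Nat.beq (l₃.map (· ^ 2)).sum D.invariant

/-- The position of a vertex. -/
def position (v : ℕ) : IntPoint :=
  if v = 0 then (0, 0, D.apex)
  else if v % 2 = 1 then D.positions.getD ((v - 1) / 2) (0, 0, 0)
  else
    let q := D.positions.getD ((v - 1) / 2) (0, 0, 0)
    (-q.1, -q.2.1, q.2.2)

/-- The heights of the vertices in the direction `n`, shifted to natural numbers. -/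
def heights (n : IntPoint) : List ℕ :=
  vertexList.map fun v => (n.dot (D.position v) + 32768).toNat

/-- The set of all pairs of vertices `v`, `w` such that `v = w` or `w` is lower than `v`, as the
binary digits of a number. -/
def orderMask (h : List ℕ) : ℕ :=
  unionMask vertexList fun v => unionMask vertexList fun w =>
    bif Nat.beq v w || Nat.blt (h.getD w 0) (h.getD v 0) then pairMask v w else 0

/-- The set of pairs of a vertex of `s` and a vertex of `t`, as the binary digits of a number. -/
def productMask (s t : ℕ) : ℕ :=
  unionMask (vertices s) fun v => unionMask (vertices t) (pairMask v)

/-- Apply a Boolean function to the list of orders of the vertices in the given directions. -/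
def withOrders (ns : List IntPoint) (g : List ℕ → Bool) : Bool :=
  List.rec (motive := fun _ => (List ℕ → Bool) → Bool) (fun g => g [])
    (fun n _ ih g => forceList (D.heights n) fun h => force (orderMask h) fun m =>
      ih fun l => g (m :: l)) ns g

/-- Some of the given orders puts one of the triangles `s` and `t` above the other, apart from
common vertices. -/
def separated (ms : List ℕ) (s t : ℕ) : Bool :=
  force (productMask s t) fun p => force (productMask t s) fun q =>
    ms.any fun m => Nat.beq (Nat.land m p) p || Nat.beq (Nat.land m q) q

/-- The triangles `s` and `t` lie in a nondegenerate tetrahedron. -/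
def adjacent (s t : ℕ) : Bool :=
  vertexList.any fun d =>
    ((vertices t).all fun w => Nat.beq w d || (vertices s).any (Nat.beq w)) &&
      decide (IntPoint.volume (D.position (Nat.mod s 16)) (D.position (Nat.mod (Nat.div s 16) 16))
        (D.position (Nat.div s 256)) (D.position d) ≠ 0)

/-- All pairs of triangles are separated or lie in a nondegenerate tetrahedron. -/
def isEmbedded : Bool :=
  D.withOrders D.normals fun ms => allPairs (fun s t => separated ms s t || D.adjacent s t) D.triangles

/-- The data describe a surface together with a realization. -/
def isValid : Bool :=
  (D.isRotation && D.hasGenusFour && D.isSymmetric) && (D.covers && D.hasInvariant && D.isEmbedded)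

end SurfaceData

/-! ### Meaning of the computed list and bit operations -/

theorem zip_tail_append_cons {α : Type*} (x z : α) (l : List α) :
    (x :: l).zip (l ++ [z]) = (x, l.headD z) :: l.zip (l.tail ++ [z]) := by
  cases l <;> simp

/-- With the head of the list as the value after the last entry, cyclic pairs can be visited in a
single structural recursion, as in `allNext`, `anyNext` and `sumNext`. The default `d` matters only
for the empty list, which has no pairs. -/
theorem cyclicPairs_eq {α : Type*} (d : α) (l : List α) :
    cyclicPairs l = l.zip (l.tail ++ [l.headD d]) := by
  cases l <;> simp [cyclicPairs]

theorem cyclicPairs_map {α β : Type*} (f : α → β) (l : List α) :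
    cyclicPairs (l.map f) = (cyclicPairs l).map (Prod.map f f) := by
  rw [cyclicPairs, cyclicPairs, ← List.map_rotate, List.zip_map]

theorem mem_of_mem_cyclicPairs {α : Type*} {l : List α} {p : α × α} (h : p ∈ cyclicPairs l) :
    p.1 ∈ l ∧ p.2 ∈ l := by
  have := List.of_mem_zip (a := p.1) (b := p.2) h
  exact ⟨this.1, by simpa using this.2⟩

theorem allNext_iff (r : ℕ → ℕ → Bool) (z : ℕ) (l : List ℕ) :
    allNext r z l = true ↔ ∀ p ∈ l.zip (l.tail ++ [z]), r p.1 p.2 = true := by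
  induction l with
  | nil => simp [allNext]
  | cons x l ih =>
    change (r x (l.headD z) && allNext r z l) = true ↔ _
    rw [Bool.and_eq_true, ih, List.tail_cons, zip_tail_append_cons, List.forall_mem_cons]

theorem anyNext_iff (r : ℕ → ℕ → Bool) (z : ℕ) (l : List ℕ) :
    anyNext r z l = true ↔ ∃ p ∈ l.zip (l.tail ++ [z]), r p.1 p.2 = true := by
  induction l with
  | nil => simp [anyNext]
  | cons x l ih =>
    change (r x (l.headD z) || anyNext r z l) = true ↔ _
    rw [Bool.or_eq_true, ih, List.tail_cons, zip_tail_append_cons, List.exists_mem_cons_iff]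

theorem sumNext_eq (f : ℕ → ℕ → ℕ) (z : ℕ) (l : List ℕ) :
    sumNext f z l = ((l.zip (l.tail ++ [z])).map fun p => f p.1 p.2).sum := by
  induction l with
  | nil => rfl
  | cons x l ih =>
    change f x (l.headD z) + sumNext f z l = _
    rw [ih, List.tail_cons, zip_tail_append_cons, List.map_cons, List.sum_cons]

theorem nodup_of_isNodup {l : List ℕ} (h : isNodup l = true) : l.Nodup := by
  induction l with
  | nil => exact List.nodup_nil
  | cons x l ih =>
    change ((l.all fun y => !Nat.beq x y) && isNodup l) = true at h
    rw [Bool.and_eq_true, List.all_eq_true] at h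
    refine List.nodup_cons.2 ⟨fun hx => ?_, ih h.2⟩
    simpa using h.1 x hx

/-- Each unordered pair is tested in one order only, hence the disjunction. The diagonal is
included, because two points of the same triangle must be told apart as well. -/
theorem or_of_allPairs {r : ℕ → ℕ → Bool} {l : List ℕ} (h : allPairs r l = true) {s t : ℕ}
    (hs : s ∈ l) (ht : t ∈ l) : r s t = true ∨ r t s = true := by
  induction l with
  | nil => simp at hs
  | cons x l ih =>
    change ((r x x && l.all (r x)) && allPairs r l) = true at h
    rw [Bool.and_eq_true, Bool.and_eq_true, List.all_eq_true] at h
    rcases List.mem_cons.1 hs with hs | hs <;> rcases List.mem_cons.1 ht with ht | ht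
    · exact Or.inl (hs ▸ ht ▸ h.1.1)
    · exact Or.inl (hs ▸ h.1.2 t ht)
    · exact Or.inr (ht ▸ h.1.2 s hs)
    · exact ih h.2 hs ht

theorem testBit_pairMask {v w i : ℕ} : (pairMask v w).testBit i = true ↔ i = 11 * v + w := by
  change (1 <<< (11 * v + w)).testBit i = true ↔ _
  rw [Nat.one_shiftLeft, Nat.testBit_two_pow, decide_eq_true_iff, eq_comm]

theorem testBit_unionMask {l : List ℕ} {f : ℕ → ℕ} {i : ℕ} :
    (unionMask l f).testBit i = true ↔ ∃ v ∈ l, (f v).testBit i = true := by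
  induction l with
  | nil => simp [unionMask]
  | cons x l ih =>
    change (f x ||| unionMask l f).testBit i = true ↔ _
    rw [Nat.testBit_or, Bool.or_eq_true, ih, List.exists_mem_cons_iff]

theorem mem_vertexList {v : ℕ} : v ∈ vertexList ↔ v < 11 := by
  simp only [vertexList, List.mem_cons, List.not_mem_nil, or_false]
  omega

theorem vertexList_all {f : ℕ → Bool} : vertexList.all f = true ↔ ∀ v : Fin 11, f v = true := by
  rw [List.all_eq_true]
  exact ⟨fun h v => h v (mem_vertexList.2 v.2), fun h v hv => h ⟨v, mem_vertexList.1 hv⟩⟩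

theorem getD_map_vertexList (f : ℕ → ℕ) (v : Fin 11) : (vertexList.map f).getD v 0 = f v := by
  fin_cases v <;> rfl

theorem sum_map_vertexList (f : ℕ → ℕ) : (vertexList.map f).sum = ∑ v : Fin 11, f v := by
  simp [Fin.sum_univ_succ, vertexList]

theorem swapped_eq (v : Fin 11) : swapped v = (swapPairs v).val := by
  revert v
  decide

theorem swapPairs_symm : swapPairs.symm = swapPairs :=
  Equiv.ext fun _ => rfl

/-! ### Soundness of the certificate -/

namespace SurfaceData

variable (D : SurfaceData)

theorem allLink_iff {a : ℕ} {r : ℕ → ℕ → Bool} :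
    D.allLink a r = true ↔ ∀ p ∈ cyclicPairs (D.natLink a), r p.1 p.2 = true := by
  rw [allLink, allNext_iff, ← cyclicPairs_eq]

theorem follows_iff {a b c : ℕ} :
    D.follows a b c = true ↔ (b, c) ∈ cyclicPairs (D.natLink a) := by
  rw [follows, anyNext_iff, ← cyclicPairs_eq]
  simp

/-- The link of a vertex as a list of vertices. -/
def link (v : Fin 11) : List (Fin 11) := (D.natLink v).map (Fin.ofNat 11)

variable {D}

theorem isRotation_iff : D.isRotation = true ↔ ∀ a : Fin 11, ((4 ≤ (D.natLink a).length ∧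
    isNodup (a.val :: D.natLink a) = true) ∧ ∀ x ∈ D.natLink a, x < 11) ∧
      ∀ p ∈ cyclicPairs (D.natLink a), (p.2, a.val) ∈ cyclicPairs (D.natLink p.1) := by
  rw [isRotation, vertexList_all]
  refine forall_congr' fun a => ?_
  simp only [Bool.and_eq_true, Nat.ble_eq, List.all_eq_true, Nat.blt_eq, allLink_iff, follows_iff]

theorem mem_cyclicPairs_link (h : D.isRotation = true) {a b c : Fin 11} :
    (b, c) ∈ cyclicPairs (D.link a) ↔ (b.val, c.val) ∈ cyclicPairs (D.natLink a) := by
  have hlt := ((isRotation_iff.1 h) a).1.2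
  rw [link, cyclicPairs_map, List.mem_map]
  constructor
  · rintro ⟨⟨x, y⟩, hp, hxy⟩
    have hm := mem_of_mem_cyclicPairs hp
    simp only [Prod.map_apply, Prod.mk.injEq] at hxy
    rw [← hxy.1, ← hxy.2, Fin.val_ofNat, Fin.val_ofNat, Nat.mod_eq_of_lt (hlt x hm.1),
      Nat.mod_eq_of_lt (hlt y hm.2)]
    exact hp
  · intro hp
    exact ⟨_, hp, by simp⟩

theorem map_val_link (h : D.isRotation = true) (a : Fin 11) :
    (D.link a).map Fin.val = D.natLink a := by
  have hlt := ((isRotation_iff.1 h) a).1.2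
  rw [link, List.map_map]
  conv_rhs => rw [← List.map_id (D.natLink a)]
  exact List.map_congr_left fun x hx => Nat.mod_eq_of_lt (hlt x hx)

/-- The rotation system described by the links. -/
def rotationSystem (h : D.isRotation = true) : RotationSystem (Fin 11) where
  link := D.link
  four_le_length v := by
    rw [link, List.length_map]
    exact ((isRotation_iff.1 h) v).1.1.1
  nodup v := by
    refine List.Nodup.of_map Fin.val ?_
    rw [List.map_cons, map_val_link h]
    exact nodup_of_isNodup ((isRotation_iff.1 h) v).1.1.2
  cyclic a p hp := by
    rw [mem_cyclicPairs_link h] at hp ⊢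
    exact ((isRotation_iff.1 h) a).2 _ hp

theorem mem_triples_iff (h : D.isRotation = true) {a b c : Fin 11} :
    (a, b, c) ∈ (rotationSystem h).triples ↔ (b.val, c.val) ∈ cyclicPairs (D.natLink a) :=
  mem_cyclicPairs_link h

theorem isOrientableTriangulation (h : D.isRotation = true) (hg : D.hasGenusFour = true) :
    IsOrientableTriangulation (rotationSystem h).complex 4 := by
  rw [hasGenusFour, Bool.and_eq_true, List.any_eq_true] at hg
  obtain ⟨⟨o, ho, hjoin⟩, hsum⟩ := hg
  rw [vertexList_all] at hjoin
  rw [Nat.beq_eq, sum_map_vertexList] at hsum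
  refine (rotationSystem h).isOrientableTriangulation ⟨o, mem_vertexList.1 ho⟩ (fun u hu => ?_) ?_
  · have h1 := hjoin u
    rw [Bool.or_eq_true, List.any_eq_true] at h1
    rcases h1 with h1 | ⟨x, hx, hxu⟩
    · exact absurd (Fin.ext (Nat.eq_of_beq_eq_true h1)) hu
    · refine List.mem_map.2 ⟨x, hx, ?_⟩
      rw [← Nat.eq_of_beq_eq_true hxu]
      simp
  · have h1 : ∀ v, ((rotationSystem h).link v).length = (D.natLink v).length :=
      fun v => List.length_map _
    -- The degree sum 102 fits genus four: `6 · 11 + 12 · 4 = 102 + 12`.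
    simp only [h1, hsum, Fintype.card_fin]

theorem isIsomorphism_swapPairs (h : D.isRotation = true) (hs : D.isSymmetric = true) :
    IsIsomorphism (rotationSystem h).complex (rotationSystem h).complex swapPairs := by
  have hstep : ∀ s ∈ (rotationSystem h).complex.faces,
      s.map swapPairs.toEmbedding ∈ (rotationSystem h).complex.faces := by
    intro s hsf
    obtain ⟨a, ha⟩ := hsf.1
    obtain ⟨b, c, habc, hsub⟩ := (rotationSystem h).exists_of_mem_complex hsf ha
    rw [isSymmetric, vertexList_all] at hs
    have h1 := (D.allLink_iff.1 (hs a)) _ ((mem_triples_iff h).1 habc)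
    rw [follows_iff, swapped_eq, swapped_eq, swapped_eq] at h1
    refine (rotationSystem h).mem_complex_of_subset ⟨_, Finset.mem_map_of_mem _ ha⟩
      ((mem_triples_iff h).2 h1) ?_
    intro w hw
    obtain ⟨v, hv, rfl⟩ := Finset.mem_map.1 hw
    have := hsub hv
    simp only [Finset.mem_insert, Finset.mem_singleton] at this ⊢
    rcases this with rfl | rfl | rfl <;> simp
  intro s
  refine ⟨hstep s, fun h1 => ?_⟩
  have h2 := hstep _ h1
  -- The check covers one direction only; the converse follows since `swapPairs` is an involution.
  have hmap : (s.map swapPairs.toEmbedding).map swapPairs.toEmbedding = s := by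
    conv_lhs => rw [← swapPairs_symm]
    ext w
    simp [swapPairs_symm]
  rwa [hmap] at h2

/-- Injectivity needs only that the listed triangles cover the complex; superfluous entries in the
list would do no harm. -/
theorem exists_triangle (h : D.isRotation = true) (hc : D.covers = true) {s : Finset (Fin 11)}
    (hs : s ∈ (rotationSystem h).complex.faces) :
    ∃ t ∈ D.triangles, ∀ v ∈ s, v.val ∈ vertices t := by
  obtain ⟨a, ha⟩ := hs.1
  obtain ⟨b, c, habc, hsub⟩ := (rotationSystem h).exists_of_mem_complex hs ha
  rw [covers, Bool.and_eq_true, vertexList_all] at hc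
  have h1 := (D.allLink_iff.1 (hc.2 a)) _ ((mem_triples_iff h).1 habc)
  rw [List.any_eq_true] at h1
  obtain ⟨t, ht, h1⟩ := h1
  simp only [Bool.and_eq_true, List.any_eq_true, Nat.beq_eq, exists_eq_right'] at h1
  refine ⟨t, ht, fun v hv => ?_⟩
  have := hsub hv
  simp only [Finset.mem_insert, Finset.mem_singleton] at this
  rcases this with rfl | rfl | rfl
  · exact h1.1.1
  · exact h1.1.2
  · exact h1.2

theorem getD_nextLevel (h : D.isRotation = true) {l : List ℕ} {f : Fin 11 → ℕ}
    (hl : ∀ v : Fin 11, l.getD v 0 = f v) (v : Fin 11) :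
    (D.nextLevel l).getD v 0 = triangleSum (rotationSystem h).complex f v := by
  have hlink : (rotationSystem h).link v = D.link v := rfl
  rw [RotationSystem.triangleSum_eq, nextLevel, getD_map_vertexList, sumNext_eq, ← cyclicPairs_eq,
    hl, hlink, ← map_val_link h, cyclicPairs_map, List.map_map]
  refine congrArg (fun g => f v * (List.map g (cyclicPairs (D.link v))).sum) (funext fun p => ?_)
  change l.getD _ 0 * l.getD _ 0 = _
  simp only [Prod.map_fst, Prod.map_snd, hl]

theorem triangleInvariant_eq (h : D.isRotation = true) (hi : D.hasInvariant = true) :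
    triangleInvariant (rotationSystem h).complex = D.invariant := by
  rw [hasInvariant, forceList_eq, forceList_eq, forceList_eq, Nat.beq_eq] at hi
  have h0 : ∀ v : Fin 11, [1, 1, 1, 1, 1, 1, 1, 1, 1, 1, 1].getD v 0 = 1 := by decide
  have h3 := getD_nextLevel h (getD_nextLevel h (getD_nextLevel h h0))
  rw [← hi, triangleInvariant]
  -- Naming the second level keeps `simp` from unfolding more than the outermost `nextLevel`.
  generalize hl : D.nextLevel (D.nextLevel [1, 1, 1, 1, 1, 1, 1, 1, 1, 1, 1]) = l at h3
  simp only [nextLevel, getD_map_vertexList] at h3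
  rw [nextLevel, List.map_map, sum_map_vertexList]
  exact Finset.sum_congr rfl fun v _ => by rw [Function.comp_apply, h3]

theorem position_swapPairs (D : SurfaceData) (v : Fin 11) :
    D.position (swapPairs v) =
      (-(D.position v).1, -(D.position v).2.1, (D.position v).2.2) := by
  fin_cases v <;> simp [← swapped_eq, swapped, position]

theorem withOrders_eq (D : SurfaceData) (ns : List IntPoint) (g : List ℕ → Bool) :
    D.withOrders ns g = g (ns.map fun n => orderMask (D.heights n)) := by
  induction ns generalizing g with
  | nil => rfl
  | cons n ns ih =>
    change (forceList (D.heights n) fun h => force (orderMask h) fun m =>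
      D.withOrders ns fun l => g (m :: l)) = _
    rw [forceList_eq, force_eq, ih, List.map_cons]

theorem dot_lt_of_testBit_orderMask (D : SurfaceData) {n : IntPoint} {v w : Fin 11}
    (h : (orderMask (D.heights n)).testBit (11 * v + w) = true) :
    v = w ∨ n.dot (D.position w) < n.dot (D.position v) := by
  simp only [orderMask, testBit_unionMask] at h
  obtain ⟨a, ha, b, hb, h⟩ := h
  rw [mem_vertexList] at ha hb
  by_cases hab : (Nat.beq a b || Nat.blt ((D.heights n).getD b 0) ((D.heights n).getD a 0)) = true
  · rw [hab, cond_true, testBit_pairMask] at h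
    have hv : a = v := by omega
    have hw : b = w := by omega
    subst hv hw
    rw [Bool.or_eq_true, Nat.beq_eq, Nat.blt_eq, heights, getD_map_vertexList,
      getD_map_vertexList] at hab
    -- The truncation in `heights` does not affect soundness: a strict inequality between values of
    -- `toNat` implies the one between the integers, whatever the shift.
    rcases hab with hab | hab
    · exact Or.inl (Fin.ext hab)
    · right
      omega
  · rw [Bool.not_eq_true] at hab
    rw [hab, cond_false, Nat.zero_testBit] at h
    exact absurd h (by simp)

/-- Inclusion of finite relations is tested by one bitwise conjunction: `m &&& p = p` says that the
digits of `p` are among those of `m`. -/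
theorem testBit_of_land_productMask {m s t v w : ℕ}
    (h : Nat.beq (Nat.land m (productMask s t)) (productMask s t) = true) (hv : v ∈ vertices s)
    (hw : w ∈ vertices t) : m.testBit (11 * v + w) = true := by
  have h1 : (productMask s t).testBit (11 * v + w) = true := by
    simp only [productMask, testBit_unionMask, testBit_pairMask]
    exact ⟨v, hv, w, hw, rfl⟩
  have h2 : m &&& productMask s t = productMask s t := Nat.eq_of_beq_eq_true h
  rw [← h2, Nat.testBit_and, Bool.and_eq_true] at h1
  exact h1.1

theorem vertices_eq {t : ℕ} (h : ∀ v ∈ vertices t, v < 11) : ∃ a b c : Fin 11,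
    a.val = Nat.mod t 16 ∧ b.val = Nat.mod (Nat.div t 16) 16 ∧ c.val = Nat.div t 256 := by
  simp only [vertices, List.mem_cons, List.not_mem_nil, or_false, forall_eq_or_imp,
    forall_eq] at h
  exact ⟨⟨_, h.1⟩, ⟨_, h.2.1⟩, ⟨_, h.2.2⟩, rfl, rfl, rfl⟩

/-- This handles triangles with a common edge, where strict separation is impossible, and a triangle
paired with itself, where `d` is any vertex off its plane. -/
theorem eq_of_adjacent (D : SurfaceData) {x y : Fin 11 → ℝ} (hx : x ∈ stdSimplex ℝ (Fin 11))
    (hy : y ∈ stdSimplex ℝ (Fin 11))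
    (hxy : simplexwiseLinear (fun v : Fin 11 => (D.position v).toE3) x =
      simplexwiseLinear (fun v : Fin 11 => (D.position v).toE3) y) {s t : ℕ}
    (hs : ∀ v ∈ vertices s, v < 11) (hxs : ∀ v : Fin 11, x v ≠ 0 → v.val ∈ vertices s)
    (hyt : ∀ v : Fin 11, y v ≠ 0 → v.val ∈ vertices t) (h : D.adjacent s t = true) : x = y := by
  simp only [adjacent, List.any_eq_true, Bool.and_eq_true, List.all_eq_true, Bool.or_eq_true,
    Nat.beq_eq, exists_eq_right', decide_eq_true_iff, mem_vertexList] at h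
  obtain ⟨d, hd, hsub, hvol⟩ := h
  obtain ⟨a, b, c, ha, hb, hc⟩ := vertices_eq hs
  rw [← ha, ← hb, ← hc] at hvol
  have hmem : ∀ v : Fin 11, v.val ∈ vertices s → v ∈ ({a, b, c, ⟨d, hd⟩} : Finset (Fin 11)) := by
    intro v hv
    rw [vertices, ← ha, ← hb, ← hc] at hv
    simp only [List.mem_cons, List.not_mem_nil, or_false] at hv
    simp only [Finset.mem_insert, Finset.mem_singleton, Fin.ext_iff]
    tauto
  refine eq_of_volume_ne_zero (fun v : Fin 11 => D.position v) hx hy hxy (d := ⟨d, hd⟩) hvol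
    (fun v hv => hmem v (hxs v hv)) fun v hv => ?_
  rcases hsub v (hyt v hv) with rfl | hv
  · simp
  · exact hmem v hv

theorem eq_of_separated_triangles (D : SurfaceData) {x y : Fin 11 → ℝ}
    (hx : x ∈ stdSimplex ℝ (Fin 11)) (hy : y ∈ stdSimplex ℝ (Fin 11))
    (hxy : simplexwiseLinear (fun v : Fin 11 => (D.position v).toE3) x =
      simplexwiseLinear (fun v : Fin 11 => (D.position v).toE3) y) {s t : ℕ}
    (hxs : ∀ v : Fin 11, x v ≠ 0 → v.val ∈ vertices s)
    (hyt : ∀ v : Fin 11, y v ≠ 0 → v.val ∈ vertices t) {ns : List IntPoint}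
    (h : separated (ns.map fun n => orderMask (D.heights n)) s t = true) : x = y := by
  rw [separated, force_eq, force_eq, List.any_eq_true] at h
  obtain ⟨m, hm, h⟩ := h
  obtain ⟨n, -, rfl⟩ := List.mem_map.1 hm
  rcases (Bool.or_eq_true _ _).mp h with h | h
  · exact eq_of_separated (fun v : Fin 11 => D.position v) hx hy hxy n fun v w hv hw =>
      D.dot_lt_of_testBit_orderMask (testBit_of_land_productMask h (hxs v hv) (hyt w hw))
  · exact (eq_of_separated (fun v : Fin 11 => D.position v) hy hx hxy.symm n fun v w hv hw =>
      D.dot_lt_of_testBit_orderMask (testBit_of_land_productMask h (hyt v hv) (hxs w hw))).symm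

/-- Two points with the same image are carried by listed triangles `s` and `t`. The certificate for
this pair, in the order in which it was tested, shows that the points are equal. -/
theorem isPolyhedralEmbedding (h : D.isRotation = true) (hc : D.covers = true)
    (he : D.isEmbedded = true) :
    IsPolyhedralEmbedding (rotationSystem h).complex fun v => (D.position v).toE3 := by
  rw [isEmbedded, withOrders_eq] at he
  have hlt : ∀ t ∈ D.triangles, ∀ v ∈ vertices t, v < 11 := by
    simp only [covers, Bool.and_eq_true, List.all_eq_true, Nat.blt_eq] at hc
    exact hc.1
  have hcarrier : ∀ x ∈ polyhedron (rotationSystem h).complex, x ∈ stdSimplex ℝ (Fin 11) ∧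
      ∃ t ∈ D.triangles, ∀ v : Fin 11, x v ≠ 0 → v.val ∈ vertices t := by
    rintro x ⟨hx, s, hs, h0⟩
    obtain ⟨t, ht, hst⟩ := exists_triangle h hc hs
    exact ⟨hx, t, ht, fun v hv => hst v (by_contra fun hvs => hv (h0 v hvs))⟩
  intro x hx y hy hxy
  obtain ⟨hx, s, hs, hxs⟩ := hcarrier x hx
  obtain ⟨hy, t, ht, hyt⟩ := hcarrier y hy
  rcases or_of_allPairs he hs ht with h1 | h1 <;> rcases (Bool.or_eq_true _ _).mp h1 with h1 | h1
  · exact D.eq_of_separated_triangles hx hy hxy hxs hyt h1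
  · exact D.eq_of_adjacent hx hy hxy (hlt s hs) hxs hyt h1
  · exact (D.eq_of_separated_triangles hy hx hxy.symm hyt hxs h1).symm
  · exact (D.eq_of_adjacent hy hx hxy.symm (hlt t ht) hyt hxs h1).symm

theorem isValid_iff : D.isValid = true ↔
    ((D.isRotation = true ∧ D.hasGenusFour = true) ∧ D.isSymmetric = true) ∧
      (D.covers = true ∧ D.hasInvariant = true) ∧ D.isEmbedded = true := by
  simp only [isValid, Bool.and_eq_true]

/-- Valid data with a given invariant describe a vertex-minimal triangulation of the surface of
genus four with this invariant and a polyhedral embedding with a half-turn symmetry. -/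
theorem exists_complex (h : D.isValid = true) : ∃ K : AbstractSimplicialComplex (Fin 11),
    triangleInvariant K = D.invariant ∧ IsVertexMinimalTriangulation K 4 ∧
    ∃ ψ : Fin 11 → E3, IsPolyhedralEmbedding K ψ ∧
      ∃ R : E3 ≃ᵃⁱ[ℝ] E3, IsHalfTurn R ∧ IsGeometricSymmetry K ψ R := by
  obtain ⟨⟨⟨hr, hg⟩, hs⟩, ⟨hc, hi⟩, he⟩ := isValid_iff.1 h
  refine ⟨(rotationSystem hr).complex, triangleInvariant_eq hr hi,
    ⟨isOrientableTriangulation hr hg, fun m L hL => ?_⟩, _, isPolyhedralEmbedding hr hc he,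
    halfTurn, isHalfTurn_halfTurn, isGeometricSymmetry_halfTurn _ (fun v : Fin 11 => D.position v) swapPairs
      (isIsomorphism_swapPairs hr hs) (position_swapPairs D)⟩
  simpa using eleven_le_card L hL

end SurfaceData

/-! ### The twenty-eight certificates and their verification -/

set_option maxHeartbeats 4000000 in
/-- Twenty-eight triangulated surfaces of genus four with eleven vertices. -/
def surfaces : List SurfaceData := [
  { links := [[5, 7, 10, 6, 8, 9], [2, 4, 7, 9, 6, 10, 8, 5, 3], [1, 3, 8, 10, 5, 9, 7, 6, 4], [1,
      5, 4, 6, 9, 10, 7, 8, 2], [1, 2, 6, 3, 5, 10, 9, 8, 7], [0, 9, 2, 10, 4, 3, 1, 8, 6, 7], [0,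
      10, 1, 9, 3, 4, 2, 7, 5, 8], [0, 5, 6, 2, 9, 1, 4, 8, 3, 10], [0, 6, 5, 1, 10, 2, 3, 7, 4,
      9], [0, 8, 4, 10, 3, 6, 1, 7, 2, 5], [0, 7, 3, 9, 4, 5, 2, 8, 1, 6]]
    triangles := [0x750, 0x860, 0x950, 0xa60, 0xa70, 0x980, 0x321, 0x421, 0x543, 0x643, 0x765,
      0x865, 0x873, 0x874, 0xa93, 0xa94, 0x531, 0x642, 0x961, 0xa52, 0xa61, 0x952, 0x851, 0x762,
      0x963, 0xa54, 0xa81, 0x972, 0xa73, 0x984, 0x741, 0x832, 0x971, 0xa82]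
    apex := -5
    positions := [(-4, 0, 5), (-1, 1, 1), (3, 4, -4), (-3, -1, 2), (2, -3, 0)]
    normals := [(5, 1, -5), (5, 1, 5), (1, 9, -4), (-1, -7, -4), (1, -4, 0), (2, 3, -5), (2, 3,
      5), (1, 0, 0), (-33, 25, 12), (33, -25, 12), (5, 3, 5), (5, 3, -5), (1, 5, 2), (3, -1, -1),
      (3, -1, 1), (2, 3, -3), (0, 1, -5), (1, -2, 0), (1, -4, 3), (1, 5, -1), (-1, 17, 5), (1,
      -17, 5), (2, 3, 3), (1, -4, -3), (1, 7, -4), (0, 1, 3), (3, 2, -5), (3, 2, 5), (-1, -9, -4),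
      (13, 14, 19), (-13, -14, 19), (3, -2, -2), (3, -2, 2), (4, 3, -1), (5, -1, -1), (5, -1, 1),
      (2, 3, -4), (2, 3, 4), (7, -3, 2), (-7, 3, 2), (1, -26, -6), (-1, 26, -6), (1, 2, 1), (2,
      -1, -1), (2, -1, 1), (4, 3, 1), (0, 5, -2), (0, 5, 2), (1, 5, -2)]
    invariant := 221930675079534660685479040 },
  { links := [[1, 9, 3, 8, 5, 2, 10, 4, 7, 6], [0, 6, 10, 8, 2, 7, 4, 9], [0, 5, 9, 7, 1, 8, 3,
      10], [0, 9, 6, 4, 5, 7, 10, 2, 8], [0, 10, 5, 3, 6, 8, 9, 1, 7], [0, 8, 6, 7, 3, 4, 10, 9,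
      2], [0, 7, 5, 8, 4, 3, 9, 10, 1], [0, 4, 1, 2, 9, 8, 10, 3, 5, 6], [0, 3, 2, 1, 10, 7, 9, 4,
      6, 5], [0, 1, 4, 8, 7, 2, 5, 10, 6, 3], [0, 2, 3, 7, 8, 1, 6, 9, 5, 4]]
    triangles := [0x721, 0x821, 0x543, 0x643, 0x765, 0x865, 0x987, 0xa87, 0xa95, 0xa96, 0x741,
      0x832, 0x910, 0xa20, 0x941, 0xa32, 0x610, 0x520, 0xa61, 0x952, 0xa81, 0x972, 0x930, 0xa40,
      0x963, 0xa54, 0xa73, 0x984, 0x753, 0x864, 0x830, 0x740, 0x850, 0x760]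
    apex := -8
    positions := [(6, -3, -2), (-3, 8, -9), (-7, 7, -7), (-4, 1, -1), (8, 6, 8)]
    normals := [(2, -3, -2), (2, -3, 2), (18, 35, 33), (4, 3, -3), (3, -1, -1), (3, 1, 3), (16,
      15, 8), (2, 1, -3), (5, 3, 4), (-18, -35, 33), (-16, -15, 8), (-7, -30, -27), (-3, -10, -8),
      (7, 29, -26), (3, 1, -2), (4, -6, 5), (7, 2, 4), (-5, -15, 13), (2, 1, -5), (2, 1, 5), (-4,
      6, 5), (4, 3, 3), (5, 3, -2), (1, 5, -4), (1, 2, 0), (1, 2, -3), (1, 2, 3), (5, 2, 4), (-7,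
      -2, 4), (6, 4, -5), (21, 22, 9), (-21, -22, 9), (3, -5, -4), (3, -5, 4), (3, 5, -5), (3, 5,
      5), (3, 9, 8), (-13, 16, 14), (13, -16, 14), (5, 22, -20), (2, 1, 1), (1, -2, -2), (1, -2,
      2), (4, 3, -2), (4, 3, 2), (2, 5, -1), (2, 5, 1), (-6, -4, -5)]
    invariant := 184054232788466143196410720 },
  { links := [[3, 6, 8, 10, 4, 5, 7, 9], [2, 5, 4, 9, 10, 8, 7, 6], [1, 6, 3, 10, 9, 7, 8, 5], [0,
      9, 5, 8, 4, 7, 10, 2, 6], [0, 10, 6, 7, 3, 8, 9, 1, 5], [0, 4, 1, 2, 8, 3, 9, 6, 10, 7], [0,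
      3, 2, 1, 7, 4, 10, 5, 9, 8], [0, 5, 10, 3, 4, 6, 1, 8, 2, 9], [0, 6, 9, 4, 3, 5, 2, 7, 1,
      10], [0, 7, 2, 10, 1, 4, 8, 6, 5, 3], [0, 8, 1, 9, 2, 3, 7, 5, 6, 4]]
    triangles := [0x521, 0x621, 0x743, 0x843, 0x965, 0xa65, 0x871, 0x872, 0xa91, 0xa92, 0x541,
      0x632, 0x761, 0x852, 0x941, 0xa32, 0xa81, 0x972, 0x853, 0x764, 0x630, 0x540, 0x930, 0xa40,
      0x953, 0xa64, 0xa73, 0x984, 0x970, 0xa80, 0x750, 0x860, 0xa75, 0x986]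
    apex := -4
    positions := [(-1, -1, 0), (5, 3, 5), (5, -6, -5), (-3, 1, -2), (4, 1, 1)]
    normals := [(1, 0, 0), (4, 18, 9), (-4, -18, 9), (2, 3, -3), (2, 3, 3), (3, 2, 0), (1, -3, 0),
      (7, 6, -6), (-7, -6, -6), (7, -8, 17), (-7, 8, 17), (-8, 2, -9), (8, -2, -9), (-11, 18, 7),
      (11, -18, 7), (1, -5, 0), (0, 1, -3), (13, -12, 27), (-13, 12, 27), (2, 2, -1), (0, 1, 3),
      (1, -3, -1), (1, -3, 1), (13, 11, 10), (-13, -11, 10), (4, 2, -3), (4, 2, 3), (5, 16, 12),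
      (4, 3, -4), (4, 3, 4), (-7, -5, 6), (7, 5, 6), (7, -10, 4), (9, 7, -8), (-9, -7, -8), (-8,
      6, -15), (8, -6, -15), (1, 3, -3), (1, 5, -2), (1, 5, 2), (1, 5, -3), (1, 5, 3), (5, 3, -3),
      (5, 3, 3), (-7, 10, 4), (16, 13, 13), (-16, -13, 13)]
    invariant := 188937033947114105344000000 },
  { links := [[3, 9, 7, 5, 4, 10, 8, 6], [2, 5, 7, 8, 4, 9, 10, 6], [1, 6, 8, 7, 3, 10, 9, 5], [0,
      6, 5, 10, 2, 7, 4, 8, 9], [0, 5, 6, 9, 1, 8, 3, 7, 10], [0, 7, 1, 2, 9, 8, 10, 3, 6, 4], [0,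
      8, 2, 1, 10, 7, 9, 4, 5, 3], [0, 9, 6, 10, 4, 3, 2, 8, 1, 5], [0, 10, 5, 9, 3, 4, 1, 7, 2,
      6], [0, 3, 8, 5, 2, 10, 1, 4, 6, 7], [0, 4, 7, 6, 1, 9, 2, 3, 5, 8]]
    triangles := [0x521, 0x621, 0x743, 0x843, 0x653, 0x654, 0x871, 0x872, 0xa91, 0xa92, 0x751,
      0x862, 0x941, 0xa32, 0x841, 0x732, 0xa61, 0x952, 0xa53, 0x964, 0x630, 0x540, 0x930, 0xa40,
      0x983, 0xa74, 0x750, 0x860, 0x985, 0xa76, 0x970, 0xa80, 0xa85, 0x976]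
    apex := 1
    positions := [(6, 6, 6), (-4, -1, 3), (-5, 1, 2), (2, 4, 4), (-2, 6, -5)]
    normals := [(11, 8, -4), (3, -3, 5), (5, -1, -1), (3, -3, -5), (2, 4, 5), (-4, -7, 11), (2, 0,
      1), (0, 1, -6), (0, 3, 2), (0, 3, 8), (2, 1, 1), (1, 3, -3), (6, 11, 18), (4, 1, -2), (0,
      -3, 8), (4, -3, -3), (0, -1, -6), (0, 3, 4), (2, 1, -1), (0, 3, -1), (3, -2, 3), (0, 3, -4),
      (1, 3, 3), (-11, -8, -4), (-9, 10, 15), (9, -10, 15), (51, 55, 61), (2, -3, -2), (2, -3, 2),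
      (3, 2, -3), (1, 3, -4), (8, 2, -5), (-8, -2, -5), (25, 8, -18), (-25, -8, -18), (-43, -46,
      51), (1, 0, -1), (1, 0, 1), (3, 0, 1), (2, -1, -4), (2, -1, 4), (1, 3, 4), (-1, -6, 4), (1,
      6, 4), (39, 29, -11), (-39, -29, -11), (43, 46, 51), (-51, -55, 61)]
    invariant := 188897705906570229760000000 },
  { links := [[3, 5, 10, 7, 4, 6, 9, 8], [2, 5, 7, 8, 10, 4, 9, 6], [1, 6, 8, 7, 9, 3, 10, 5], [0,
      8, 4, 7, 6, 10, 2, 9, 5], [0, 7, 3, 8, 5, 9, 1, 10, 6], [0, 3, 9, 4, 8, 6, 7, 1, 2, 10], [0,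
      4, 10, 3, 7, 5, 8, 2, 1, 9], [0, 10, 9, 2, 8, 1, 5, 6, 3, 4], [0, 9, 10, 1, 7, 2, 6, 5, 4,
      3], [0, 6, 1, 4, 5, 3, 2, 7, 10, 8], [0, 5, 2, 3, 6, 4, 1, 8, 9, 7]]
    triangles := [0x521, 0x621, 0x743, 0x843, 0x765, 0x865, 0x871, 0x872, 0xa97, 0xa98, 0x751,
      0x862, 0x961, 0xa52, 0x941, 0xa32, 0xa41, 0x932, 0xa81, 0x972, 0x763, 0x854, 0x830, 0x740,
      0xa70, 0x980, 0x530, 0x640, 0xa50, 0x960, 0x953, 0xa64, 0xa63, 0x954]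
    apex := -1
    positions := [(-4, -4, 4), (-4, 4, -5), (1, 3, 2), (-1, -2, 1), (5, 0, 0)]
    normals := [(1, 0, -5), (2, -5, 0), (3, 4, -2), (0, 3, 4), (3, 5, 3), (4, -5, 4), (4, -5, -4),
      (3, 1, 0), (-3, -15, 16), (10, 37, 35), (15, -20, -13), (-10, -37, 35), (-15, 20, -13), (0,
      1, 4), (2, -1, -2), (2, -1, 2), (17, -9, 10), (-6, 33, 31), (0, 1, -3), (-9, -4, -6), (3,
      12, 11), (6, -33, 31), (2, 3, -2), (3, 5, 1), (3, -1, -2), (5, -2, 1), (5, 3, -5), (5, 3,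
      5), (9, 4, -6), (-3, -12, 11), (25, -13, 16), (-25, 13, 16), (3, 5, -1), (-20, 27, -18),
      (20, -27, -18), (0, 2, -3), (1, -2, -3), (1, -2, 3), (3, -1, 2), (5, -2, -1), (1, 6, 6), (9,
      8, 4), (-9, -8, 4), (-18, 25, -16), (18, -25, -16)]
    invariant := 188898072759657505440000000 },
  { links := [[3, 7, 9, 5, 4, 8, 10, 6], [2, 6, 8, 3, 4, 9, 7, 10, 5], [1, 5, 7, 4, 3, 10, 8, 9,
      6], [0, 6, 9, 10, 2, 4, 1, 8, 7], [0, 5, 10, 9, 1, 3, 2, 7, 8], [0, 9, 8, 6, 7, 2, 1, 10,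
      4], [0, 10, 7, 5, 8, 1, 2, 9, 3], [0, 3, 8, 4, 2, 5, 6, 10, 1, 9], [0, 4, 7, 3, 1, 6, 5, 9,
      2, 10], [0, 7, 1, 4, 10, 3, 6, 2, 8, 5], [0, 8, 2, 3, 9, 4, 5, 1, 7, 6]]
    triangles := [0x431, 0x432, 0x765, 0x865, 0x521, 0x621, 0x873, 0x874, 0xa93, 0xa94, 0x630,
      0x540, 0x730, 0x840, 0x950, 0xa60, 0x970, 0xa80, 0x831, 0x742, 0x963, 0xa54, 0x941, 0xa32,
      0xa51, 0x962, 0x971, 0xa82, 0x861, 0x752, 0xa71, 0x982, 0x985, 0xa76]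
    apex := -2
    positions := [(5, -6, -7), (2, -1, 5), (1, 0, -6), (4, 7, 6), (1, -2, -1)]
    normals := [(2, -2, -5), (0, 5, -3), (6, 11, 3), (33, 12, 8), (1, 0, 5), (4, 3, -1), (1, -6,
      -3), (-17, -8, 4), (2, -3, 1), (-15, -8, -3), (5, 0, -3), (3, -2, -1), (3, 1, 2), (7, 12,
      -3), (1, 1, -3), (3, -2, 1), (2, 4, 3), (4, 3, 1), (1, 4, 0), (38, 15, -9), (5, 3, -1), (2,
      -3, -1), (1, 3, -3), (2, 4, -3), (5, 0, 3), (-7, -12, -3), (17, 8, 4), (-1, 6, -3), (-25,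
      -9, 6), (1, 1, 3), (2, -1, -3), (1, 3, 3), (2, 5, 0), (0, 5, 3), (-1, 1, -7), (1, -1, -7),
      (-2, 7, 3), (2, -7, 3), (-6, -11, 3), (-38, -15, -9), (1, 1, -1), (1, 1, 1), (1, -1, 2), (5,
      -1, -1), (5, -1, 1), (3, -4, -4), (3, -4, 4)]
    invariant := 174040788554136377231428706 },
  { links := [[3, 7, 9, 5, 4, 8, 10, 6], [2, 5, 7, 8, 4, 10, 9, 6], [1, 6, 8, 7, 3, 9, 10, 5], [0,
      6, 4, 5, 10, 8, 9, 2, 7], [0, 5, 3, 6, 9, 7, 10, 1, 8], [0, 9, 8, 6, 7, 1, 2, 10, 3, 4], [0,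
      10, 7, 5, 8, 2, 1, 9, 4, 3], [0, 3, 2, 8, 1, 5, 6, 10, 4, 9], [0, 4, 1, 7, 2, 6, 5, 9, 3,
      10], [0, 7, 4, 6, 1, 10, 2, 3, 8, 5], [0, 8, 3, 5, 2, 9, 1, 4, 7, 6]]
    triangles := [0x521, 0x621, 0x543, 0x643, 0x765, 0x865, 0x871, 0x872, 0xa91, 0xa92, 0x751,
      0x862, 0x961, 0xa52, 0x841, 0x732, 0xa41, 0x932, 0xa53, 0x964, 0x630, 0x540, 0x950, 0xa60,
      0x985, 0xa76, 0x730, 0x840, 0x983, 0xa74, 0x970, 0xa80, 0xa83, 0x974]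
    apex := 1
    positions := [(-1, 5, 5), (2, -2, 2), (1, -3, 4), (5, 4, 6), (3, 2, -5)]
    normals := [(-8, 4, 1), (1, 0, 5), (-3, 16, -3), (3, 0, -5), (1, 4, 4), (1, 5, -4), (1, -4,
      -1), (3, 0, 4), (7, -9, 0), (8, 11, 8), (-7, -10, 7), (2, -2, 1), (3, 2, 5), (4, -3, -2),
      (2, 1, -5), (4, -1, 1), (1, 4, 3), (-1, -30, 17), (4, 1, -1), (3, 2, -3), (2, -5, 2), (1,
      -1, -3), (1, 1, 4), (4, 1, 1), (8, -4, 1), (1, 30, 17), (2, -2, -1), (3, -1, -1), (0, 3,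
      -2), (0, 3, 2), (0, 1, -4), (0, 1, 4), (2, -5, -2), (1, -6, -1), (4, -5, -3), (4, -5, 3),
      (4, 5, -4), (0, -1, -10), (0, 1, -10), (2, 1, 0), (1, 1, -4), (4, 1, -3), (4, 1, 3), (2, 1,
      5), (4, 5, 4), (-6, -5, 3), (6, 5, 3)]
    invariant := 188913481162562900896000000 },
  { links := [[1, 7, 10, 4, 5, 2, 8, 9, 3, 6], [0, 6, 9, 4, 10, 8, 2, 7], [0, 5, 10, 3, 9, 7, 1,
      8], [0, 9, 2, 10, 7, 8, 5, 4, 6], [0, 10, 1, 9, 8, 7, 6, 3, 5], [0, 4, 3, 8, 6, 7, 9, 10,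
      2], [0, 3, 4, 7, 5, 8, 10, 9, 1], [0, 1, 2, 9, 5, 6, 4, 8, 3, 10], [0, 2, 1, 10, 6, 5, 3, 7,
      4, 9], [0, 8, 4, 1, 6, 10, 5, 7, 2, 3], [0, 7, 3, 2, 5, 9, 6, 8, 1, 4]]
    triangles := [0x721, 0x821, 0x543, 0x643, 0x765, 0x865, 0x873, 0x874, 0xa95, 0xa96, 0x710,
      0x820, 0x941, 0xa32, 0x961, 0xa52, 0x610, 0x520, 0xa41, 0x932, 0xa81, 0x972, 0x853, 0x764,
      0x630, 0x540, 0x975, 0xa86, 0x930, 0xa40, 0xa70, 0x980, 0xa73, 0x984]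
    apex := -7
    positions := [(2, -1, 1), (-7, -1, 7), (-2, -7, 5), (-2, 0, 6), (1, 5, 4)]
    normals := [(14, 3, 2), (1, -1, 5), (3, -1, 0), (1, -1, -5), (4, -1, -5), (12, -13, 5), (-11,
      2, -10), (-12, 13, 5), (-11, 2, 9), (2, -1, 4), (4, 3, -5), (4, 3, 5), (0, 1, -3), (0, 1,
      5), (1, -3, 0), (-1, 0, -6), (2, -1, -4), (4, -1, 5), (-11, -3, 2), (1, 0, -6), (6, -1, -6),
      (-1, 1, -6), (1, -9, -2), (7, -8, 3), (-7, 8, 3), (10, -11, 4), (-10, 11, 4), (1, 3, 0), (4,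
      -1, 0), (-6, 1, -6), (4, 9, 1), (-4, -9, 1), (11, 3, 2), (-13, -3, 2), (0, 1, 2), (1, -1,
      -6), (5, -4, -2), (5, -4, 2), (2, 0, -1), (2, 0, 1), (4, -1, -1), (4, -1, 1), (0, 1, -5),
      (5, 1, -1), (5, 1, 1), (1, -5, -5), (1, -5, 5), (-1, 8, -2), (-11, 12, 5), (11, -12, 5)]
    invariant := 184038267821594284367478720 },
  { links := [[1, 6, 3, 8, 10, 2, 5, 4, 7, 9], [0, 9, 4, 10, 8, 2, 7, 6], [0, 10, 3, 9, 7, 1, 8,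
      5], [0, 6, 4, 5, 9, 2, 10, 7, 8], [0, 5, 3, 6, 10, 1, 9, 8, 7], [0, 2, 8, 6, 7, 10, 9, 3,
      4], [0, 1, 7, 5, 8, 9, 10, 4, 3], [0, 4, 8, 3, 10, 5, 6, 1, 2, 9], [0, 3, 7, 4, 9, 6, 5, 2,
      1, 10], [0, 7, 2, 3, 5, 10, 6, 8, 4, 1], [0, 8, 1, 4, 6, 9, 5, 7, 3, 2]]
    triangles := [0x721, 0x821, 0x543, 0x643, 0x765, 0x865, 0x873, 0x874, 0xa95, 0xa96, 0x761,
      0x852, 0x910, 0xa20, 0x941, 0xa32, 0x610, 0x520, 0xa41, 0x932, 0xa81, 0x972, 0x953, 0xa64,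
      0x630, 0x540, 0xa75, 0x986, 0xa73, 0x984, 0x830, 0x740, 0x970, 0xa80]
    apex := -12
    positions := [(-3, -1, 4), (-5, -12, -13), (7, -5, -2), (-1, -1, -3), (-8, -3, 12)]
    normals := [(5, -2, -2), (5, -2, 2), (3, -7, 0), (-7, 19, 0), (1, -3, -2), (1, -3, 2), (1, 3,
      0), (3, 4, -3), (3, 4, 3), (4, -5, -4), (4, -5, 4), (16, 15, 4), (-16, -15, 4), (2, -1, 0),
      (5, -14, -1), (-5, 14, -1), (0, 1, -2), (0, 1, 2), (4, -3, -1), (4, -3, 1), (1, 1, -5),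
      (-97, -168, -103), (97, 168, -103), (5, 2, -1), (22, 6, 15), (-22, -6, 15), (2, 2, -1), (2,
      2, 1), (1, 1, 5), (5, 2, 1), (-4, 10, -1), (4, -10, -1), (1, -1, -1), (1, -1, 1), (1, -4,
      -2), (1, -4, 2), (4, -5, -1), (4, -5, 1), (1, -6, -3), (-1, 6, -3), (2, -3, -1), (2, -3, 1),
      (7, -3, -6), (-7, 3, -6), (11, -5, -9), (-11, 5, -9)]
    invariant := 184043390705139197837930760 },
  { links := [[3, 10, 6, 7, 4, 9, 5, 8], [2, 5, 4, 7, 8, 10, 9, 6], [1, 6, 3, 8, 7, 9, 10, 5], [0,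
      8, 2, 6, 4, 5, 9, 7, 10], [0, 7, 1, 5, 3, 6, 10, 8, 9], [0, 9, 3, 4, 1, 2, 10, 7, 6, 8], [0,
      10, 4, 3, 2, 1, 9, 8, 5, 7], [0, 6, 5, 10, 3, 9, 2, 8, 1, 4], [0, 5, 6, 9, 4, 10, 1, 7, 2,
      3], [0, 4, 8, 6, 1, 10, 2, 7, 3, 5], [0, 3, 7, 5, 2, 9, 1, 8, 4, 6]]
    triangles := [0x521, 0x621, 0x543, 0x643, 0x765, 0x865, 0x871, 0x872, 0xa91, 0xa92, 0x541,
      0x632, 0x741, 0x832, 0x961, 0xa52, 0xa81, 0x972, 0x973, 0xa84, 0xa73, 0x984, 0xa30, 0x940,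
      0xa75, 0x986, 0x830, 0x740, 0x850, 0x760, 0x950, 0xa60, 0x953, 0xa64]
    apex := 12
    positions := [(-1, 1, -4), (6, -6, -5), (6, -11, -10), (-11, -2, -3), (-3, 0, 0)]
    normals := [(3, -3, -4), (1, -3, 4), (3, 4, 0), (2, -21, -7), (-1, -3, -16), (0, 2, -5), (-1,
      -10, -11), (5, -1, 2), (1, 14, -15), (25, 23, 18), (-25, -23, 18), (3, 2, 0), (-8, 6, -5),
      (9, -7, -6), (-2, -21, -22), (1, -1, 1), (2, 1, -2), (-2, -1, -6), (1, -5, 0), (1, -6, -3),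
      (4, 5, 4), (1, 10, -11), (11, 93, -92), (-11, -93, -92), (2, 1, 2), (1, -5, 2), (5, 5, -4),
      (1, 0, -3), (1, 1, -2), (1, 1, 2), (2, -1, -1), (0, 1, -4), (0, 1, 4), (1, 5, 0), (-1, 6,
      -3), (5, 5, 4), (-1, 11, -4), (1, -14, -4), (-1, 14, -4), (-14, 10, -9), (14, -10, -9), (1,
      0, -1), (1, 0, 1), (2, 0, -1), (8, -6, -5), (-9, 7, -6)]
    invariant := 188915068236425850784000000 },
  { links := [[3, 9, 6, 7, 4, 10, 5, 8], [2, 5, 4, 9, 10, 8, 7, 6], [1, 6, 3, 10, 9, 7, 8, 5], [0,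
      8, 4, 7, 10, 2, 6, 5, 9], [0, 7, 3, 8, 9, 1, 5, 6, 10], [0, 10, 7, 9, 3, 6, 4, 1, 2, 8], [0,
      9, 8, 10, 4, 5, 3, 2, 1, 7], [0, 6, 1, 8, 2, 9, 5, 10, 3, 4], [0, 5, 2, 7, 1, 10, 6, 9, 4,
      3], [0, 3, 5, 7, 2, 10, 1, 4, 8, 6], [0, 4, 6, 8, 1, 9, 2, 3, 7, 5]]
    triangles := [0x521, 0x621, 0x743, 0x843, 0x653, 0x654, 0x871, 0x872, 0xa91, 0xa92, 0x541,
      0x632, 0x761, 0x852, 0x941, 0xa32, 0xa81, 0x972, 0xa73, 0x984, 0x830, 0x740, 0x930, 0xa40,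
      0x953, 0xa64, 0x975, 0xa86, 0x850, 0x760, 0xa50, 0x960, 0xa75, 0x986]
    apex := 14
    positions := [(-1, 0, -3), (14, 6, -13), (7, 5, -4), (1, -13, -2), (0, -3, 4)]
    normals := [(8, 7, -6), (9, -2, 6), (2, -5, -2), (-14, 3, 10), (14, 1, 0), (1, -2, 5), (4, 4,
      3), (2, -1, -4), (-12, 17, -7), (-1, 0, -9), (4, 0, 5), (12, 1, -2), (11, -12, -7), (1, -2,
      0), (2, 1, 1), (1, -3, 2), (-11, 11, -7), (2, -1, 0), (2, 2, -1), (5, -1, -4), (-14, -1,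
      -2), (2, 3, -2), (1, 5, 2), (1, 0, -7), (-9, 1, -7), (1, -2, -1), (2, 1, -1), (2, 2, 1),
      (-9, 2, 6), (25, -6, -20), (-25, 6, -20), (1, -2, 1), (4, 4, -3), (9, -1, -7), (14, 1, -3),
      (-11, 12, -7), (107, 1, -15), (-107, -1, -15), (188, 2, -27), (-188, -2, -27), (4, 5, -3),
      (4, 5, 3), (-1, 0, -7), (-8, -1, -2), (5, -7, -3), (-8, -7, -6)]
    invariant := 188898657873098622976000000 },
  { links := [[3, 6, 10, 8, 4, 5, 9, 7], [2, 5, 7, 8, 10, 4, 9, 6], [1, 6, 8, 7, 9, 3, 10, 5], [0,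
      7, 10, 2, 9, 8, 5, 4, 6], [0, 8, 9, 1, 10, 7, 6, 3, 5], [0, 4, 3, 8, 6, 7, 1, 2, 10, 9], [0,
      3, 4, 7, 5, 8, 2, 1, 9, 10], [0, 9, 2, 8, 1, 5, 6, 4, 10, 3], [0, 10, 1, 7, 2, 6, 5, 3, 9,
      4], [0, 5, 10, 6, 1, 4, 8, 3, 2, 7], [0, 6, 9, 5, 2, 3, 7, 4, 1, 8]]
    triangles := [0x521, 0x621, 0x543, 0x643, 0x765, 0x865, 0x871, 0x872, 0xa95, 0xa96, 0x751,
      0x862, 0x961, 0xa52, 0x941, 0xa32, 0xa41, 0x932, 0xa81, 0x972, 0x853, 0x764, 0x630, 0x540,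
      0x950, 0xa60, 0x730, 0x840, 0x970, 0xa80, 0xa73, 0x984, 0x983, 0xa74]
    apex := 5
    positions := [(-5, -3, -5), (3, -2, 0), (-5, 3, -2), (2, 3, -3), (-3, -5, 6)]
    normals := [(1, -1, -4), (1, -1, 3), (-11, 7, 0), (22, 25, -34), (-12, -17, -21), (-1, 21, 4),
      (3, -1, 0), (11, -9, -11), (6, -3, 5), (4, 3, 5), (8, 11, -14), (1, -21, 4), (4, 3, -5),
      (-7, -11, 0), (-6, 3, 5), (-6, 5, -6), (0, 1, -3), (1, 2, 3), (2, -3, 0), (3, 0, -2), (3, 0,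
      2), (0, 1, 7), (0, -1, 7), (1, 2, -3), (2, -1, -2), (2, -1, 2), (0, 1, 3), (3, 0, -1), (3,
      0, 1), (1, -3, -2), (1, -3, 2), (-1, 11, 2), (1, -11, 2), (1, -15, 3), (-1, 15, 3), (19, 21,
      -29), (-19, -21, -29), (-22, -25, -34), (1, -1, -2), (1, -3, 1), (1, -2, -3), (1, -2, 3),
      (1, 0, 4), (3, -2, -2), (3, -2, 2), (-9, 5, 8), (9, -5, 8)]
    invariant := 188913839448021606120000000 },
  { links := [[3, 6, 7, 10, 4, 5, 8, 9], [2, 5, 4, 7, 8, 10, 9, 6], [1, 6, 3, 8, 7, 9, 10, 5], [0,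
      9, 5, 10, 7, 4, 8, 2, 6], [0, 10, 6, 9, 8, 3, 7, 1, 5], [0, 4, 1, 2, 10, 3, 9, 7, 6, 8], [0,
      3, 2, 1, 9, 4, 10, 8, 5, 7], [0, 6, 5, 9, 2, 8, 1, 4, 3, 10], [0, 5, 6, 10, 1, 7, 2, 3, 4,
      9], [0, 8, 4, 6, 1, 10, 2, 7, 5, 3], [0, 7, 3, 5, 2, 9, 1, 8, 6, 4]]
    triangles := [0x521, 0x621, 0x743, 0x843, 0x765, 0x865, 0x871, 0x872, 0xa91, 0xa92, 0x541,
      0x632, 0x741, 0x832, 0x961, 0xa52, 0xa81, 0x972, 0x953, 0xa64, 0xa53, 0x964, 0x930, 0xa40,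
      0x975, 0xa86, 0x630, 0x540, 0x850, 0x760, 0xa70, 0x980, 0xa73, 0x984]
    apex := 2
    positions := [(5, 5, -5), (1, -2, -1), (-5, 1, 1), (-2, -1, -2), (2, -1, 5)]
    normals := [(1, -5, 0), (0, 1, -4), (4, 3, 1), (2, 5, 2), (2, 5, -2), (3, -3, -4), (3, -3, 4),
      (1, 4, 0), (2, 2, -1), (-17, -8, -40), (4, -5, 1), (-2, -11, -3), (2, 13, -4), (17, 8, -40),
      (2, 3, 1), (2, -1, -2), (2, 1, 2), (3, 2, 0), (1, 4, -2), (1, 4, 2), (10, 23, 6), (3, -4,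
      -3), (-5, -11, 3), (1, -2, 1), (3, -2, 0), (0, 1, 4), (4, -3, 4), (1, 3, 0), (1, 3, -1), (1,
      3, 1), (1, 5, 2), (3, -4, 3), (3, 4, -3), (3, 4, 3), (4, -3, -4), (3, 5, -3), (3, 5, 3),
      (-12, -29, 8), (12, 29, 8), (35, 83, 20), (-35, -83, 20), (2, -1, 2), (2, -3, 0), (1, 5,
      -2), (1, 6, -3), (-1, -6, -3), (-15, -38, 11), (15, 38, 11), (37, 88, 21), (-37, -88, 21)]
    invariant := 188929386312196078080000000 },
  { links := [[1, 7, 5, 4, 10, 2, 8, 6, 3, 9], [0, 9, 6, 10, 4, 8, 2, 7], [0, 10, 5, 9, 3, 7, 1,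
      8], [0, 6, 4, 5, 10, 8, 7, 2, 9], [0, 5, 3, 6, 9, 7, 8, 1, 10], [0, 7, 6, 8, 9, 2, 10, 3,
      4], [0, 8, 5, 7, 10, 1, 9, 4, 3], [0, 1, 2, 3, 8, 4, 9, 10, 6, 5], [0, 2, 1, 4, 7, 3, 10, 9,
      5, 6], [0, 3, 2, 5, 8, 10, 7, 4, 6, 1], [0, 4, 1, 6, 7, 9, 8, 3, 5, 2]]
    triangles := [0x721, 0x821, 0x543, 0x643, 0x765, 0x865, 0x873, 0x874, 0xa97, 0xa98, 0x710,
      0x820, 0x910, 0xa20, 0x961, 0xa52, 0x841, 0x732, 0xa41, 0x932, 0xa61, 0x952, 0xa53, 0x964,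
      0x930, 0xa40, 0x985, 0xa76, 0xa83, 0x974, 0x630, 0x540, 0x750, 0x860]
    apex := -4
    positions := [(-8, 1, 9), (2, 1, 7), (0, 5, 0), (-3, -8, 8), (6, -8, -8)]
    normals := [(5, 3, -1), (0, -1, 13), (1, 2, 0), (5, -2, 4), (5, 4, 3), (116, 54, -67), (4, -1,
      0), (5, 4, -3), (-116, -54, -67), (0, 1, 2), (-15, 1, 5), (15, -1, 5), (-19, 40, 29), (1,
      -1, 1), (0, 1, -2), (3, 4, -1), (11, -1, 2), (-17, 2, 3), (-7, -5, 3), (-145, -67, -84),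
      (145, 67, -84), (3, 2, -2), (3, 2, 2), (7, 5, 3), (0, 1, 13), (1, 0, -4), (2, 4, 1), (-9,
      -5, -5), (9, 5, -5), (-10, 21, -15), (2, 0, -1), (2, 0, 1), (1, 3, 2), (3, 3, 1), (2, 4,
      -1), (4, 3, 1), (16, -1, 4), (10, -21, -15), (40, -5, 7), (-40, 5, 7), (33, 16, 19), (-33,
      -16, 19), (0, 2, -1), (0, 2, 1), (1, 0, 2), (2, -1, -1), (6, 5, 4), (-6, -5, 4), (227, -29,
      38), (-227, 29, 38)]
    invariant := 184061181109602108930368680 },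
  { links := [[1, 6, 7, 3, 10, 2, 5, 8, 4, 9], [0, 9, 8, 2, 7, 4, 10, 6], [0, 10, 7, 1, 8, 3, 9,
      5], [0, 7, 9, 2, 8, 6, 4, 5, 10], [0, 8, 10, 1, 7, 5, 3, 6, 9], [0, 2, 9, 6, 10, 3, 4, 7,
      8], [0, 1, 10, 5, 9, 4, 3, 8, 7], [0, 6, 8, 5, 4, 1, 2, 10, 9, 3], [0, 5, 7, 6, 3, 2, 1, 9,
      10, 4], [0, 4, 6, 5, 2, 3, 7, 10, 8, 1], [0, 3, 5, 6, 1, 4, 8, 9, 7, 2]]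
    triangles := [0x721, 0x821, 0x543, 0x643, 0x965, 0xa65, 0x875, 0x876, 0xa97, 0xa98, 0x741,
      0x832, 0x910, 0xa20, 0x981, 0xa72, 0x610, 0x520, 0xa41, 0x932, 0xa61, 0x952, 0x973, 0xa84,
      0xa30, 0x940, 0xa53, 0x964, 0x730, 0x840, 0x863, 0x754, 0x850, 0x760]
    apex := 2
    positions := [(3, 2, -1), (-8, 8, 9), (6, -5, 8), (1, 3, -7), (-7, -8, -9)]
    normals := [(0, 1, -4), (5, 3, 0), (42, 43, -28), (3, 4, 3), (11, -13, -3), (3, -2, -2), (-27,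
      40, -16), (11, 3, 9), (-11, 13, -3), (5, -2, 3), (27, -40, -16), (1, 2, -1), (-11, -3, 9),
      (0, 1, 4), (-10, 3, 5), (6, 7, 2), (1, 5, -4), (1, 5, 4), (-6, -7, 2), (10, -3, 5), (-11,
      -8, -4), (5, -3, 4), (-9, 11, -3), (9, -11, -3), (1, -1, 0), (1, -1, -1), (2, 2, -3), (2, 2,
      3), (5, 0, -2), (5, 0, 2), (-7, -7, -6), (11, 8, -4), (0, 1, 0), (1, -1, -2), (1, -1, 2),
      (2, -2, -1), (2, -2, 1), (4, 1, -1), (4, 1, 1), (7, 7, -6), (10, 2, 9), (-10, -2, 9), (9,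
      -13, -5), (-9, 13, -5)]
    invariant := 184045220216395617994738560 },
  { links := [[3, 9, 5, 8, 4, 10, 6, 7], [2, 8, 5, 6, 3, 4, 9, 10, 7], [1, 7, 6, 5, 4, 3, 10, 9,
      8], [0, 7, 8, 10, 2, 4, 1, 6, 9], [0, 8, 7, 9, 1, 3, 2, 5, 10], [0, 9, 7, 10, 4, 2, 6, 1,
      8], [0, 10, 8, 9, 3, 1, 5, 2, 7], [0, 6, 2, 1, 10, 5, 9, 4, 8, 3], [0, 5, 1, 2, 9, 6, 10, 3,
      7, 4], [0, 3, 6, 8, 2, 10, 1, 4, 7, 5], [0, 4, 5, 7, 1, 9, 2, 3, 8, 6]]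
    triangles := [0x431, 0x432, 0x651, 0x652, 0x721, 0x821, 0x873, 0x874, 0xa91, 0xa92, 0x730,
      0x840, 0x930, 0xa40, 0x850, 0x760, 0x950, 0xa60, 0x631, 0x542, 0x851, 0x762, 0x941, 0xa32,
      0xa71, 0x982, 0x963, 0xa54, 0xa83, 0x974, 0x975, 0xa86, 0xa75, 0x986]
    apex := -3
    positions := [(1, 6, 10), (1, 2, -1), (-10, -12, 11), (9, -10, -11), (-4, 0, 2)]
    normals := [(2, -3, -5), (6, 1, -5), (66, -13, 35), (1, -2, 1), (3, -2, -1), (1, 19, 14), (3,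
      -2, 3), (1, -2, -1), (3, 2, 1), (-23, -4, -20), (-198, -31, 174), (-290, 47, 147), (8, 38,
      -39), (5, -2, 2), (-1, -19, 14), (4, -4, 3), (-1, 29, 21), (-4, -20, -21), (1, -28, 20), (2,
      -1, -2), (3, -1, 0), (1, 3, 2), (-26, 4, -13), (1, 3, -2), (-6, -1, -5), (-15, 7, 11), (26,
      -4, -13), (150, -241, 88), (3, 2, -1), (-1, 1, 13), (1, -1, 13), (-26, -4, 23), (26, 4, 23),
      (198, 31, 174), (-150, 241, 88), (290, -47, 147), (1, 1, -1), (0, 15, -11), (18, -8, 13),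
      (-18, 8, 13), (23, 4, -20), (-8, -38, -39), (158, -253, 92), (-158, 253, 92)]
    invariant := 174466133737500580384402566 },
  { links := [[1, 7, 6, 9, 3, 2, 8, 5, 10, 4], [0, 4, 9, 6, 10, 8, 2, 7], [0, 3, 10, 5, 9, 7, 1,
      8], [0, 9, 5, 4, 6, 8, 7, 10, 2], [0, 10, 6, 3, 5, 7, 8, 9, 1], [0, 8, 6, 7, 4, 3, 9, 2,
      10], [0, 7, 5, 8, 3, 4, 10, 1, 9], [0, 1, 2, 9, 10, 3, 8, 4, 5, 6], [0, 2, 1, 10, 9, 4, 7,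
      3, 6, 5], [0, 6, 1, 4, 8, 10, 7, 2, 5, 3], [0, 5, 2, 3, 7, 9, 8, 1, 6, 4]]
    triangles := [0x721, 0x821, 0x543, 0x643, 0x765, 0x865, 0x873, 0x874, 0xa97, 0xa98, 0x710,
      0x820, 0x941, 0xa32, 0x961, 0xa52, 0x410, 0x320, 0xa61, 0x952, 0xa81, 0x972, 0xa73, 0x984,
      0x863, 0x754, 0x850, 0x760, 0xa50, 0x960, 0x930, 0xa40, 0x953, 0xa64]
    apex := 4
    positions := [(-2, 5, 5), (-2, -2, -5), (-3, -5, -6), (5, -1, -4), (2, 0, -2)]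
    normals := [(1, 4, 0), (3, -2, -4), (3, -2, 4), (2, -3, 0), (1, 2, -4), (1, 2, 4), (6, 2, 3),
      (-6, -2, 3), (3, 4, -2), (3, 4, 2), (4, -3, 0), (-1, -8, 0), (-1, 28, -18), (1, -28, -18),
      (0, 1, -4), (5, -2, -5), (5, -2, 5), (4, 0, -1), (4, 0, 1), (0, 1, 4), (1, 0, -5), (1, 0,
      5), (12, 5, 6), (-12, -5, 6), (1, 1, -2), (1, 1, 2), (-1, 22, -13), (1, -22, -13), (24, 9,
      7), (-24, -9, 7), (2, -1, -1), (2, -1, 1), (1, 2, -2), (1, 2, 2), (5, 1, -2), (5, 1, 2), (2,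
      -1, -4), (2, -1, 4), (1, -1, -5), (1, -1, 5), (-9, -2, -4), (9, 2, -4), (9, 4, 5), (-9, -4,
      5)]
    invariant := 184044663314318129230020960 },
  { links := [[1, 7, 4, 9, 5, 2, 8, 3, 10, 6], [0, 6, 9, 4, 10, 8, 2, 7], [0, 5, 10, 3, 9, 7, 1,
      8], [0, 8, 7, 6, 4, 5, 9, 2, 10], [0, 7, 8, 5, 3, 6, 10, 1, 9], [0, 9, 3, 4, 8, 6, 7, 10,
      2], [0, 10, 4, 3, 7, 5, 8, 9, 1], [0, 1, 2, 9, 10, 5, 6, 3, 8, 4], [0, 2, 1, 10, 9, 6, 5, 4,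
      7, 3], [0, 4, 1, 6, 8, 10, 7, 2, 3, 5], [0, 3, 2, 5, 7, 9, 8, 1, 4, 6]]
    triangles := [0x721, 0x821, 0x543, 0x643, 0x765, 0x865, 0x873, 0x874, 0xa97, 0xa98, 0x710,
      0x820, 0x941, 0xa32, 0x961, 0xa52, 0x610, 0x520, 0xa41, 0x932, 0xa81, 0x972, 0x763, 0x854,
      0x830, 0x740, 0xa75, 0x986, 0xa30, 0x940, 0x950, 0xa60, 0x953, 0xa64]
    apex := 3
    positions := [(0, -5, 4), (-4, 1, -3), (-1, 0, -2), (4, 5, -4), (1, 1, -1)]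
    normals := [(-11, 9, 0), (1, 3, -4), (2, 1, 3), (1, -1, -3), (1, -3, 0), (1, -1, 5), (5, -1,
      -2), (13, -1, 6), (1, -4, 5), (1, 3, 4), (3, 2, -2), (-11, 0, 2), (-1, 5, 9), (7, -8, -4),
      (4, -2, 1), (5, -2, -2), (-1, 6, -13), (3, -4, 3), (-6, 7, -4), (3, 2, 2), (3, 0, 4), (-16,
      14, 1), (27, 1, 6), (-40, -5, 26), (2, 1, -3), (3, 2, -1), (1, 0, -4), (1, 5, 0), (3, -4,
      -3), (1, -6, -13), (3, 2, 1), (1, 5, -4), (1, 5, 4), (1, 0, 9), (-1, 0, 9), (-13, 1, 6),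
      (32, 4, 21), (0, 1, 3), (1, 5, -1), (1, 5, 1), (0, 3, -7), (11, 0, 2), (71, 8, 46), (-71,
      -8, 46)]
    invariant := 184044533277106438072788960 },
  { links := [[1, 4, 5, 8, 10, 2, 3, 6, 7, 9], [0, 9, 6, 10, 8, 2, 7, 4], [0, 10, 5, 9, 7, 1, 8,
      3], [0, 2, 8, 7, 10, 9, 5, 4, 6], [0, 1, 7, 8, 9, 10, 6, 3, 5], [0, 4, 3, 9, 2, 10, 7, 6,
      8], [0, 3, 4, 10, 1, 9, 8, 5, 7], [0, 6, 5, 10, 3, 8, 4, 1, 2, 9], [0, 5, 6, 9, 4, 7, 3, 2,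
      1, 10], [0, 7, 2, 5, 3, 10, 4, 8, 6, 1], [0, 8, 1, 6, 4, 9, 3, 7, 5, 2]]
    triangles := [0x721, 0x821, 0x543, 0x643, 0x765, 0x865, 0x873, 0x874, 0xa93, 0xa94, 0x741,
      0x832, 0x910, 0xa20, 0x961, 0xa52, 0x410, 0x320, 0xa61, 0x952, 0xa81, 0x972, 0x953, 0xa64,
      0x630, 0x540, 0xa73, 0x984, 0xa75, 0x986, 0x850, 0x760, 0x970, 0xa80]
    apex := 9
    positions := [(-10, -1, -10), (6, 4, 11), (12, 10, 6), (7, 6, 0), (-11, 11, 12)]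
    normals := [(5, 1, 0), (1, -3, -4), (1, -3, 4), (-11, 13, 1), (9, -11, 1), (-3, 35, 19), (-1,
      -1, -120), (3, -35, 19), (3, 4, -4), (5, -4, -3), (5, -4, 3), (-4, 0, 15), (3, 2, 4), (27,
      9, -4), (26, -30, 3), (1, -4, 2), (-11, 16, 5), (-28, -9, -4), (8, 0, 29), (1, 1, -120), (5,
      -7, 2), (-25, 29, 3), (1, -3, -1), (11, -13, 0), (-16, 28, -7), (16, -28, -7), (-143, 171,
      -3), (143, -171, -3), (1, 0, 0), (1, 1, 1), (1, 2, 0), (-2, 0, 7), (1, -9, 5), (-1, 9, 5),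
      (-27, -9, -4), (1, -1, -1), (1, -1, 1), (3, -4, 0), (3, -32, 17), (-3, 32, 17)]
    invariant := 184043256378814220978779560 },
  { links := [[3, 7, 9, 5, 4, 8, 10, 6], [2, 3, 6, 8, 7, 10, 5, 9, 4], [1, 4, 5, 7, 8, 9, 6, 10,
      3], [0, 6, 1, 2, 10, 9, 8, 4, 7], [0, 5, 2, 1, 9, 10, 7, 3, 8], [0, 9, 1, 10, 8, 6, 7, 2,
      4], [0, 10, 2, 9, 7, 5, 8, 1, 3], [0, 3, 4, 10, 1, 8, 2, 5, 6, 9], [0, 4, 3, 9, 2, 7, 1, 6,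
      5, 10], [0, 7, 6, 2, 8, 3, 10, 4, 1, 5], [0, 8, 5, 1, 7, 4, 9, 3, 2, 6]]
    triangles := [0x743, 0x843, 0x765, 0x865, 0x321, 0x421, 0x871, 0x872, 0xa93, 0xa94, 0x630,
      0x540, 0x730, 0x840, 0x950, 0xa60, 0x970, 0xa80, 0x631, 0x542, 0x983, 0xa74, 0x941, 0xa32,
      0x951, 0xa62, 0x861, 0x752, 0xa51, 0x962, 0xa71, 0x982, 0xa85, 0x976]
    apex := 7
    positions := [(-8, 4, -8), (7, 6, 6), (-5, -2, -1), (-3, 0, -2), (0, 8, 8)]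
    normals := [(2, 5, -3), (-5, -10, -7), (5, -3, 0), (-3, 7, -7), (3, -7, -7), (4, 2, -1), (1,
      0, -4), (1, -21, 16), (5, -2, 4), (5, -2, 0), (1, 23, 18), (1, -3, 0), (5, -2, -4), (1, 3,
      0), (3, 5, -5), (1, 0, 4), (1, -5, -4), (35, -39, 12), (-35, 39, 12), (9, 17, -12), (2, 5,
      3), (-1, -23, 18), (2, 3, 0), (1, -5, 4), (-1, 13, 9), (1, -2, -5), (-17, 20, -6), (17, -20,
      -6), (2, -2, 1), (1, -2, 5), (4, -4, -5), (4, -4, 5), (3, -1, 9), (-3, 1, 9), (5, 1, 9),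
      (-5, -1, 9), (-7, -15, 10), (7, 15, 10), (-9, -17, -12), (2, -2, -1), (3, -1, -1), (3, -1,
      1), (2, 3, 3), (-7, 1, 4), (7, -1, 4), (5, 10, -7)]
    invariant := 174040515975379602410598416 },
  { links := [[3, 6, 10, 8, 4, 5, 9, 7], [2, 8, 6, 3, 4, 9, 5, 10, 7], [1, 7, 5, 4, 3, 10, 6, 9,
      8], [0, 7, 8, 9, 10, 2, 4, 1, 6], [0, 8, 7, 10, 9, 1, 3, 2, 5], [0, 4, 2, 7, 6, 8, 10, 1,
      9], [0, 3, 1, 8, 5, 7, 9, 2, 10], [0, 9, 6, 5, 2, 1, 10, 4, 8, 3], [0, 10, 5, 6, 1, 2, 9, 3,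
      7, 4], [0, 5, 1, 4, 10, 3, 8, 2, 6, 7], [0, 6, 2, 3, 9, 4, 7, 1, 5, 8]]
    triangles := [0x431, 0x432, 0x765, 0x865, 0x721, 0x821, 0x873, 0x874, 0xa93, 0xa94, 0x630,
      0x540, 0x730, 0x840, 0x950, 0xa60, 0x970, 0xa80, 0x631, 0x542, 0x983, 0xa74, 0x941, 0xa32,
      0x951, 0xa62, 0x861, 0x752, 0xa51, 0x962, 0xa71, 0x982, 0xa85, 0x976]
    apex := -2
    positions := [(-7, -3, 7), (1, -7, -7), (-6, 2, 4), (-3, -1, 3), (-1, -5, -3)]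
    normals := [(1, -4, -2), (1, -4, 2), (-18, -3, -10), (1, 0, -2), (-40, -7, 22), (1, 0, 2), (2,
      -1, 0), (-27, 5, -14), (-15, 4, 9), (0, 1, -4), (31, 22, 24), (3, 1, -3), (-7, 19, -14),
      (-29, -20, 22), (3, 1, 3), (1, 2, 2), (1, -11, 4), (7, -19, -14), (-1, 11, 4), (1, 2, -2),
      (4, 2, 3), (12, -4, 7), (1, 16, -10), (-1, -16, -10), (-8, -1, -4), (8, 1, -4), (-5, 12, 0),
      (-12, 4, 7), (-7, -20, -38), (7, 20, -38), (0, 1, 4), (4, 2, -3), (3, -5, -3), (3, -5, 3),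
      (16, 9, 20), (-16, -9, 20), (22, 13, 28), (-22, -13, 28), (0, 1, 0), (7, -2, 4), (-7, 2, 4),
      (18, 3, -10), (-19, -3, -10)]
    invariant := 173995364381590379072017400 },
  { links := [[1, 9, 8, 4, 5, 2, 10, 7, 3, 6], [0, 6, 10, 8, 2, 7, 4, 9], [0, 5, 9, 7, 1, 8, 3,
      10], [0, 7, 9, 10, 2, 8, 5, 4, 6], [0, 8, 10, 9, 1, 7, 6, 3, 5], [0, 4, 3, 8, 7, 10, 6, 9,
      2], [0, 3, 4, 7, 8, 9, 5, 10, 1], [0, 10, 5, 8, 6, 4, 1, 2, 9, 3], [0, 9, 6, 7, 5, 3, 2, 1,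
      10, 4], [0, 1, 4, 10, 3, 7, 2, 5, 6, 8], [0, 2, 3, 9, 4, 8, 1, 6, 5, 7]]
    triangles := [0x721, 0x821, 0x543, 0x643, 0x965, 0xa65, 0x875, 0x876, 0xa93, 0xa94, 0x741,
      0x832, 0x910, 0xa20, 0x941, 0xa32, 0x610, 0x520, 0xa61, 0x952, 0xa81, 0x972, 0x853, 0x764,
      0x630, 0x540, 0xa75, 0x986, 0xa70, 0x980, 0x730, 0x840, 0x973, 0xa84]
    apex := 7
    positions := [(-5, -3, -6), (1, 7, -8), (7, -4, -4), (-2, 5, -5), (3, -2, 0)]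
    normals := [(5, 1, -2), (5, 3, 3), (11, 18, -1), (2, -13, -6), (8, -7, 31), (-2, 15, -7), (-8,
      7, 31), (3, 5, 1), (0, 1, -10), (3, 2, -3), (4, -1, 3), (-5, -6, 4), (-7, -11, -11), (0, -1,
      -10), (1, -2, 0), (4, -1, -3), (-9, -15, 14), (4, 0, 1), (2, -15, -7), (-5, -12, -12), (5,
      12, -12), (1, 1, 2), (5, 6, 4), (3, 7, -6), (-2, 10, -5), (-3, -7, -6), (-7, -12, 0), (1, 1,
      -2), (0, 1, -3), (0, 1, 3), (0, 3, -1), (0, 3, 1), (3, 2, 3), (2, -6, -3), (-2, 6, -3), (4,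
      5, -4), (4, 5, 4), (2, -10, -5), (1, 0, -3), (1, 0, 3), (4, 1, -2), (4, 1, 2), (-2, 13, -6),
      (3, -20, -9), (-3, 20, -9), (9, 15, 14)]
    invariant := 184043256257830345250044680 },
  { links := [[1, 7, 10, 6, 3, 2, 8, 9, 5, 4], [0, 4, 9, 6, 10, 8, 2, 7], [0, 3, 10, 5, 9, 7, 1,
      8], [0, 6, 4, 5, 8, 7, 9, 10, 2], [0, 5, 3, 6, 7, 8, 10, 9, 1], [0, 9, 2, 10, 7, 6, 8, 3,
      4], [0, 10, 1, 9, 8, 5, 7, 4, 3], [0, 1, 2, 9, 3, 8, 4, 6, 5, 10], [0, 2, 1, 10, 4, 7, 3, 5,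
      6, 9], [0, 8, 6, 1, 4, 10, 3, 7, 2, 5], [0, 7, 5, 2, 3, 9, 4, 8, 1, 6]]
    triangles := [0x721, 0x821, 0x543, 0x643, 0x765, 0x865, 0x873, 0x874, 0xa93, 0xa94, 0x710,
      0x820, 0x941, 0xa32, 0x961, 0xa52, 0x410, 0x320, 0xa61, 0x952, 0xa81, 0x972, 0x853, 0x764,
      0x630, 0x540, 0x973, 0xa84, 0x950, 0xa60, 0xa70, 0x980, 0xa75, 0x986]
    apex := -7
    positions := [(-2, 2, 0), (7, 8, 7), (7, -4, 6), (3, -2, 5), (-3, -4, 3)]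
    normals := [(1, 0, 11), (-16, 1, -4), (5, -4, 0), (1, -1, -5), (2, -13, 5), (-1, -1, 6), (-2,
      13, 5), (3, 2, 15), (3, -2, -4), (1, -3, 5), (3, -2, 5), (1, 2, 4), (1, 3, 0), (2, -9, 4),
      (-2, 9, 4), (2, 1, -1), (2, 0, 5), (15, -1, -4), (4, 1, 4), (-1, 0, 6), (2, -1, -4), (1, -4,
      -4), (2, -5, 2), (4, 1, -4), (-1, 9, 3), (1, -9, 3), (2, 1, 1), (3, -3, -1), (3, 4, 0), (3,
      5, -1), (14, 16, 1), (-14, -16, 1), (1, -1, 4), (2, -5, -2), (-7, 1, -2), (1, 0, 16), (-1,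
      0, 16), (3, 2, 19), (1, -1, 1), (0, 1, -3), (3, -1, -1), (3, -1, 1), (1, 2, -3), (3, 5, 1),
      (7, -1, -2), (2, 1, -10), (-1, 10, 4), (1, -10, 4)]
    invariant := 184038269616897386655798720 },
  { links := [[3, 7, 5, 10, 4, 8, 6, 9], [2, 8, 3, 6, 10, 5, 4, 9, 7], [1, 7, 4, 5, 9, 6, 3, 10,
      8], [0, 9, 10, 2, 6, 1, 8, 4, 7], [0, 10, 9, 1, 5, 2, 7, 3, 8], [0, 7, 6, 8, 9, 2, 4, 1,
      10], [0, 8, 5, 7, 10, 1, 3, 2, 9], [0, 3, 4, 2, 1, 9, 8, 10, 6, 5], [0, 4, 3, 1, 2, 10, 7,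
      9, 5, 6], [0, 6, 2, 5, 8, 7, 1, 4, 10, 3], [0, 5, 1, 6, 7, 8, 2, 3, 9, 4]]
    triangles := [0x743, 0x843, 0x765, 0x865, 0x721, 0x821, 0x987, 0xa87, 0xa93, 0xa94, 0x730,
      0x840, 0x930, 0xa40, 0x631, 0x542, 0x831, 0x742, 0x541, 0x632, 0x941, 0xa32, 0xa51, 0x962,
      0x971, 0xa82, 0xa61, 0x952, 0x750, 0x860, 0x985, 0xa76, 0xa50, 0x960]
    apex := 3
    positions := [(2, 2, 6), (-2, -4, 2), (-6, -3, -3), (-8, 1, -11), (-11, -10, 11)]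
    normals := [(-16, 11, -9), (16, -11, -9), (-11, 12, 0), (0, 5, -2), (0, 2, 3), (0, 5, 2),
      (-23, 21, 8), (-16, 21, -9), (11, -7, -7), (-12, 7, -8), (11, -15, -3), (73, -63, 30), (-20,
      27, -6), (1, 2, -2), (17, -13, -8), (7, -9, -4), (-2, -13, 7), (2, 13, 7), (2, -5, 5), (0,
      1, 0), (1, 2, 2), (21, -15, 13), (-6, 8, 3), (-17, 13, -8), (-21, 15, 13), (-17, 34, 21),
      (17, -34, 21), (-36, 31, 15), (12, -13, 3), (1, 0, 0), (6, -8, 3), (13, -6, -8), (-13, 6,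
      -8), (34, -35, -18), (64, -65, 34), (2, 1, -2), (2, 1, 2), (1, 10, 5), (-1, -10, 5), (-12,
      13, 3), (25, -33, -7), (-25, 33, -7), (2, -3, -2), (3, -5, -2), (3, -5, 2), (5, -5, 2), (11,
      -10, 4), (-2, -15, -8), (2, 15, -8), (16, -21, -9), (-26, 22, 11), (-64, 65, 34)]
    invariant := 174904539520487630826155776 },
  { links := [[1, 5, 10, 3, 7, 2, 6, 9, 4, 8], [0, 8, 9, 10, 4, 7, 6, 2, 5], [0, 7, 10, 9, 3, 8,
      5, 1, 6], [0, 10, 8, 2, 9, 5, 4, 6, 7], [0, 9, 7, 1, 10, 6, 3, 5, 8], [0, 1, 2, 8, 4, 3, 9,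
      6, 10], [0, 2, 1, 7, 3, 4, 10, 5, 9], [0, 3, 6, 1, 4, 9, 8, 10, 2], [0, 4, 5, 2, 3, 10, 7,
      9, 1], [0, 6, 5, 3, 2, 10, 1, 8, 7, 4], [0, 5, 6, 4, 1, 9, 2, 7, 8, 3]]
    triangles := [0x521, 0x621, 0x543, 0x643, 0x965, 0xa65, 0x987, 0xa87, 0xa91, 0xa92, 0x510,
      0x620, 0x810, 0x720, 0x981, 0xa72, 0x741, 0x832, 0x761, 0x852, 0xa41, 0x932, 0x730, 0x840,
      0x763, 0x854, 0xa83, 0x974, 0x953, 0xa64, 0xa30, 0x940, 0xa50, 0x960]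
    apex := -3
    positions := [(2, -2, -2), (-3, 2, -6), (1, 5, 7), (-5, 1, 1), (-6, 1, 6)]
    normals := [(5, 7, -3), (-2, 7, 0), (-5, -7, -3), (4, -1, -4), (1, 3, 0), (4, -1, 4), (-19,
      -16, 10), (19, 16, 10), (2, 1, 0), (2, 5, -2), (2, 5, 2), (4, -5, 0), (-26, -39, 22), (26,
      39, 22), (1, -5, 0), (2, -5, 0), (-1, 0, 10), (-3, -16, 0), (1, 4, 3), (1, 5, -3), (19, 18,
      12), (-19, -18, 12), (-6, -28, 1), (6, 28, 1), (-14, -30, -3), (4, 5, -2), (4, 5, 2), (0, 2,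
      1), (2, 0, -1), (2, 0, 1), (1, 5, -1), (1, 5, 1), (2, 5, -1), (2, 5, 1), (1, 0, 10), (14,
      30, -3), (28, 27, -18), (-28, -27, -18), (4, 5, -4), (4, 5, 4), (4, 6, -3), (-4, -6, -3),
      (1, 9, -2), (-1, -9, -2), (-9, -8, 5), (9, 8, 5), (-21, -44, -5), (21, 44, -5)]
    invariant := 165015527388876025996798368 },
  { links := [[1, 8, 4, 5, 10, 2, 7, 3, 6, 9], [0, 9, 7, 4, 10, 6, 2, 5, 8], [0, 10, 8, 3, 9, 5,
      1, 6, 7], [0, 7, 10, 4, 9, 2, 8, 5, 6], [0, 8, 9, 3, 10, 1, 7, 6, 5], [0, 4, 6, 3, 8, 1, 2,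
      9, 10], [0, 3, 5, 4, 7, 2, 1, 10, 9], [0, 2, 6, 4, 1, 9, 8, 10, 3], [0, 1, 5, 3, 2, 10, 7,
      9, 4], [0, 6, 10, 5, 2, 3, 4, 8, 7, 1], [0, 5, 9, 6, 1, 4, 3, 7, 8, 2]]
    triangles := [0x521, 0x621, 0x943, 0xa43, 0x653, 0x654, 0x987, 0xa87, 0xa95, 0xa96, 0x851,
      0x762, 0x810, 0x720, 0x910, 0xa20, 0x971, 0xa82, 0x741, 0x832, 0xa41, 0x932, 0xa61, 0x952,
      0x630, 0x540, 0x730, 0x840, 0xa50, 0x960, 0x853, 0x764, 0xa73, 0x984]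
    apex := -5
    positions := [(-7, 6, -7), (0, -1, -4), (2, -2, -6), (7, 6, 8), (-4, 1, 6)]
    normals := [(1, 3, 0), (0, 1, -5), (3, 4, 0), (23, -8, -9), (-26, -28, -13), (-23, 8, -9),
      (-20, -21, 11), (1, -5, -2), (1, -5, 2), (12, -3, 5), (-20, 4, 9), (1, -2, -5), (-17, -29,
      27), (15, 19, 4), (-7, -12, -11), (-10, -12, 3), (-6, -5, -3), (-29, -30, -29), (2, 3, 0),
      (4, -5, 3), (11, 9, -10), (-7, -23, -3), (7, 23, -3), (-119, 38, -47), (119, -38, -47), (0,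
      2, -1), (-5, -6, 0), (6, 5, -3), (10, 12, 3), (1, -1, -1), (0, 1, 4), (4, 5, -5), (1, -1,
      0), (2, 1, 0), (2, -2, -1), (-7, 2, 3), (7, 8, -1), (-11, -9, -10), (13, 17, 2), (-13, -17,
      2), (-15, -19, 4)]
    invariant := 165020094140048325378102996 },
  { links := [[1, 5, 10, 3, 8, 2, 6, 9, 4, 7], [0, 7, 8, 9, 10, 4, 6, 2, 5], [0, 8, 7, 10, 9, 3,
      5, 1, 6], [0, 10, 6, 5, 2, 9, 7, 4, 8], [0, 9, 5, 6, 1, 10, 8, 3, 7], [0, 1, 2, 3, 6, 4, 9,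
      8, 10], [0, 2, 1, 4, 5, 3, 10, 7, 9], [0, 4, 3, 9, 6, 10, 2, 8, 1], [0, 3, 4, 10, 5, 9, 1,
      7, 2], [0, 6, 7, 3, 2, 10, 1, 8, 5, 4], [0, 5, 8, 4, 1, 9, 2, 7, 6, 3]]
    triangles := [0x521, 0x621, 0x743, 0x843, 0x653, 0x654, 0x871, 0x872, 0xa91, 0xa92, 0x510,
      0x620, 0x981, 0xa72, 0x710, 0x820, 0x641, 0x532, 0xa41, 0x932, 0x830, 0x740, 0x973, 0xa84,
      0xa85, 0x976, 0x985, 0xa76, 0xa50, 0x960, 0xa30, 0x940, 0xa63, 0x954]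
    apex := -6
    positions := [(-4, -3, -2), (6, -3, 7), (-1, -1, -1), (2, 7, -7), (-1, 2, 3)]
    normals := [(-8, 2, -5), (8, -2, -5), (2, 3, 0), (-10, 13, 1), (14, 37, -22), (-14, -37, -22),
      (3, -4, 2), (4, -1, 0), (1, -2, -4), (-2, 6, -5), (2, -6, -5), (3, 2, -2), (4, -5, -4), (2,
      1, 1), (-5, 8, -7), (8, -11, 1), (28, -69, -52), (-8, -2, 3), (2, -1, -1), (1, 3, -1), (1,
      3, 1), (2, 2, 3), (2, -3, 3), (3, 5, -3), (3, 5, 3), (-28, 69, -52), (4, -1, -3), (8, 2, 3),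
      (-1, -32, 7), (2, 0, 1), (1, 2, -2), (2, -4, -3), (2, -4, 3), (-9, 3, -5), (9, -3, -5), (5,
      -8, -7), (1, 23, 5), (-1, -23, 5), (1, 32, 7), (2, 0, -1), (1, -2, -1), (4, -1, 3), (4, 8,
      5), (-4, -8, 5), (-8, 11, 1)]
    invariant := 165015506713757111648635392 },
  { links := [[1, 7, 6, 4, 9, 2, 8, 5, 3, 10], [0, 10, 6, 2, 5, 8, 9, 4, 7], [0, 9, 5, 1, 6, 7,
      10, 3, 8], [0, 5, 6, 9, 7, 4, 8, 2, 10], [0, 6, 5, 10, 8, 3, 7, 1, 9], [0, 8, 1, 2, 9, 10,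
      4, 6, 3], [0, 7, 2, 1, 10, 9, 3, 5, 4], [0, 1, 4, 3, 9, 8, 10, 2, 6], [0, 2, 3, 4, 10, 7, 9,
      1, 5], [0, 4, 1, 8, 7, 3, 6, 10, 5, 2], [0, 3, 2, 7, 8, 4, 5, 9, 6, 1]]
    triangles := [0x521, 0x621, 0x743, 0x843, 0x653, 0x654, 0x987, 0xa87, 0xa95, 0xa96, 0x851,
      0x762, 0x981, 0xa72, 0xa10, 0x920, 0xa61, 0x952, 0x710, 0x820, 0x741, 0x832, 0x941, 0xa32,
      0x530, 0x640, 0xa30, 0x940, 0x850, 0x760, 0x963, 0xa54, 0x973, 0xa84]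
    apex := -1
    positions := [(2, -4, -5), (1, 0, 2), (3, 1, 4), (-3, -4, 6), (5, -5, 5)]
    normals := [(5, 2, -2), (5, 2, 2), (5, 4, -1), (1, -1, 13), (3, 5, 3), (3, 0, -2), (3, 0, 2),
      (1, 4, -2), (1, -4, -2), (4, 12, -15), (9, 0, -4), (-9, 0, -4), (1, 4, 5), (1, -4, 2), (-4,
      -11, -14), (1, 4, -5), (5, 4, 1), (-18, -5, 5), (18, 5, 5), (2, 1, -4), (2, 1, 4), (-1, 1,
      13), (1, 4, 2), (5, 1, -3), (5, 1, 3), (8, 1, -4), (-8, -1, -4), (2, 3, -3), (5, -4, -2),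
      (5, -4, 2), (3, 2, -1), (3, 2, 1), (1, -5, -1), (1, 5, 6), (-1, -5, 6), (1, 2, 0), (3, 2,
      0), (1, -5, 1), (-13, -3, 4), (13, 3, 4), (-15, -4, 4), (15, 4, 4), (3, 10, 13)]
    invariant := 165015527037470138715744672 }]

set_option maxHeartbeats 4000000 in
set_option maxRecDepth 100000 in
theorem isValid_of_mem_surfaces : ∀ D ∈ surfaces, D.isValid = true := by
  have h : surfaces.all SurfaceData.isValid = true := by decide +kernel
  exact List.all_eq_true.1 h

theorem length_surfaces : surfaces.length = 28 := rfl

/-- The stored numbers are genuine invariants of the complexes by `triangleInvariant_eq`, so their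
distinctness rules out isomorphisms. -/
theorem nodup_invariant_surfaces : (surfaces.map SurfaceData.invariant).Nodup := by
  decide +kernel

theorem injective_invariant_surfaces :
    Function.Injective fun i : Fin 28 =>
      (surfaces[i.val]'(i.2.trans_eq length_surfaces.symm)).invariant := by
  intro i j hij
  have h := nodup_invariant_surfaces.getElem_inj_iff (i := i.val) (hi := by simp [length_surfaces])
    (j := j.val) (hj := by simp [length_surfaces])
  exact Fin.ext (h.1 (by simpa using hij))

end TriangulatedSurface

end

/-! ### Twenty-eight non-isomorphic symmetric polyhedral surfaces -/

theorem theorem10 :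
    ∃ T : Fin 28 → AbstractSimplicialComplex (Fin 11),
      (∀ i, TriangulatedSurface.IsVertexMinimalTriangulation (T i) 4) ∧
      (∀ i j, i ≠ j → ¬ TriangulatedSurface.Isomorphic (T i) (T j)) ∧
      ∀ i, ∃ ψ : Fin 11 → TriangulatedSurface.E3,
        TriangulatedSurface.IsPolyhedralEmbedding (T i) ψ ∧
        ∃ R : TriangulatedSurface.E3 ≃ᵃⁱ[ℝ] TriangulatedSurface.E3,
          TriangulatedSurface.IsHalfTurn R ∧
          TriangulatedSurface.IsGeometricSymmetry (T i) ψ R := by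
  choose T hinv hT hψ using fun i : Fin 28 => TriangulatedSurface.SurfaceData.exists_complex
    (TriangulatedSurface.isValid_of_mem_surfaces _ (List.getElem_mem
      (i.2.trans_eq TriangulatedSurface.length_surfaces.symm)))
  refine ⟨T, hT, fun i j hij h => hij ?_, hψ⟩
  apply TriangulatedSurface.injective_invariant_surfaces
  have h1 := TriangulatedSurface.triangleInvariant_eq_of_isomorphic h
  rwa [hinv, hinv] at h1
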